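/- Let $\omega_1,\omega_2\in\mathbb C$ be $\mathbb R$-linearly independent, $\Omega=\mathbb Z\omega_1\oplus\mathbb Z\omega_2$, let $\sigma(u;\Omega)=u\prod_{\omega\in\Omega\setminus\{0\}}(1-\frac u\omega)e^{\frac u\omega+\frac{u^2}{2\omega^2}}$ be the Weierstrass sigma function, and put $e(u)=\exp(2\pi\sqrt{-1}\,u)$, $[u]=e(gu^2)\,\sigma(u;\Omega)$ with a constant $g\in\mathbb C$. For $\omega\in\Omega$ put $\epsilon_\omega=1$ if $\omega\in2\Omega$, $\epsilon_\omega=-1$ otherwise, and let $\eta_\omega\in\mathbb C$ be the number determined by $[u+\omega]=\epsilon_\omega\, e(\eta_\omega(u+\frac\omega2))\,[u]$ for all $u$. Put $\omega_0=0$, $\omega_3=-\omega_1-\omega_2$, $\epsilon_r=\epsilon_{\omega_r}$, $\eta_r=\eta_{\omega_r}$ $(0\le r\le3)$. Fix $\delta\in\mathbb C\setminus\{0\}$ with $\mathbb Z\delta\cap\Omega=\{0\}$. Write $[u\pm v]=[u+v][u-v]$, $[u]_k=\prod_{j=0}^{k-1}[u+j\delta]$ and, for a function $f$, $f(u)_k=\prod_{j=0}^{k-1}f(u+j\delta)$.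 For $\boldsymbol a=(a_0,\dots,a_7)\in\mathbb C^8$ and $c\in\mathbb C$ put $$A^{\pm}(x;\boldsymbol a)=\frac{\prod_{p=0}^7[x\pm a_p]}{[2x][2x\pm\delta]}\quad\text{(upper or lower signs throughout)},$$ $$A^0(x;\boldsymbol a|c)=\sum_{r=0}^3\epsilon_r\,e\Big(\big(\delta-\tfrac{\omega_r}2-\tfrac12\textstyle\sum_{p=0}^7a_p\big)\eta_r\Big)\frac{[x\pm c]\prod_{p=0}^7[\frac12(\omega_r-\delta)+a_p]}{2[\frac12(\omega_r-\delta)\pm x][\frac12(\omega_r-\delta)\pm c]},$$ $$C_\sigma(z;\boldsymbol a|c)=\sum_{0\le r\le\sigma/2}(-1)^r\sum_{(\xi_p)}\prod_{p=1}^rA^+(z+(\xi_p-1)\delta;\boldsymbol a)A^-(z+\xi_p\delta;\boldsymbol a)\prod_{\substack{0\le k\le\sigma-1\\k\ne\xi_p-1,\,\xi_p\ (1\le p\le r)}}A^0(z+k\delta;\boldsymbol a|c),$$ the inner sum being over integer sequences $0<\xi_1<\dots<\xi_r<\sigma$ with $\xi_{p+1}-\xi_p\ge2$. For $x\in\mathbb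 C^m$, $\alpha\in\mathbb N^m$, $y\in\mathbb C^n$, $\beta\in\mathbb N^n$ $(m,n\ge0)$ put \begin{align*} S(x,\alpha;y,\beta;\boldsymbol a|c)=&\sum_{0\le\nu\le\mu\le\alpha}(-1)^{|\nu|+|\alpha-\mu|}\prod_{i=1}^mA^-(x_i;\boldsymbol a)_{\nu_i}A^+(x_i+\mu_i\delta;\boldsymbol a)_{\alpha_i-\mu_i}C_{\mu_i-\nu_i}(x_i+\nu_i\delta;\boldsymbol a|c)\\ &\cdot\prod_{i=1}^m\frac{[2x_i+2(\nu_i-1)\delta]}{[2x_i-2\delta]}\frac{[2x_i+2\mu_i\delta]}{[2x_i+2\alpha_i\delta]}\\ &\cdot\prod_{1\le i<j\le m}\frac{[(x_i+\nu_i\delta-\delta)\pm(x_j+\nu_j\delta-\delta)]}{[(x_i-\delta)\pm(x_j-\delta)]}\frac{[(x_i+\mu_i\delta)\pm(x_j+\mu_j\delta)]}{[(x_i+\alpha_i\delta)\pm(x_j+\alpha_j\delta)]}\\ &\cdot\prod_{1\le i,j\le m}\frac{[(x_i-\delta)\pm(x_j+\alpha_j\delta)]}{[(x_i-\delta)\pm(x_j+\mu_j\delta)]}\frac{[(x_i+\nu_i\delta-\delta)\pm(x_j+\mu_j\delta)]}{[(x_i+\nu_i\delta-\delta)\pm(x_j+\alpha_j\delta)]}\frac{[x_i+x_j-2\delta]_{\nu_i}}{[x_i+x_j+(\alpha_j-1)\delta]_{\nu_i}}\frac{[x_i-x_j-\alpha_j\delta]_{\nu_i}}{[x_i-x_j+\delta]_{\nu_i}}\\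 &\cdot\prod_{1\le i,j\le m}\frac{[-x_i-x_j-(\alpha_i+\alpha_j)\delta]_{\alpha_i-\mu_i}}{[-x_i-x_j-(\alpha_i-1)\delta]_{\alpha_i-\mu_i}}\frac{[-x_i+x_j-\alpha_i\delta]_{\alpha_i-\mu_i}}{[-x_i+x_j+(\alpha_j-\alpha_i+1)\delta]_{\alpha_i-\mu_i}}\\ &\cdot\prod_{\substack{1\le i\le m\\1\le k\le n}}\frac{[x_i+y_k+(\beta_k-1)\delta]_{\nu_i}}{[x_i+y_k-\delta]_{\nu_i}}\frac{[x_i-y_k]_{\nu_i}}{[x_i-y_k-\beta_k\delta]_{\nu_i}}\\ &\cdot\prod_{\substack{1\le i\le m\\1\le k\le n}}\frac{[-x_i-y_k-(\alpha_i-1)\delta]_{\alpha_i-\mu_i}}{[-x_i-y_k-(\alpha_i+\beta_k-1)\delta]_{\alpha_i-\mu_i}}\frac{[-x_i+y_k-(\alpha_i-\beta_k)\delta]_{\alpha_i-\mu_i}}{[-x_i+y_k-\alpha_i\delta]_{\alpha_i-\mu_i}}. \end{align*} Here inequalities between multi-indices are componentwise and $|\alpha|=\sum_i\alpha_i$. \textbf{Theorem.}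 Let $M\ge N\ge0$ be integers, $\alpha\in\mathbb N^m$ and $\beta\in\mathbb N^n$ with $|\alpha|=M$, $|\beta|=N$. Let $\boldsymbol a=(a_0,\dots,a_7)\in\mathbb C^8$ satisfy $\sum_{p=0}^7a_p=(4-2M+2N)\delta$ and $a_7=a_0+\delta$, and define $\boldsymbol b=(b_0,\dots,b_7)$ by $b_0=\delta-a_7$, $b_7=\delta-a_0$ and $b_p=\delta-a_p$ $(1\le p\le6)$. Then for all $x\in\mathbb C^m$ and $y\in\mathbb C^n$ for which no denominator occurring in the two sums vanishes, $$S(x,\alpha;y,\beta;\boldsymbol a|a_0)=\prod_{p=1}^6[a_0+a_p]_{M-N}\cdot S(y,\beta;x,\alpha;\boldsymbol b|b_0).$$ -/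

import Mathlib

open scoped BigOperators

noncomputable section

namespace EllipticBC

/-- `e(u) = exp(2π√-1 u)`. -/
def e (u : ℂ) : ℂ := Complex.exp (2 * Real.pi * Complex.I * u)

/-- The Weierstrass sigma function of the period lattice `Ω = ℤω₁ ⊕ ℤω₂`. -/
def sigma (L : PeriodPair) (u : ℂ) : ℂ :=
  u * ∏' l : {l : L.lattice // l ≠ 0},
    (1 - u / (l : ℂ)) * Complex.exp (u / (l : ℂ) + u ^ 2 / (2 * (l : ℂ) ^ 2))

/-- The function `[u] = e(g u²) σ(u; Ω)`, with a constant `g ∈ ℂ`. -/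
def br (L : PeriodPair) (g u : ℂ) : ℂ := e (g * u ^ 2) * sigma L u

/-- `[u ± v] = [u + v][u - v]`. -/
def brpm (L : PeriodPair) (g u v : ℂ) : ℂ := br L g (u + v) * br L g (u - v)

/-- `[u]_k = [u][u + δ] ⋯ [u + (k-1)δ]`. -/
def brPoch (L : PeriodPair) (g δ u : ℂ) (k : ℕ) : ℂ :=
  ∏ j ∈ Finset.range k, br L g (u + j * δ)

/-- `f(u)_k = f(u) f(u + δ) ⋯ f(u + (k-1)δ)`. -/
def shiftProd (δ : ℂ) (f : ℂ → ℂ) (u : ℂ) (k : ℕ) : ℂ :=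
  ∏ j ∈ Finset.range k, f (u + j * δ)

/-- `(ω₀, ω₁, ω₂, ω₃) = (0, ω₁, ω₂, -ω₁-ω₂)`. -/
def om (L : PeriodPair) : Fin 4 → ℂ := ![0, L.ω₁, L.ω₂, -L.ω₁ - L.ω₂]

open Classical in
/-- `ε_ω = 1` if `ω ∈ 2Ω` and `ε_ω = -1` otherwise. -/
def eps (L : PeriodPair) (ω : ℂ) : ℂ := if ∃ l ∈ L.lattice, ω = 2 * l then 1 else -1

/-- `η_ω`, for `ω ∈ Ω`: the (unique) complex number for which the quasi-periodicity
`[u + ω] = ε_ω e(η_ω (u + ω/2)) [u]` holds for all `u`. -/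
def eta (L : PeriodPair) (g ω : ℂ) : ℂ :=
  Classical.epsilon fun η : ℂ =>
    ∀ u : ℂ, br L g (u + ω) = eps L ω * e (η * (u + ω / 2)) * br L g u

/-- `A⁺(x; a) = ∏ₚ [x + aₚ] / ([2x][2x + δ])`. -/
def Aplus (L : PeriodPair) (g δ : ℂ) (a : Fin 8 → ℂ) (x : ℂ) : ℂ :=
  (∏ p, br L g (x + a p)) / (br L g (2 * x) * br L g (2 * x + δ))

/-- `A⁻(x; a) = ∏ₚ [x - aₚ] / ([2x][2x - δ])`. -/
def Aminus (L : PeriodPair) (g δ : ℂ) (a : Fin 8 → ℂ) (x : ℂ) : ℂ :=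
  (∏ p, br L g (x - a p)) / (br L g (2 * x) * br L g (2 * x - δ))

/-- `A⁰_r(x; a | c)`. -/
def AzeroTerm (L : PeriodPair) (g δ : ℂ) (a : Fin 8 → ℂ) (r : Fin 4) (c x : ℂ) : ℂ :=
  eps L (om L r) * e ((δ - om L r / 2 - (∑ p, a p) / 2) * eta L g (om L r)) *
    ((brpm L g x c * ∏ p, br L g ((om L r - δ) / 2 + a p)) /
      (2 * brpm L g ((om L r - δ) / 2) x * brpm L g ((om L r - δ) / 2) c))

/-- `A⁰(x; a | c) = ∑ᵣ A⁰_r(x; a | c_r)`. -/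
def Azero (L : PeriodPair) (g δ : ℂ) (a : Fin 8 → ℂ) (c : Fin 4 → ℂ) (x : ℂ) : ℂ :=
  ∑ r, AzeroTerm L g δ a r (c r) x

open Classical in
/-- The sequences `(ξ_p)_{1 ≤ p ≤ r}` of integers with `0 < ξ_1 < ⋯ < ξ_r < σ` and
`ξ_{p+1} - ξ_p ≥ 2`. -/
def xiSeqs (σ r : ℕ) : Finset (Fin r → ℕ) :=
  (Fintype.piFinset fun _ : Fin r => Finset.Ioo 0 σ).filter fun ξ =>
    StrictMono ξ ∧ ∀ p q : Fin r, (p : ℕ) + 1 = (q : ℕ) → ξ p + 2 ≤ ξ q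

open Classical in
/-- `C_σ(z; a | c)`. The last product runs over `0 ≤ k < σ` with `k ≠ ξ_p - 1, ξ_p` for all `p`. -/
def Cfun (L : PeriodPair) (g δ : ℂ) (a : Fin 8 → ℂ) (c : Fin 4 → ℂ) (σ : ℕ) (z : ℂ) : ℂ :=
  ∑ r ∈ Finset.range (σ / 2 + 1), (-1) ^ r * ∑ ξ ∈ xiSeqs σ r,
    (∏ p, Aplus L g δ a (z + ((ξ p : ℂ) - 1) * δ) * Aminus L g δ a (z + (ξ p : ℂ) * δ)) *
      ∏ k ∈ (Finset.range σ).filter (fun k => ∀ p, k + 1 ≠ ξ p ∧ k ≠ ξ p),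
        Azero L g δ a c (z + (k : ℂ) * δ)

/-- The term indexed by `ν ≤ μ ≤ α` of the series of type `BC`. -/
def bcTerm (L : PeriodPair) (g δ : ℂ) (a : Fin 8 → ℂ) (c : Fin 4 → ℂ) {m n : ℕ}
    (x : Fin m → ℂ) (α : Fin m → ℕ) (y : Fin n → ℂ) (β : Fin n → ℕ) (ν μ : Fin m → ℕ) : ℂ :=
  (-1) ^ ((∑ i, ν i) + ∑ i, (α i - μ i)) *
  (∏ i, shiftProd δ (Aminus L g δ a) (x i) (ν i) *
      shiftProd δ (Aplus L g δ a) (x i + μ i * δ) (α i - μ i) *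
      Cfun L g δ a c (μ i - ν i) (x i + ν i * δ)) *
  (∏ i, br L g (2 * x i + 2 * ((ν i : ℂ) - 1) * δ) / br L g (2 * x i - 2 * δ) *
      (br L g (2 * x i + 2 * μ i * δ) / br L g (2 * x i + 2 * α i * δ))) *
  (∏ i, ∏ j ∈ Finset.Ioi i,
      brpm L g (x i + ν i * δ - δ) (x j + ν j * δ - δ) / brpm L g (x i - δ) (x j - δ) *
      (brpm L g (x i + μ i * δ) (x j + μ j * δ) /
        brpm L g (x i + α i * δ) (x j + α j * δ))) *
  (∏ i, ∏ j,
      brpm L g (x i - δ) (x j + α j * δ) / brpm L g (x i - δ) (x j + μ j * δ) *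
      (brpm L g (x i + ν i * δ - δ) (x j + μ j * δ) /
        brpm L g (x i + ν i * δ - δ) (x j + α j * δ)) *
      (brPoch L g δ (x i + x j - 2 * δ) (ν i) /
        brPoch L g δ (x i + x j + ((α j : ℂ) - 1) * δ) (ν i)) *
      (brPoch L g δ (x i - x j - α j * δ) (ν i) / brPoch L g δ (x i - x j + δ) (ν i))) *
  (∏ i, ∏ j,
      brPoch L g δ (-x i - x j - ((α i : ℂ) + α j) * δ) (α i - μ i) /
        brPoch L g δ (-x i - x j - ((α i : ℂ) - 1) * δ) (α i - μ i) *
      (brPoch L g δ (-x i + x j - α i * δ) (α i - μ i) /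
        brPoch L g δ (-x i + x j + ((α j : ℂ) - α i + 1) * δ) (α i - μ i))) *
  (∏ i, ∏ k,
      brPoch L g δ (x i + y k + ((β k : ℂ) - 1) * δ) (ν i) /
        brPoch L g δ (x i + y k - δ) (ν i) *
      (brPoch L g δ (x i - y k) (ν i) / brPoch L g δ (x i - y k - β k * δ) (ν i))) *
  (∏ i, ∏ k,
      brPoch L g δ (-x i - y k - ((α i : ℂ) - 1) * δ) (α i - μ i) /
        brPoch L g δ (-x i - y k - ((α i : ℂ) + β k - 1) * δ) (α i - μ i) *
      (brPoch L g δ (-x i + y k - ((α i : ℂ) - β k) * δ) (α i - μ i) /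
        brPoch L g δ (-x i + y k - α i * δ) (α i - μ i)))

/-- The multiple series of type `BC_m`: the sum of the terms over `0 ≤ ν ≤ μ ≤ α`. -/
def bcSum (L : PeriodPair) (g δ : ℂ) (a : Fin 8 → ℂ) (c : Fin 4 → ℂ) {m n : ℕ}
    (x : Fin m → ℂ) (α : Fin m → ℕ) (y : Fin n → ℂ) (β : Fin n → ℕ) : ℂ :=
  ∑ μ ∈ Finset.Icc 0 α, ∑ ν ∈ Finset.Icc 0 μ, bcTerm L g δ a c x α y β ν μ

/-- No denominator occurring in the terms of `bcSum L g δ a c x α y β` vanishes. The fields list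
all these denominators, in the order of the formula. -/
structure DenominatorsNonzero (L : PeriodPair) (g δ : ℂ) (c : Fin 4 → ℂ) {m n : ℕ}
    (x : Fin m → ℂ) (α : Fin m → ℕ) (y : Fin n → ℂ) (β : Fin n → ℕ) : Prop where
  /-- `A⁺` and `A⁻` at `x_i + kδ` -/
  atPlusMinus : ∀ i, ∀ k < α i, br L g (2 * (x i + k * δ)) ≠ 0 ∧
    br L g (2 * (x i + k * δ) + δ) ≠ 0 ∧ br L g (2 * (x i + k * δ) - δ) ≠ 0
  /-- `A⁰` at `x_i + kδ` -/
  atZero : ∀ i, ∀ k < α i, ∀ r, brpm L g ((om L r - δ) / 2) (x i + k * δ) ≠ 0 ∧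
    brpm L g ((om L r - δ) / 2) (c r) ≠ 0
  single : ∀ i, br L g (2 * x i - 2 * δ) ≠ 0 ∧ br L g (2 * x i + 2 * α i * δ) ≠ 0
  pair : ∀ i j, i < j → brpm L g (x i - δ) (x j - δ) ≠ 0 ∧
    brpm L g (x i + α i * δ) (x j + α j * δ) ≠ 0
  shiftMu : ∀ i j, ∀ s ≤ α j, brpm L g (x i - δ) (x j + s * δ) ≠ 0
  shiftNu : ∀ i j, ∀ s ≤ α i, brpm L g (x i + s * δ - δ) (x j + α j * δ) ≠ 0
  pochNu : ∀ i j, brPoch L g δ (x i + x j + ((α j : ℂ) - 1) * δ) (α i) ≠ 0 ∧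
    brPoch L g δ (x i - x j + δ) (α i) ≠ 0
  pochMu : ∀ i j, brPoch L g δ (-x i - x j - ((α i : ℂ) - 1) * δ) (α i) ≠ 0 ∧
    brPoch L g δ (-x i + x j + ((α j : ℂ) - α i + 1) * δ) (α i) ≠ 0
  mixedNu : ∀ i k, brPoch L g δ (x i + y k - δ) (α i) ≠ 0 ∧
    brPoch L g δ (x i - y k - β k * δ) (α i) ≠ 0
  mixedMu : ∀ i k, brPoch L g δ (-x i - y k - ((α i : ℂ) + β k - 1) * δ) (α i) ≠ 0 ∧
    brPoch L g δ (-x i + y k - α i * δ) (α i) ≠ 0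

/-- `b_0 = δ - a_7`, `b_7 = δ - a_0` and `b_p = δ - a_p` for `1 ≤ p ≤ 6`. -/
def dualParams (δ : ℂ) (a : Fin 8 → ℂ) : Fin 8 → ℂ :=
  ![δ - a 7, δ - a 1, δ - a 2, δ - a 3, δ - a 4, δ - a 5, δ - a 6, δ - a 0]

end EllipticBC

end

open scoped BigOperators

noncomputable section

namespace EllipticBC

open Filter Topology

/-! ### The Weierstrass sigma function -/

/-! Put d = M - N, and let D = A⁺ T_δ + A⁰ + A⁻ T_{-δ} be van Diejen's operator in one variable. The
balancing condition Σ a_p = (4 - 2d)δ makes D preserve the space of even theta functions of degree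
2(d - 1), which is spanned by d Lagrange-type functions with nodes s_1, …, s_d (`vanDiejen_lagr`).
The quasi-periods match, and the poles of the coefficients cancel (`regular_vanDiejen`). On the
Cauchy kernel Φ(w, z) = ∏[z ± s_l] / ([z ± w] ∏[w ± s_l]), the operator D with parameters a acting
on z and the one with parameters b acting on w differ only by such a theta function of z
(`vanDiejen_kern`). Both facts come from Liouville's theorem through `tendsto_zero_of_quasiPer`.

Take the square matrix whose M rows are the points x_i + kδ (k < α_i) and whose columns are the N
kernels at the points y_k + lδ (l < β_k), followed by the d Lagrange functions. Applying D in z to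
every column gives the same matrix as applying the dual operator to the kernel columns only and then
multiplying by a block triangular matrix with diagonal blocks 1 and the matrix of D on theta
functions (`det_rows_eq_det_columns`).

Each of these two determinants is also a multiple series. A row of the first is a three-term
combination of rows at z - δ, z, z + δ. Along a chain of consecutive points the wedge product of
such combinations collapses to products that omit two of the α_i + 2 available points, and their
coefficients are continuants of a tridiagonal matrix (`prod_three_term`). Splitting by whether the
last ξ is maximal shows that these continuants are the C_σ (`Cfun_eq_continuant`). What remains are
determinants of kernels and Lagrange functions at shifted points. They are elliptic Cauchy
determinants (`det_one_div_brpm`, `det_thetaFun`), and their ratios to the unshifted one are the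
products in S (`weight_skip`). Hence S(x, α; y, β; a) = det(D on theta functions) · S(y, β; x, α; b)
for generic points (`bcSum_eq_det_mul`).

The determinant is computed by evaluating at a_0 + jδ for 0 ≤ j < d. Since A⁰(a_0 | a_0), A⁻(a_0)
and A⁻(a_0 + δ) = A⁻(a_7) vanish, the values of Df there depend in a lower triangular way on the
values of f at a_0 + δ, …, a_0 + dδ. The diagonal entries A⁺(a_0 + jδ) and two Cauchy-type
determinants then give the product of [a_0 + a_p]_d (`det_lagrMatrix`). Finally, genericity is
removed by continuity along a line of parameters that preserves the constraints (`bcSum_duality`).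
-/

/-- The canonical factor `(1 - u/l) exp (u/l + u²/(2l²))`. -/
def sigmaFactor (l u : ℂ) : ℂ := (1 - u / l) * Complex.exp (u / l + u ^ 2 / (2 * l ^ 2))

/-- The exponential is chosen so that the derivative of (1 - z) exp(z + z²/2) is just -z² exp(z +
z²/2). The mean value inequality on the ball of radius ‖w‖ then gives a cubic bound. -/
lemma norm_one_sub_mul_exp_sub_one_le {w : ℂ} (hw : ‖w‖ ≤ 1) :
    ‖(1 - w) * Complex.exp (w + w ^ 2 / 2) - 1‖ ≤ Real.exp 2 * ‖w‖ ^ 3 := by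
  have hd : ∀ z ∈ Metric.closedBall (0 : ℂ) ‖w‖, HasDerivWithinAt
      (fun z : ℂ => (1 - z) * Complex.exp (z + z ^ 2 / 2))
      (-z ^ 2 * Complex.exp (z + z ^ 2 / 2)) (Metric.closedBall (0 : ℂ) ‖w‖) z := by
    intro z _
    have h1 : HasDerivAt (fun z : ℂ => z + z ^ 2 / 2) (1 + z) z := by
      have := (hasDerivAt_id z).add (((hasDerivAt_id z).pow 2).div_const 2)
      convert! this using 1
      simp
    have h2 := ((hasDerivAt_id z).const_sub 1).mul h1.cexp
    refine (h2.congr_deriv ?_).hasDerivWithinAt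
    simp
    ring
  have hb : ∀ z ∈ Metric.closedBall (0 : ℂ) ‖w‖,
      ‖-z ^ 2 * Complex.exp (z + z ^ 2 / 2)‖ ≤ ‖w‖ ^ 2 * Real.exp 2 := by
    intro z hz
    have hz' : ‖z‖ ≤ ‖w‖ := by simpa using hz
    rw [norm_mul, norm_neg, norm_pow]
    gcongr
    rw [Complex.norm_exp]
    apply Real.exp_le_exp.2
    refine (Complex.re_le_norm _).trans ((norm_add_le _ _).trans ?_)
    have : ‖z‖ ≤ 1 := hz'.trans hw
    rw [norm_div, norm_pow]
    simp only [Complex.norm_ofNat]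
    nlinarith [norm_nonneg z]
  have := (convex_closedBall (0 : ℂ) ‖w‖).norm_image_sub_le_of_norm_hasDerivWithin_le hd hb
    (x := 0) (y := w) (by simp) (by simp)
  simp only [sub_zero, zero_add] at this
  norm_num at this
  calc _ ≤ _ := this
    _ = _ := by ring

lemma norm_sigmaFactor_sub_one_le {l u : ℂ} {r : ℝ} (hu : ‖u‖ ≤ r) (hl : r ≤ ‖l‖) (h0 : l ≠ 0) :
    ‖sigmaFactor l u - 1‖ ≤ Real.exp 2 * r ^ 3 * ‖l‖ ^ (-3 : ℝ) := by
  have hl0 : 0 < ‖l‖ := norm_pos_iff.2 h0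
  have h1 : ‖u / l‖ ≤ 1 := by
    rw [norm_div, div_le_one hl0]; exact hu.trans hl
  have := norm_one_sub_mul_exp_sub_one_le h1
  have h2 : sigmaFactor l u = (1 - u / l) * Complex.exp (u / l + (u / l) ^ 2 / 2) := by
    rw [sigmaFactor]; congr 3; field_simp
  rw [h2]
  refine this.trans ?_
  rw [norm_div, div_pow, mul_assoc]
  have h3 : ‖l‖ ^ (-3 : ℝ) = (‖l‖ ^ 3)⁻¹ := by
    rw [Real.rpow_neg hl0.le]; norm_cast
  rw [h3, div_eq_mul_inv]
  gcongr

lemma differentiable_sigmaFactor (l : ℂ) : Differentiable ℂ (sigmaFactor l) := by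
  unfold sigmaFactor
  fun_prop

variable (L : PeriodPair)

/-- The exponent 3 exceeds the rank 2 of the lattice. -/
lemma summable_lattice_rpow (c : ℝ) :
    Summable fun l : {l : L.lattice // l ≠ 0} => c * ‖(l : ℂ)‖ ^ (-3 : ℝ) := by
  have h : Summable fun l : L.lattice => ‖l‖ ^ (-3 : ℝ) :=
    ZLattice.summable_norm_rpow _ _ (by simp; norm_num)
  exact (h.comp_injective Subtype.val_injective).mul_left c

lemma eventually_norm_sigmaFactor_le (r : ℝ) :
    ∀ᶠ l : {l : L.lattice // l ≠ 0} in cofinite, ∀ u ∈ Metric.ball (0 : ℂ) r,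
      ‖sigmaFactor (l : ℂ) u - 1‖ ≤ Real.exp 2 * r ^ 3 * ‖(l : ℂ)‖ ^ (-3 : ℝ) := by
  have hfin : {l : L.lattice | ‖l‖ ≤ r}.Finite := by
    refine (isCompact_iff_finite.mp (isCompact_closedBall (0 : L.lattice) r)).subset ?_
    intro l hl
    simpa using hl
  have : {l : {l : L.lattice // l ≠ 0} | ‖(l : L.lattice)‖ ≤ r}.Finite :=
    hfin.preimage Subtype.val_injective.injOn
  refine this.subset ?_
  intro l hl
  by_contra hc
  apply hl
  intro u hu
  refine norm_sigmaFactor_sub_one_le (mem_ball_zero_iff.1 hu).le (not_le.1 hc).le ?_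
  have := l.2
  simpa using this

lemma multipliableLocallyUniformlyOn_sigmaFactor (r : ℝ) :
    MultipliableLocallyUniformlyOn (fun (l : {l : L.lattice // l ≠ 0}) u => sigmaFactor (l : ℂ) u)
      (Metric.ball (0 : ℂ) r) := by
  have := Summable.multipliableLocallyUniformlyOn_one_add
    (f := fun (l : {l : L.lattice // l ≠ 0}) u => sigmaFactor (l : ℂ) u - 1)
    Metric.isOpen_ball (summable_lattice_rpow L (Real.exp 2 * r ^ 3))
    (eventually_norm_sigmaFactor_le L r)
    (fun l => ((differentiable_sigmaFactor _).continuous.sub continuous_const).continuousOn)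
  simpa using this

lemma exists_mem_ball (u : ℂ) : ∃ r : ℝ, 0 < r ∧ u ∈ Metric.ball (0 : ℂ) r :=
  ⟨‖u‖ + 1, by positivity, by simp⟩

/-- The product part of the sigma function. -/
def sigmaProd (u : ℂ) : ℂ := ∏' l : {l : L.lattice // l ≠ 0}, sigmaFactor (l : ℂ) u

lemma sigma_eq (u : ℂ) : sigma L u = u * sigmaProd L u := rfl

lemma differentiable_sigmaProd : Differentiable ℂ (sigmaProd L) := by
  intro u
  obtain ⟨r, -, hu⟩ := exists_mem_ball u
  have := (multipliableLocallyUniformlyOn_sigmaFactor L r).hasProdLocallyUniformlyOn.differentiableOn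
    (.of_forall fun s => DifferentiableOn.fun_finsetProd
      fun i _ => (differentiable_sigmaFactor _).differentiableOn) Metric.isOpen_ball
  exact (this u hu).differentiableAt (Metric.isOpen_ball.mem_nhds hu)

lemma differentiable_sigma : Differentiable ℂ (sigma L) :=
  differentiable_id.mul (differentiable_sigmaProd L)

lemma sigmaFactor_ne_zero {l u : ℂ} (hl : l ≠ 0) (h : u ≠ l) : sigmaFactor l u ≠ 0 := by
  refine mul_ne_zero ?_ (Complex.exp_ne_zero _)
  rw [sub_ne_zero]
  intro h'
  exact h ((div_eq_one_iff_eq hl).1 h'.symm)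

lemma summable_sigmaFactor_sub_one (u : ℂ) :
    Summable fun l : {l : L.lattice // l ≠ 0} => ‖sigmaFactor (l : ℂ) u - 1‖ := by
  obtain ⟨r, -, hu⟩ := exists_mem_ball u
  refine (summable_lattice_rpow L (Real.exp 2 * r ^ 3)).of_norm_bounded_eventually ?_
  filter_upwards [eventually_norm_sigmaFactor_le L r] with l hl
  simpa using hl u hu

lemma sigmaProd_ne_zero {u : ℂ} (hu : ∀ l ∈ L.lattice, l ≠ 0 → u ≠ l) : sigmaProd L u ≠ 0 := by
  have := tprod_one_add_ne_zero_of_summable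
    (f := fun l : {l : L.lattice // l ≠ 0} => sigmaFactor (l : ℂ) u - 1) ?_
    (summable_sigmaFactor_sub_one L u)
  · simpa [sigmaProd] using this
  · intro l
    have h0 : (l : ℂ) ≠ 0 := by simpa using l.2
    simpa using sigmaFactor_ne_zero h0 (hu _ l.1.2 h0)

lemma sigmaProd_zero : sigmaProd L 0 = 1 := by
  simp [sigmaProd, sigmaFactor]

lemma sigma_ne_zero {u : ℂ} (hu : u ∉ L.lattice) : sigma L u ≠ 0 := by
  rw [sigma_eq]
  refine mul_ne_zero ?_ (sigmaProd_ne_zero L ?_)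
  · rintro rfl; exact hu (zero_mem _)
  · rintro l hl _ rfl; exact hu hl

lemma sigma_eq_zero {u : ℂ} (hu : u ∈ L.lattice) : sigma L u = 0 := by
  rw [sigma_eq]
  by_cases h0 : u = 0
  · simp [h0]
  · rw [sigmaProd, tprod_of_exists_eq_zero, mul_zero]
    refine ⟨⟨⟨u, hu⟩, by simpa using h0⟩, ?_⟩
    simp [sigmaFactor, h0]

/-- Negation permutes the nonzero periods, and the factor of -l at -u is the factor of l at u. -/
lemma sigma_neg (u : ℂ) : sigma L (-u) = - sigma L u := by
  rw [sigma_eq, sigma_eq, neg_mul]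
  congr 2
  unfold sigmaProd
  let E : {l : L.lattice // l ≠ 0} ≃ {l : L.lattice // l ≠ 0} :=
    (Equiv.neg L.lattice).subtypeEquiv (by simp)
  rw [← E.tprod_eq]
  congr 1
  funext l
  simp [E, sigmaFactor, neg_div_neg_eq]

/-! ### The Weierstrass zeta function as the logarithmic derivative of sigma -/

/-- The summand of the Weierstrass zeta function. -/
def zetaTerm (l u : ℂ) : ℂ := 1 / (u - l) + 1 / l + u / l ^ 2

/-- The three terms combine to u²/((u - l)l²). For ‖u‖ ≤ r and ‖l‖ ≥ 2r this is at most 2r²‖l‖⁻³,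
which is summable over the lattice. -/
lemma hasSumLocallyUniformly_zetaTerm :
    HasSumLocallyUniformly (fun (l : L.lattice) (u : ℂ) => zetaTerm (l : ℂ) u)
      (fun u => ∑' l : L.lattice, zetaTerm (l : ℂ) u) := by
  refine L.hasSumLocallyUniformly_aux (u := fun r l => (2 * r ^ 2) * ‖l‖ ^ (-3 : ℝ)) _
    (fun _ _ => (ZLattice.summable_norm_rpow _ _ (by simp; norm_num)).mul_left _) fun r hr =>
    Filter.eventually_atTop.mpr ⟨2 * r, ?_⟩
  rintro _ h s hs l rfl
  have hl0 : 0 < ‖(l : ℂ)‖ := by linarith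
  have hl : (l : ℂ) ≠ 0 := norm_pos_iff.1 hl0
  have hsl : ‖(l : ℂ)‖ / 2 ≤ ‖s - l‖ := by
    rw [norm_sub_rev]
    exact .trans (by linarith) (norm_sub_norm_le (l : ℂ) s)
  have hsl0 : s - l ≠ 0 := norm_pos_iff.1 (by linarith)
  have h1 : zetaTerm l s = s ^ 2 / ((s - l) * (l : ℂ) ^ 2) := by
    unfold zetaTerm; field_simp; ring
  have h3 : ‖l‖ ^ (-3 : ℝ) = (‖(l : ℂ)‖ ^ 3)⁻¹ := by
    rw [Submodule.coe_norm, Real.rpow_neg hl0.le]; norm_cast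
  rw [h1, norm_div, norm_mul, norm_pow, norm_pow, h3]
  calc ‖s‖ ^ 2 / (‖s - l‖ * ‖(l : ℂ)‖ ^ 2) ≤ r ^ 2 / (‖(l : ℂ)‖ / 2 * ‖(l : ℂ)‖ ^ 2) := by gcongr
    _ = _ := by field_simp

lemma differentiableAt_zetaTerm {l u : ℂ} (h : u ≠ l) : DifferentiableAt ℂ (zetaTerm l) u := by
  unfold zetaTerm
  have : u - l ≠ 0 := sub_ne_zero.2 h
  fun_prop (disch := assumption)

lemma hasDerivAt_zetaTerm {l u : ℂ} (h : u ≠ l) :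
    HasDerivAt (zetaTerm l) (-(1 / (u - l) ^ 2 - 1 / l ^ 2)) u := by
  have h0 : u - l ≠ 0 := sub_ne_zero.2 h
  have h1 := ((((hasDerivAt_id u).sub_const l).inv h0).add_const (1 / l)).add
    ((hasDerivAt_id u).div_const (l ^ 2))
  have h2 : zetaTerm l = fun u => (id u - l)⁻¹ + 1 / l + id u / l ^ 2 := by
    funext u; simp [zetaTerm]
  rw [h2]
  refine h1.congr_deriv ?_
  simp
  ring

/-- The Weierstrass zeta function. -/
def zeta (u : ℂ) : ℂ := ∑' l : L.lattice, zetaTerm (l : ℂ) u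

lemma ne_of_notMem_lattice {u : ℂ} (hu : u ∉ L.lattice) (l : L.lattice) : u ≠ l := by
  rintro rfl; exact hu l.2

lemma isOpen_compl_lattice : IsOpen ((L.lattice : Set ℂ)ᶜ) := L.isClosed_lattice.isOpen_compl

lemma differentiableOn_zeta : DifferentiableOn ℂ (zeta L) (L.lattice : Set ℂ)ᶜ := by
  refine (hasSumLocallyUniformly_zetaTerm L).hasSumLocallyUniformlyOn.differentiableOn
    (.of_forall fun s => .fun_sum fun i _ => ?_) (isOpen_compl_lattice L)
  intro u hu
  exact (differentiableAt_zetaTerm (ne_of_notMem_lattice L hu i)).differentiableWithinAt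

/-- Locally uniform convergence permits termwise differentiation. The periodicity of ℘ is the only
source of quasi-periodicity in the whole development. -/
lemma hasDerivAt_zeta {u : ℂ} (hu : u ∉ L.lattice) : HasDerivAt (zeta L) (-L.weierstrassP u) u := by
  have hd : DifferentiableAt ℂ (zeta L) u :=
    (differentiableOn_zeta L u hu).differentiableAt ((isOpen_compl_lattice L).mem_nhds hu)
  have h1 := ((hasSumLocallyUniformly_zetaTerm L).tendstoLocallyUniformlyOn.deriv
    (.of_forall fun s => .fun_sum fun i _ => fun u hu =>
      (differentiableAt_zetaTerm (ne_of_notMem_lattice L hu i)).differentiableWithinAt)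
      (isOpen_compl_lattice L)).tendsto_at hu
  have h2 := (L.hasSum_weierstrassP u).neg
  have h3 : deriv (zeta L) u = -L.weierstrassP u := by
    refine tendsto_nhds_unique h1 ?_
    refine h2.congr fun s => ?_
    simp only [Function.comp_apply]
    rw [deriv_fun_sum fun i _ => differentiableAt_zetaTerm (ne_of_notMem_lattice L hu i)]
    exact Finset.sum_congr rfl fun i _ =>
      (hasDerivAt_zetaTerm (ne_of_notMem_lattice L hu i)).deriv.symm
  rw [← h3]
  exact hd.hasDerivAt

lemma logDeriv_sigmaFactor {l u : ℂ} (hl : l ≠ 0) (h : u ≠ l) :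
    logDeriv (sigmaFactor l) u = zetaTerm l u := by
  have h1 : HasDerivAt (fun z : ℂ => z / l + z ^ 2 / (2 * l ^ 2)) (1 / l + u / l ^ 2) u := by
    have := ((hasDerivAt_id u).div_const l).add (((hasDerivAt_id u).pow 2).div_const (2 * l ^ 2))
    refine this.congr_deriv ?_
    simp; field_simp
  have h2 := (((hasDerivAt_id u).div_const l).const_sub 1).mul h1.cexp
  have h3 : deriv (sigmaFactor l) u = _ := h2.deriv
  rw [logDeriv_apply, h3]
  have h4 : u - l ≠ 0 := sub_ne_zero.2 h
  have h5 : l - u ≠ 0 := sub_ne_zero.2 h.symm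
  have h6 := Complex.exp_ne_zero (u / l + u ^ 2 / (2 * l ^ 2))
  have h7 : (1 - u / l) ≠ 0 := by
    rw [sub_ne_zero]
    intro h'
    exact h ((div_eq_one_iff_eq hl).1 h'.symm)
  unfold sigmaFactor zetaTerm
  simp only [id]
  rw [div_eq_iff (mul_ne_zero h7 h6)]
  have : ∀ E : ℂ, -(1 / l) * E + (1 - u / l) * (E * (1 / l + u / l ^ 2)) =
      (1 / (u - l) + 1 / l + u / l ^ 2) * ((1 - u / l) * E) := by
    intro E; field_simp; ring
  exact this _

lemma logDeriv_sigma {u : ℂ} (hu : u ∉ L.lattice) : logDeriv (sigma L) u = zeta L u := by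
  have hu0 : u ≠ 0 := by rintro rfl; exact hu (zero_mem _)
  obtain ⟨r, -, hur⟩ := exists_mem_ball u
  have hsum : Summable fun l : L.lattice => zetaTerm (l : ℂ) u :=
    (hasSumLocallyUniformly_zetaTerm L).hasSum.summable
  have hl (l : {l : L.lattice // l ≠ 0}) : ((l : L.lattice) : ℂ) ≠ 0 := by simpa using l.2
  have hlog (l : {l : L.lattice // l ≠ 0}) :
      logDeriv (sigmaFactor (l : ℂ)) u = zetaTerm (l : ℂ) u :=
    logDeriv_sigmaFactor (hl l) (ne_of_notMem_lattice L hu l)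
  have hprod : sigmaProd L u ≠ 0 := sigmaProd_ne_zero L fun l hl _ h => hu (h ▸ hl)
  have h1 : logDeriv (sigmaProd L) u = ∑' l : {l : L.lattice // l ≠ 0}, zetaTerm (l : ℂ) u := by
    have := logDeriv_tprod_eq_tsum (s := Metric.ball (0 : ℂ) r) Metric.isOpen_ball hur
      (f := fun (l : {l : L.lattice // l ≠ 0}) u => sigmaFactor (l : ℂ) u)
      (fun l => sigmaFactor_ne_zero (hl l) (ne_of_notMem_lattice L hu l))
      (fun l => (differentiable_sigmaFactor _).differentiableOn)
      (by
        simp_rw [hlog]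
        exact hsum.comp_injective Subtype.val_injective)
      (multipliableLocallyUniformlyOn_sigmaFactor L r) hprod
    simp_rw [hlog] at this
    exact this
  have h2 : logDeriv (sigma L) u = 1 / u + logDeriv (sigmaProd L) u := by
    have := logDeriv_mul (f := id) (g := sigmaProd L) u hu0 hprod differentiableAt_id
      (differentiable_sigmaProd L u)
    rw [logDeriv_id] at this
    exact this
  rw [h2, h1, zeta]
  have h3 := hsum.tsum_subtype_add_tsum_subtype_compl {l : L.lattice | l = 0}
  -- At l = 0 the terms 1/l and u/l² are zero by convention, so the summand is exactly the
  -- logarithmic derivative of the leading factor u of σ.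
  have h4 : ∑' l : {l : L.lattice | l = 0}, zetaTerm ((l : L.lattice) : ℂ) u = 1 / u := by
    have : ({l : L.lattice | l = 0} : Set L.lattice) = {0} := by ext; simp
    rw [this, tsum_singleton (0 : L.lattice) (fun l : L.lattice => zetaTerm (l : ℂ) u)]
    simp [zetaTerm]
  rw [← h3, h4]
  rfl

/-! ### Quasi-periodicity -/

lemma isPreconnected_compl_lattice : IsPreconnected ((L.lattice : Set ℂ)ᶜ) := by
  have hc : (L.lattice : Set ℂ).Countable := by
    have : Countable L.lattice := L.latticeEquivProd.toEquiv.injective.countable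
    exact Set.countable_coe_iff.1 this
  exact (hc.isConnected_compl_of_one_lt_rank (by simp)).isPreconnected

lemma add_notMem_lattice {u ω : ℂ} (hω : ω ∈ L.lattice) (hu : u ∉ L.lattice) :
    u + ω ∉ L.lattice := fun h => hu (by simpa using L.lattice.sub_mem h hω)

/-- The difference has derivative ℘(u) - ℘(u + ω) = 0, and the complement of the countable lattice
is connected. -/
lemma exists_zeta_add {ω : ℂ} (hω : ω ∈ L.lattice) :
    ∃ a, ∀ u ∉ L.lattice, zeta L (u + ω) = zeta L u + a := by
  have hd : ∀ u ∉ L.lattice, HasDerivAt (fun u => zeta L (u + ω) - zeta L u) 0 u := by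
    intro u hu
    have h1 := (hasDerivAt_zeta L (add_notMem_lattice L hω hu)).comp_add_const u ω
    have h2 := h1.sub (hasDerivAt_zeta L hu)
    refine h2.congr_deriv ?_
    rw [L.weierstrassP_add_coe u ⟨ω, hω⟩]
    simp
  obtain ⟨a, ha⟩ := (isOpen_compl_lattice L).exists_is_const_of_deriv_eq_zero
    (isPreconnected_compl_lattice L)
    (fun u hu => (hd u hu).differentiableAt.differentiableWithinAt) (fun u hu => (hd u hu).deriv)
  exact ⟨a, fun u hu => by rw [← ha u hu]; ring⟩

/-- Off the lattice the quotient of the two sides has zero derivative by `exists_zeta_add`; on the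
lattice both sides vanish. -/
lemma exists_sigma_add {ω : ℂ} (hω : ω ∈ L.lattice) :
    ∃ a B, ∀ u, sigma L (u + ω) = B * Complex.exp (a * (u + ω / 2)) * sigma L u := by
  obtain ⟨a, ha⟩ := exists_zeta_add L hω
  have hd : ∀ u ∉ L.lattice, HasDerivAt
      (fun u => sigma L (u + ω) / (Complex.exp (a * (u + ω / 2)) * sigma L u)) 0 u := by
    intro u hu
    have hu' := add_notMem_lattice L hω hu
    have s1 := sigma_ne_zero L hu
    have s2 := sigma_ne_zero L hu'
    have d1 : HasDerivAt (sigma L) (zeta L u * sigma L u) u := by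
      have := (differentiable_sigma L u).hasDerivAt
      refine this.congr_deriv ?_
      rw [← logDeriv_sigma L hu, logDeriv_apply]; field_simp
    have d2 : HasDerivAt (sigma L) (zeta L (u + ω) * sigma L (u + ω)) (u + ω) := by
      have := (differentiable_sigma L (u + ω)).hasDerivAt
      refine this.congr_deriv ?_
      rw [← logDeriv_sigma L hu', logDeriv_apply]; field_simp
    have d3 : HasDerivAt (fun u : ℂ => a * (u + ω / 2)) a u := by
      simpa using ((hasDerivAt_id u).add_const (ω / 2)).const_mul a
    have he := Complex.exp_ne_zero (a * (u + ω / 2))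
    have d4 := (d2.comp_add_const u ω).div (d3.cexp.mul d1) (mul_ne_zero he s1)
    refine d4.congr_deriv ?_
    rw [ha u hu]
    simp only [Pi.mul_apply]
    field_simp
    ring
  obtain ⟨B, hB⟩ := (isOpen_compl_lattice L).exists_is_const_of_deriv_eq_zero
    (isPreconnected_compl_lattice L)
    (fun u hu => (hd u hu).differentiableAt.differentiableWithinAt) (fun u hu => (hd u hu).deriv)
  refine ⟨a, B, fun u => ?_⟩
  by_cases hu : u ∈ L.lattice
  · rw [sigma_eq_zero L hu, sigma_eq_zero L (L.lattice.add_mem hu hω), mul_zero]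
  · have := hB u hu
    rw [div_eq_iff (mul_ne_zero (Complex.exp_ne_zero _) (sigma_ne_zero L hu))] at this
    rw [this]; ring

lemma exists_notMem_lattice : ∃ u, u ∉ L.lattice := ⟨_, L.ω₁_div_two_notMem_lattice⟩

/-- Applying the relation at u and at -u - ω and using that σ is odd returns to the starting value,
with total factor B². -/
lemma sigma_add_factor_sq {ω a B : ℂ}
    (h : ∀ u, sigma L (u + ω) = B * Complex.exp (a * (u + ω / 2)) * sigma L u) : B ^ 2 = 1 := by
  obtain ⟨u, hu⟩ := exists_notMem_lattice L
  have h1 := h u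
  have h2 := h (-u - ω)
  have e1 : -u - ω + ω = -u := by ring
  have e2 : -u - ω = -(u + ω) := by ring
  have e3 : a * (-u - ω + ω / 2) = -(a * (u + ω / 2)) := by ring
  rw [e1, e3, e2, sigma_neg, sigma_neg, h1, Complex.exp_neg] at h2
  have := sigma_ne_zero L hu
  have he := Complex.exp_ne_zero (a * (u + ω / 2))
  field_simp at h2
  linear_combination h2

/-- For ω = 2l, two steps by l give the factor B² = 1. Otherwise σ(ω/2) ≠ 0, and evaluation at u =
-ω/2 with σ odd forces B = -1. -/
lemma exists_sigma_add_eps {ω : ℂ} (hω : ω ∈ L.lattice) :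
    ∃ a, ∀ u, sigma L (u + ω) = eps L ω * Complex.exp (a * (u + ω / 2)) * sigma L u := by
  by_cases h2 : ∃ l ∈ L.lattice, ω = 2 * l
  · obtain ⟨l, hl, rfl⟩ := h2
    obtain ⟨a, B, h⟩ := exists_sigma_add L hl
    have hB := sigma_add_factor_sq L h
    refine ⟨2 * a, fun u => ?_⟩
    have e1 : u + 2 * l = u + l + l := by ring
    rw [e1, h, h, eps, if_pos ⟨l, hl, rfl⟩]
    have e2 : 2 * a * (u + 2 * l / 2) = a * (u + l + l / 2) + a * (u + l / 2) := by ring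
    rw [e2, Complex.exp_add]
    linear_combination (Complex.exp (a * (u + l + l / 2)) * Complex.exp (a * (u + l / 2)) *
      sigma L u) * hB
  · obtain ⟨a, B, h⟩ := exists_sigma_add L hω
    refine ⟨a, fun u => ?_⟩
    have hn : ω / 2 ∉ L.lattice := fun hm => h2 ⟨ω / 2, hm, by ring⟩
    have hs := sigma_ne_zero L hn
    have h3 := h (-(ω / 2))
    rw [sigma_neg] at h3
    have e1 : -(ω / 2) + ω = ω / 2 := by ring
    have e2 : a * (-(ω / 2) + ω / 2) = 0 := by ring
    rw [e1, e2, Complex.exp_zero] at h3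
    have hB : B = -1 := by
      have : (B + 1) * sigma L (ω / 2) = 0 := by linear_combination h3
      rcases mul_eq_zero.1 this with h | h
      · linear_combination h
      · exact absurd h hs
    rw [h, hB, eps, if_neg h2]

/-! ### The exponential `e` and the bracket [u] -/

lemma e_add (u v : ℂ) : e (u + v) = e u * e v := by
  rw [e, e, e, ← Complex.exp_add]; congr 1; ring

lemma e_ne_zero (u : ℂ) : e u ≠ 0 := Complex.exp_ne_zero _

lemma e_zero : e 0 = 1 := by simp [e]

lemma e_neg (u : ℂ) : e (-u) = (e u)⁻¹ := by
  rw [e, e, ← Complex.exp_neg]; congr 1; ring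

lemma e_sum {ι : Type*} (s : Finset ι) (f : ι → ℂ) : e (∑ i ∈ s, f i) = ∏ i ∈ s, e (f i) := by
  rw [e, Finset.mul_sum, Complex.exp_sum]; rfl

lemma differentiable_e : Differentiable ℂ e := by
  unfold e; fun_prop

variable (g : ℂ)

lemma exists_eta {ω : ℂ} (hω : ω ∈ L.lattice) :
    ∃ η : ℂ, ∀ u : ℂ, br L g (u + ω) = eps L ω * e (η * (u + ω / 2)) * br L g u := by
  obtain ⟨a, ha⟩ := exists_sigma_add_eps L hω
  -- The first summand rescales the exponent of σ; the second is contributed by e(g(u + ω)²)/e(gu²)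
  -- = e(2gω(u + ω/2)).
  refine ⟨a / (2 * Real.pi * Complex.I) + 2 * g * ω, fun u => ?_⟩
  have hpi : (2 * Real.pi * Complex.I : ℂ) ≠ 0 := Complex.two_pi_I_ne_zero
  have h1 : Complex.exp (a * (u + ω / 2)) = e (a / (2 * Real.pi * Complex.I) * (u + ω / 2)) := by
    rw [e]; congr 1; field_simp
  have h2 : e (g * (u + ω) ^ 2) = e (2 * g * ω * (u + ω / 2)) * e (g * u ^ 2) := by
    rw [← e_add]; congr 1; ring
  rw [br, br, ha, h1, h2, add_mul, e_add]
  ring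

lemma br_add {ω : ℂ} (hω : ω ∈ L.lattice) (u : ℂ) :
    br L g (u + ω) = eps L ω * e (eta L g ω * (u + ω / 2)) * br L g u :=
  Classical.epsilon_spec (exists_eta L g hω) u

lemma eps_mul_self (ω : ℂ) : eps L ω * eps L ω = 1 := by
  unfold eps; split_ifs <;> norm_num

lemma eps_ne_zero (ω : ℂ) : eps L ω ≠ 0 := left_ne_zero_of_mul_eq_one (eps_mul_self L ω)

lemma br_neg (u : ℂ) : br L g (-u) = -br L g u := by
  rw [br, br, sigma_neg, neg_sq, mul_neg]

lemma br_eq_zero_iff {u : ℂ} : br L g u = 0 ↔ u ∈ L.lattice := by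
  rw [br, mul_eq_zero, or_iff_right (e_ne_zero _)]
  exact ⟨fun h => by_contra fun hu => sigma_ne_zero L hu h, sigma_eq_zero L⟩

lemma br_zero : br L g 0 = 0 := (br_eq_zero_iff L g).2 (zero_mem _)

lemma differentiable_br : Differentiable ℂ (br L g) := by
  have h1 := differentiable_sigma L
  have h2 := differentiable_e
  unfold br
  fun_prop

@[fun_prop]
lemma continuous_br : Continuous (br L g) := (differentiable_br L g).continuous

@[fun_prop]
lemma analyticAt_br (u : ℂ) : AnalyticAt ℂ (br L g) u := (differentiable_br L g).analyticAt u

/-- This normalisation determines all residues of 1/[u], and hence every cancellation of poles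
below. -/
lemma deriv_br_zero : HasDerivAt (br L g) 1 0 := by
  have h1 : HasDerivAt (fun u : ℂ => e (g * u ^ 2) * sigmaProd L u)
      (deriv (fun u : ℂ => e (g * u ^ 2) * sigmaProd L u) 0) 0 := by
    apply DifferentiableAt.hasDerivAt
    have h1 := differentiable_sigmaProd L
    have h2 := differentiable_e
    fun_prop
  have h2 := (hasDerivAt_id (0 : ℂ)).mul h1
  have h3 : br L g = fun u => id u * (e (g * u ^ 2) * sigmaProd L u) := by
    funext u; rw [br, sigma_eq]; simp only [id]; ring
  rw [h3]
  refine h2.congr_deriv ?_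
  simp [sigmaProd_zero, e_zero]

end EllipticBC

end

open scoped BigOperators

noncomputable section

namespace EllipticBC

open Filter Topology

/-! ### Removable singularities and Liouville's theorem -/

/-- `f` agrees with an analytic function on a punctured neighbourhood of `p`. -/
def Regular (f : ℂ → ℂ) (p : ℂ) : Prop := ∃ a : ℂ → ℂ, AnalyticAt ℂ a p ∧ f =ᶠ[𝓝[≠] p] a

lemma _root_.AnalyticAt.regular {f : ℂ → ℂ} {p : ℂ} (h : AnalyticAt ℂ f p) : Regular f p :=
  ⟨f, h, .rfl⟩

namespace Regular

variable {f h : ℂ → ℂ} {p : ℂ}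

lemma congr (hf : Regular f p) (hfh : f =ᶠ[𝓝[≠] p] h) : Regular h p := by
  obtain ⟨a, ha, hfa⟩ := hf
  exact ⟨a, ha, hfh.symm.trans hfa⟩

lemma add (hf : Regular f p) (hh : Regular h p) : Regular (fun z => f z + h z) p := by
  obtain ⟨a, ha, hfa⟩ := hf
  obtain ⟨b, hb, hhb⟩ := hh
  exact ⟨fun z => a z + b z, ha.fun_add hb, by filter_upwards [hfa, hhb] with z h1 h2; rw [h1, h2]⟩

lemma mul (hf : Regular f p) (hh : Regular h p) : Regular (fun z => f z * h z) p := by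
  obtain ⟨a, ha, hfa⟩ := hf
  obtain ⟨b, hb, hhb⟩ := hh
  exact ⟨fun z => a z * b z, ha.fun_mul hb, by filter_upwards [hfa, hhb] with z h1 h2; rw [h1, h2]⟩

lemma const_mul (c : ℂ) (hf : Regular f p) : Regular (fun z => c * f z) p :=
  (analyticAt_const (v := c)).regular.mul hf

lemma sub (hf : Regular f p) (hh : Regular h p) : Regular (fun z => f z - h z) p := by
  refine (hf.add (hh.const_mul (-1))).congr (.of_forall fun z => ?_)
  simp [sub_eq_add_neg]

lemma meromorphicAt (hf : Regular f p) : MeromorphicAt f p := by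
  obtain ⟨a, ha, hfa⟩ := hf
  exact ha.meromorphicAt.congr hfa.symm

lemma exists_tendsto (hf : Regular f p) : ∃ c, Tendsto f (𝓝[≠] p) (𝓝 c) := by
  obtain ⟨a, ha, hfa⟩ := hf
  exact ⟨a p, (ha.continuousAt.tendsto.mono_left nhdsWithin_le_nhds).congr' hfa.symm⟩

/-- Multiplication by z - p raises the order by exactly one, so positive order of the product means
nonnegative order of f. It is the criterion used at simple poles with vanishing residue. -/
lemma of_tendsto_zero (hf : MeromorphicAt f p)
    (h0 : Tendsto (fun z => (z - p) * f z) (𝓝[≠] p) (𝓝 0)) : Regular f p := by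
  have h1 : MeromorphicAt (fun z : ℂ => z - p) p := by fun_prop
  have h2 := (tendsto_zero_iff_meromorphicOrderAt_pos (h1.fun_mul hf)).1 h0
  rw [fun_meromorphicOrderAt_mul h1 hf] at h2
  have h3 : meromorphicOrderAt (fun z : ℂ => z - p) p = 1 := by simp
  rw [h3] at h2
  refine hf.meromorphicOrderAt_nonneg_iff.1 ?_
  cases h4 : meromorphicOrderAt f p with
  | top => exact le_top
  | coe n =>
    rw [h4] at h2
    have : (0 : ℤ) < 1 + n := by exact_mod_cast h2
    have h5 : (0 : ℤ) ≤ n := by omega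
    exact_mod_cast h5

lemma comp_add_const (c : ℂ) (hf : Regular f (p + c)) : Regular (fun z => f (z + c)) p := by
  obtain ⟨a, ha, hfa⟩ := hf
  refine ⟨fun z => a (z + c), ha.comp_of_eq (by fun_prop) rfl, ?_⟩
  have : Tendsto (fun z : ℂ => z + c) (𝓝[≠] p) (𝓝[≠] (p + c)) := by
    refine tendsto_nhdsWithin_of_tendsto_nhds_of_eventually_within _
      ((continuous_add_const c).tendsto p |>.mono_left nhdsWithin_le_nhds) ?_
    filter_upwards [self_mem_nhdsWithin] with z hz
    simpa using hz
  exact this.eventually hfa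

lemma comp_neg (hf : Regular f (-p)) : Regular (fun z => f (-z)) p := by
  obtain ⟨a, ha, hfa⟩ := hf
  refine ⟨fun z => a (-z), ha.comp_of_eq (by fun_prop) rfl, ?_⟩
  have : Tendsto (fun z : ℂ => -z) (𝓝[≠] p) (𝓝[≠] (-p)) := by
    refine tendsto_nhdsWithin_of_tendsto_nhds_of_eventually_within _
      (continuous_neg.tendsto p |>.mono_left nhdsWithin_le_nhds) ?_
    filter_upwards [self_mem_nhdsWithin] with z hz
    simpa using hz
  exact this.eventually hfa

end Regular

/-- The value at each point of the analytic extension of a function with removable singularities. -/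
lemma exists_entire_extension {f : ℂ → ℂ} (hf : ∀ p, Regular f p) :
    ∃ F : ℂ → ℂ, Differentiable ℂ F ∧ ∀ p, Tendsto f (𝓝[≠] p) (𝓝 (F p)) := by
  choose a ha hfa using hf
  have hlim : ∀ p, Tendsto f (𝓝[≠] p) (𝓝 (a p p)) := fun p =>
    ((ha p).continuousAt.tendsto.mono_left nhdsWithin_le_nhds).congr' (hfa p).symm
  refine ⟨fun p => a p p, fun p => ?_, hlim⟩
  refine ((ha p).congr ?_).differentiableAt
  -- Near p both numbers are the limit of f at q, so the values a q q are locally those of the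
  -- single analytic function a p.
  have h1 : ∀ᶠ q in 𝓝[≠] p, a p q = a q q := by
    have h3 : ∀ᶠ q in 𝓝[≠] p, AnalyticAt ℂ (a p) q :=
      (ha p).eventually_analyticAt.filter_mono nhdsWithin_le_nhds
    have h4 : ∀ᶠ q in 𝓝[≠] p, ∀ᶠ z in 𝓝[≠] q, f z = a p z := by
      have := (eventually_eventually_nhdsWithin (s := {p}ᶜ) (a := p)).2 (hfa p)
      filter_upwards [this, self_mem_nhdsWithin] with q hq hqp
      rw [(isOpen_compl_singleton (x := p)).nhdsWithin_eq hqp] at hq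
      exact hq.filter_mono nhdsWithin_le_nhds
    filter_upwards [h3, h4] with q h3 h4
    exact tendsto_nhds_unique
      ((h3.continuousAt.tendsto.mono_left nhdsWithin_le_nhds).congr'
        (h4.mono fun z hz => hz.symm)) (hlim q)
  have h2 := eventually_nhdsWithin_iff.1 h1
  filter_upwards [h2] with q hq
  by_cases hqp : q = p
  · rw [hqp]
  · exact hq hqp

variable (L : PeriodPair)

/-- Liouville's theorem for elliptic functions with removable singularities. -/
lemma elliptic_regular_const {f : ℂ → ℂ} (hf : ∀ p, Regular f p)
    (hper : ∀ ω ∈ L.lattice, ∀ z, f (z + ω) = f z) :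
    ∃ C, ∀ p, Tendsto f (𝓝[≠] p) (𝓝 C) := by
  obtain ⟨F, hF, hlim⟩ := exists_entire_extension hf
  have hFper : ∀ z w, w ∈ L.lattice → F (z + w) = F z := by
    intro z w hw
    refine tendsto_nhds_unique ?_ (hlim z)
    have : Tendsto (fun u : ℂ => u + w) (𝓝[≠] z) (𝓝[≠] (z + w)) := by
      refine tendsto_nhdsWithin_of_tendsto_nhds_of_eventually_within _
        ((continuous_add_const w).tendsto z |>.mono_left nhdsWithin_le_nhds) ?_
      filter_upwards [self_mem_nhdsWithin] with z hz
      simpa using hz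
    exact ((hlim (z + w)).comp this).congr fun u => hper w hw u
  have hb := (IsZLattice.isCompact_range_of_periodic L.lattice F hF.continuous hFper).isBounded
  exact ⟨F 0, fun p => by rw [hF.apply_eq_apply_of_bounded hb 0 p]; exact hlim p⟩

variable (g : ℂ)

/-! ### Quasi-periodic functions -/

/-- `f` has the quasi-periods of an even theta function of degree `2k`. -/
def QuasiPer (k : ℂ) (f : ℂ → ℂ) : Prop :=
  ∀ ω ∈ L.lattice, ∀ z, f (z + ω) = e (eta L g ω * (k * (2 * z + ω))) * f z

variable {L g}

lemma QuasiPer.mul {k l : ℂ} {f h : ℂ → ℂ} (hf : QuasiPer L g k f) (hh : QuasiPer L g l h) :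
    QuasiPer L g (k + l) (fun z => f z * h z) := by
  intro ω hω z
  simp only
  rw [hf ω hω, hh ω hω, add_mul, mul_add (eta L g ω), e_add]; ring

lemma QuasiPer.inv {k : ℂ} {f : ℂ → ℂ} (hf : QuasiPer L g k f) :
    QuasiPer L g (-k) (fun z => (f z)⁻¹) := by
  intro ω hω z
  simp only
  rw [hf ω hω, neg_mul, mul_neg, e_neg, mul_inv]

lemma QuasiPer.div {k l : ℂ} {f h : ℂ → ℂ} (hf : QuasiPer L g k f) (hh : QuasiPer L g l h) :
    QuasiPer L g (k - l) (fun z => f z / h z) := by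
  simpa only [div_eq_mul_inv, sub_eq_add_neg] using hf.mul hh.inv

lemma QuasiPer.add {k : ℂ} {f h : ℂ → ℂ} (hf : QuasiPer L g k f) (hh : QuasiPer L g k h) :
    QuasiPer L g k (fun z => f z + h z) := by
  intro ω hω z
  simp only
  rw [hf ω hω, hh ω hω, ← mul_add]

lemma QuasiPer.const_mul {k : ℂ} {f : ℂ → ℂ} (c : ℂ) (hf : QuasiPer L g k f) :
    QuasiPer L g k (fun z => c * f z) := by
  intro ω hω z
  simp only
  rw [hf ω hω, mul_left_comm]

lemma QuasiPer.sub {k : ℂ} {f h : ℂ → ℂ} (hf : QuasiPer L g k f) (hh : QuasiPer L g k h) :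
    QuasiPer L g k (fun z => f z - h z) := by
  intro ω hω z
  simp only
  rw [hf ω hω, hh ω hω, ← mul_sub]

lemma QuasiPer.sum {ι : Type*} {s : Finset ι} {k : ℂ} {f : ι → ℂ → ℂ}
    (hf : ∀ i ∈ s, QuasiPer L g k (f i)) : QuasiPer L g k (fun z => ∑ i ∈ s, f i z) := by
  intro ω hω z
  simp only
  rw [Finset.mul_sum]
  exact Finset.sum_congr rfl fun i hi => hf i hi ω hω z

lemma QuasiPer.prod {ι : Type*} {s : Finset ι} {k : ℂ} {f : ι → ℂ → ℂ}
    (hf : ∀ i ∈ s, QuasiPer L g k (f i)) : QuasiPer L g (s.card * k) (fun z => ∏ i ∈ s, f i z) := by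
  classical
  induction s using Finset.induction_on with
  | empty => intro ω _ z; simp [e_zero]
  | insert i s hi ih =>
    simp_rw [Finset.prod_insert hi]
    have := (hf i (Finset.mem_insert_self _ _)).mul
      (ih fun j hj => hf j (Finset.mem_insert_of_mem hj))
    convert this using 1
    rw [Finset.card_insert_of_notMem hi]; push_cast; ring

/-- The signs square to 1 and the contributions of t cancel, so the multiplier does not depend on t.
All functions [z ± t] can therefore be compared with one another. -/
lemma quasiPer_brpm (t : ℂ) : QuasiPer L g 1 (fun z => brpm L g z t) := by
  intro ω hω z
  simp only [brpm]
  have e1 : z + ω + t = z + t + ω := by ring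
  have e2 : z + ω - t = z - t + ω := by ring
  have e3 : eta L g ω * (1 * (2 * z + ω)) =
    eta L g ω * (z + t + ω / 2) + eta L g ω * (z - t + ω / 2) := by ring
  rw [e1, e2, br_add L g hω, br_add L g hω, e3, e_add]
  linear_combination (e (eta L g ω * (z + t + ω / 2)) * br L g (z + t) *
    (e (eta L g ω * (z - t + ω / 2)) * br L g (z - t))) * eps_mul_self L ω

lemma brpm_neg_left (z t : ℂ) : brpm L g (-z) t = brpm L g z t := by
  have e1 : -z + t = -(z - t) := by ring
  have e2 : -z - t = -(z + t) := by ring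
  rw [brpm, brpm, e1, e2, br_neg, br_neg]; ring

lemma brpm_neg_right (z t : ℂ) : brpm L g z (-t) = brpm L g z t := by
  have e1 : z - -t = z + t := by ring
  rw [brpm, brpm, e1, ← sub_eq_add_neg, mul_comm]

lemma brpm_swap (z t : ℂ) : brpm L g z t = -brpm L g t z := by
  have e2 : z - t = -(t - z) := by ring
  rw [brpm, brpm, e2, br_neg, add_comm]; ring

lemma Regular.of_neg {f : ℂ → ℂ} {p : ℂ} (heven : ∀ z, f (-z) = f z) (h : Regular f (-p)) :
    Regular f p := by
  simpa only [heven] using h.comp_neg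

/-- The multiplier is entire without zeros, so regularity need only be checked once modulo the
lattice. -/
lemma Regular.of_quasiPer {k : ℂ} {f : ℂ → ℂ} {p ω : ℂ} (hf : QuasiPer L g k f)
    (hω : ω ∈ L.lattice) (h : Regular f (p + ω)) : Regular f p := by
  have h1 := h.comp_add_const ω
  have h2 : AnalyticAt ℂ (fun z => (e (eta L g ω * (k * (2 * z + ω))))⁻¹) p := by
    have := differentiable_e
    refine AnalyticAt.inv ?_ (e_ne_zero _)
    refine Differentiable.analyticAt ?_ p
    fun_prop
  refine (h2.regular.mul h1).congr (.of_forall fun z => ?_)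
  simp only
  rw [hf ω hω, inv_mul_cancel_left₀ (e_ne_zero _)]

/-- The residue of `1 / [a z + c]` at a zero of the denominator. -/
lemma tendsto_sub_div_br {a c p ω : ℂ} (ha : a ≠ 0) (hω : ω ∈ L.lattice) (h : a * p + c = ω) :
    Tendsto (fun z => (z - p) / br L g (a * z + c)) (𝓝[≠] p)
      (𝓝 (eps L ω * e (-(eta L g ω * (ω / 2))) / a)) := by
  have h1 : HasDerivAt (fun z => br L g (a * z + c)) (eps L ω * e (eta L g ω * (ω / 2)) * a) p := by
    have h2 : (fun z => br L g (a * z + c)) = fun z =>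
        eps L ω * e (eta L g ω * (a * z + c - ω + ω / 2)) * br L g (a * z + c - ω) := by
      funext z
      rw [← br_add L g hω]; congr 1; ring
    have h3 : HasDerivAt (fun z => br L g (a * z + c - ω)) a p := by
      have h4 : HasDerivAt (fun z : ℂ => a * z + c - ω) a p := by
        simpa using (((hasDerivAt_id p).const_mul a).add_const c).sub_const ω
      have h5 : HasDerivAt (br L g) 1 (a * p + c - ω) := by
        rw [h, sub_self]; exact deriv_br_zero L g
      refine HasDerivAt.congr_deriv ?_ (one_mul a)
      exact (h5.comp p h4 :)
    have h4 : HasDerivAt (fun z => eps L ω * e (eta L g ω * (a * z + c - ω + ω / 2)))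
        (deriv (fun z => eps L ω * e (eta L g ω * (a * z + c - ω + ω / 2))) p) p := by
      have := differentiable_e
      apply DifferentiableAt.hasDerivAt
      fun_prop
    rw [h2]
    refine (h4.mul h3).congr_deriv ?_
    rw [h, sub_self, br_zero, zero_add]; ring
  have h0 : br L g (a * p + c) = 0 := (br_eq_zero_iff L g).2 (h ▸ hω)
  have h2 := h1.tendsto_slope
  have h3 : eps L ω * e (eta L g ω * (ω / 2)) * a ≠ 0 :=
    mul_ne_zero (mul_ne_zero (eps_ne_zero L ω) (e_ne_zero _)) ha
  have h4 := h2.inv₀ h3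
  have h5 : (eps L ω * e (eta L g ω * (ω / 2)) * a)⁻¹ =
      eps L ω * e (-(eta L g ω * (ω / 2))) / a := by
    rw [e_neg, mul_inv, mul_inv, div_eq_mul_inv]
    congr 2
    exact inv_eq_of_mul_eq_one_left (eps_mul_self L ω)
  rw [h5] at h4
  refine h4.congr fun z => ?_
  simp only [slope, vsub_eq_sub, smul_eq_mul, h0, sub_zero]
  rw [mul_inv, inv_inv, div_eq_mul_inv]

/-! ### Separated points and the uniqueness principle for even theta functions -/

/-- For generic points: none of the expressions `2 s_i`, `s_i ± s_j` is a period. -/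
structure Separated {ι : Type*} (L : PeriodPair) (s : ι → ℂ) : Prop where
  two_mul : ∀ i, 2 * s i ∉ L.lattice
  add : ∀ i j, i ≠ j → s i + s j ∉ L.lattice
  sub : ∀ i j, i ≠ j → s i - s j ∉ L.lattice

lemma countable_lattice (L : PeriodPair) : (L.lattice : Set ℂ).Countable := by
  have : Countable L.lattice := L.latticeEquivProd.toEquiv.injective.countable
  exact Set.countable_coe_iff.1 this

lemma exists_notMem_of_countable {S : Set ℂ} (hS : S.Countable) : ∃ t, t ∉ S := by
  exact (hS.isConnected_compl_of_one_lt_rank (E := ℂ) (by simp)).nonempty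

lemma exists_avoiding {ι : Type*} [Countable ι] (L : PeriodPair) (s : ι → ℂ) :
    ∃ t : ℂ, 2 * t ∉ L.lattice ∧ ∀ i, t + s i ∉ L.lattice ∧ t - s i ∉ L.lattice := by
  have hc := countable_lattice L
  obtain ⟨t, ht⟩ := exists_notMem_of_countable
    (((hc.preimage (f := fun t : ℂ => 2 * t) (mul_right_injective₀ two_ne_zero)).union
      ((Set.countable_iUnion fun i => hc.preimage (f := fun t : ℂ => t + s i)
        (add_left_injective _)))).union
      ((Set.countable_iUnion fun i => hc.preimage (f := fun t : ℂ => t - s i)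
        (sub_left_injective))))
  simp only [Set.mem_union, Set.mem_iUnion, Set.mem_preimage, SetLike.mem_coe, not_or,
    not_exists] at ht
  exact ⟨t, ht.1.1, fun i => ⟨ht.1.2 i, ht.2 i⟩⟩

lemma br_ne_zero {u : ℂ} (h : u ∉ L.lattice) : br L g u ≠ 0 := fun h' => h ((br_eq_zero_iff L g).1 h')

lemma brpm_ne_zero {u v : ℂ} (h : u + v ∉ L.lattice) (h' : u - v ∉ L.lattice) :
    brpm L g u v ≠ 0 := mul_ne_zero (br_ne_zero h) (br_ne_zero h')

@[fun_prop]
lemma analyticAt_brpm {f h : ℂ → ℂ} {p : ℂ} (hf : AnalyticAt ℂ f p) (hh : AnalyticAt ℂ h p) :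
    AnalyticAt ℂ (fun z => brpm L g (f z) (h z)) p := by
  unfold brpm
  exact ((analyticAt_br L g _).fun_comp (hf.fun_add hh)).fun_mul
    ((analyticAt_br L g _).fun_comp (hf.fun_sub hh))

/-- An even quasi-periodic function of degree `2(d-1)` without poles which vanishes at `d`
separated points vanishes identically. -/
lemma tendsto_zero_of_quasiPer {ι : Type*} [Fintype ι] {s : ι → ℂ} (hs : Separated L s)
    {E : ℂ → ℂ} (hreg : ∀ p, Regular E p) (heven : ∀ z, E (-z) = E z)
    (hper : QuasiPer L g ((Fintype.card ι : ℂ) - 1) E)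
    (hzero : ∀ i, Tendsto E (𝓝[≠] (s i)) (𝓝 0)) (p : ℂ) : Tendsto E (𝓝[≠] p) (𝓝 0) := by
  classical
  -- An auxiliary zero at ±t raises the degree of E to that of ∏[z ± s_i], so the quotient Q is
  -- elliptic. Avoiding p makes it possible to divide by [z ± t] near p at the end.
  obtain ⟨t, -, htp⟩ := exists_avoiding L (fun o : Option ι => o.elim p s)
  have ht : ∀ i, t + s i ∉ L.lattice ∧ t - s i ∉ L.lattice := fun i => htp (some i)
  have hp : brpm L g p t ≠ 0 := by
    rw [brpm_swap, neg_ne_zero]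
    exact brpm_ne_zero (htp none).1 (htp none).2
  let ψ : ℂ → ℂ := fun z => ∏ i, brpm L g z (s i)
  let Q : ℂ → ℂ := fun z => E z * brpm L g z t / ψ z
  have hψper : QuasiPer L g (Fintype.card ι : ℂ) ψ := by
    have := QuasiPer.prod (s := Finset.univ) fun i _ => quasiPer_brpm (L := L) (g := g) (s i)
    simpa using this
  have hQper : QuasiPer L g 0 Q := by
    have := (hper.mul (quasiPer_brpm t)).div hψper
    simpa [Q] using this
  have hQeven : ∀ z, Q (-z) = Q z := by
    intro z
    simp only [Q, ψ, heven, brpm_neg_left]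
  have hψan : ∀ p, AnalyticAt ℂ ψ p := fun p =>
    Finset.analyticAt_fun_prod _ fun i _ => by fun_prop
  -- Separation makes s_i a simple zero of the denominator, and E vanishes there; evenness and
  -- periodicity carry this to all other zeros.
  have hQs : ∀ i, Regular Q (s i) := by
    intro i
    have hmer : MeromorphicAt Q (s i) :=
      ((hreg _).meromorphicAt.fun_mul (analyticAt_brpm (by fun_prop) (by fun_prop)).meromorphicAt).fun_div
        (hψan _).meromorphicAt
    refine .of_tendsto_zero hmer ?_
    let rest : ℂ → ℂ := fun z => br L g (z + s i) * ∏ j ∈ Finset.univ.erase i, brpm L g z (s j)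
    have hrest : ContinuousAt rest (s i) := by
      refine AnalyticAt.continuousAt (𝕜 := ℂ) ?_
      refine AnalyticAt.fun_mul (by fun_prop) (Finset.analyticAt_fun_prod _ fun j _ => by fun_prop)
    have hrest0 : rest (s i) ≠ 0 := by
      refine mul_ne_zero (br_ne_zero ?_) (Finset.prod_ne_zero_iff.2 fun j hj => ?_)
      · rw [← _root_.two_mul]; exact hs.two_mul i
      · have hj' : i ≠ j := (Finset.ne_of_mem_erase hj).symm
        exact brpm_ne_zero (hs.add i j hj') (hs.sub i j hj')
    have h1 := tendsto_sub_div_br (L := L) (g := g) (a := 1) (c := -s i) (p := s i) one_ne_zero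
      (zero_mem _) (by ring)
    have h2 : Tendsto (fun z => brpm L g z t) (𝓝[≠] (s i)) (𝓝 (brpm L g (s i) t)) :=
      ((analyticAt_brpm (by fun_prop) (by fun_prop)).continuousAt.tendsto).mono_left
        nhdsWithin_le_nhds
    have h3 := (((hzero i).mul h2).mul h1).div (hrest.tendsto.mono_left nhdsWithin_le_nhds) hrest0
    simp only [zero_mul, zero_div] at h3
    refine h3.congr fun z => ?_
    simp only [Q, ψ, rest, Pi.div_apply]
    rw [← Finset.mul_prod_erase Finset.univ _ (Finset.mem_univ i)]
    simp only [brpm, one_mul, sub_eq_add_neg, div_eq_mul_inv, mul_inv]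
    ring
  have hQreg : ∀ p, Regular Q p := by
    intro p
    by_cases h : ψ p = 0
    · obtain ⟨i, -, hi⟩ := Finset.prod_eq_zero_iff.1 h
      rcases mul_eq_zero.1 hi with h1 | h1
      · have h1 := (br_eq_zero_iff L g).1 h1
        refine .of_neg hQeven (.of_quasiPer hQper h1 ?_)
        simpa using hQs i
      · have h1 := (br_eq_zero_iff L g).1 h1
        refine .of_quasiPer hQper (L.lattice.neg_mem h1) ?_
        simpa using hQs i
    · have h1 := ((hreg p).mul (analyticAt_brpm (L := L) (g := g) (f := id) (h := fun _ => t)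
        (by fun_prop) (by fun_prop)).regular).mul ((hψan p).fun_inv h).regular
      simpa only [Q, div_eq_mul_inv, id] using h1
  obtain ⟨C, hC⟩ := elliptic_regular_const L hQreg fun ω hω z => by
    have := hQper ω hω z
    simpa [e_zero] using this
  obtain ⟨c, hc⟩ := (hreg t).exists_tendsto
  have hψt : ψ t ≠ 0 :=
    Finset.prod_ne_zero_iff.2 fun i _ => brpm_ne_zero (ht i).1 (ht i).2
  -- At z = t the factor [z ± t] vanishes while the denominator does not.
  have hC0 : C = 0 := by
    have h2 : Tendsto (fun z => brpm L g z t) (𝓝[≠] t) (𝓝 (brpm L g t t)) :=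
      ((analyticAt_brpm (by fun_prop) (by fun_prop)).continuousAt.tendsto).mono_left
        nhdsWithin_le_nhds
    have h3 := (hc.mul h2).div ((hψan t).continuousAt.tendsto.mono_left nhdsWithin_le_nhds) hψt
    have h4 : brpm L g t t = 0 := by rw [brpm, sub_self, br_zero, mul_zero]
    rw [h4, mul_zero, zero_div] at h3
    exact tendsto_nhds_unique (hC t) h3
  have key : Tendsto (fun z => E z * brpm L g z t) (𝓝[≠] p) (𝓝 0) := by
    have h3 := (hC p).mul ((hψan p).continuousAt.tendsto.mono_left nhdsWithin_le_nhds)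
    rw [hC0, zero_mul] at h3
    refine h3.congr' ?_
    -- Otherwise the identity theorem would make ψ vanish identically, contradicting its value at t.
    have h4 : ∀ᶠ z in 𝓝[≠] p, ψ z ≠ 0 := by
      rcases (hψan p).eventually_eq_zero_or_eventually_ne_zero with h | h
      · exfalso
        have h5 := AnalyticOnNhd.eqOn_zero_of_preconnected_of_eventuallyEq_zero
          (f := ψ) (U := Set.univ) (fun z _ => hψan z) isPreconnected_univ (Set.mem_univ p) h
        exact hψt (h5 (Set.mem_univ t))
      · exact h
    filter_upwards [h4] with z hz
    simp only [Q]
    rw [div_mul_cancel₀ _ hz]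
  have h2 : ContinuousAt (fun z => brpm L g z t) p :=
    (analyticAt_brpm (by fun_prop) (by fun_prop)).continuousAt
  have h3 := key.div (h2.tendsto.mono_left nhdsWithin_le_nhds) hp
  rw [zero_div] at h3
  refine h3.congr' ?_
  filter_upwards [(h2.eventually_ne hp).filter_mono nhdsWithin_le_nhds] with z hz
  simp only [Pi.div_apply]
  rw [mul_div_cancel_right₀ _ hz]

end EllipticBC

end

open scoped BigOperators

noncomputable section

namespace EllipticBC

open Filter Topology

variable {L : PeriodPair} {g : ℂ}

/-! ### The three-term relation -/

lemma AnalyticAt.tendsto_punctured {f : ℂ → ℂ} {p : ℂ} (hf : AnalyticAt ℂ f p) :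
    Tendsto f (𝓝[≠] p) (𝓝 (f p)) := hf.continuousAt.tendsto.mono_left nhdsWithin_le_nhds

/-- As a function of z, the difference of the two sides is an even theta function of degree 2 that
vanishes at the two separated points p and q. -/
lemma three_term {p q : ℂ} (hp : 2 * p ∉ L.lattice) (hq : 2 * q ∉ L.lattice)
    (hadd : p + q ∉ L.lattice) (hsub : p - q ∉ L.lattice) (z t : ℂ) :
    brpm L g z t * brpm L g p q = brpm L g z p * brpm L g t q - brpm L g z q * brpm L g t p := by
  let E : ℂ → ℂ := fun z => brpm L g p q * brpm L g z t -
    (brpm L g t q * brpm L g z p - brpm L g t p * brpm L g z q)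
  have hs : Separated L ![p, q] := by
    refine ⟨fun i => ?_, fun i j hij => ?_, fun i j hij => ?_⟩
    · fin_cases i <;> simpa
    · fin_cases i <;> fin_cases j <;> simp_all [add_comm]
    · fin_cases i <;> fin_cases j <;> simp_all
      rwa [← neg_sub, neg_mem_iff]
  have han : ∀ z, AnalyticAt ℂ E z := fun z => by
    have h1 (c t : ℂ) : AnalyticAt ℂ (fun z => c * brpm L g z t) z :=
      analyticAt_const.fun_mul (by fun_prop)
    exact (h1 _ _).fun_sub ((h1 _ _).fun_sub (h1 _ _))
  have hz0 (t : ℂ) : brpm L g t t = 0 := by rw [brpm, sub_self, br_zero, mul_zero]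
  have hper : QuasiPer L g ((Fintype.card (Fin 2) : ℂ) - 1) E := by
    have h1 (c t : ℂ) := (quasiPer_brpm (L := L) (g := g) t).const_mul c
    have := (h1 (brpm L g p q) t).sub ((h1 (brpm L g t q) p).sub (h1 (brpm L g t p) q))
    convert! this using 1
    simp; norm_num
  have h := tendsto_zero_of_quasiPer hs (E := E) (fun z => (han z).regular)
    (fun z => by simp only [E, brpm_neg_left]) hper (by
      intro i
      have := AnalyticAt.tendsto_punctured (han (![p, q] i))
      convert! this using 2
      fin_cases i
      · simp only [E]
        simp [hz0]
        rw [brpm_swap t p]; ring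
      · simp only [E]
        simp [hz0]
        rw [brpm_swap p q, brpm_swap t q]; ring) z
  have h2 := tendsto_nhds_unique (AnalyticAt.tendsto_punctured (han z)) h
  simp only [E] at h2
  linear_combination h2

/-! ### Cauchy determinants -/

/-- The columns are polynomials of degree below n evaluated at x, so the matrix is Vandermonde(x)
times a coefficient matrix independent of x. Specialising x = y makes the matrix diagonal and yields
the coefficient determinant; if y has a repetition, two columns coincide. -/
lemma det_prod_erase_sub {K : Type*} [Field K] {n : ℕ} (x y : Fin n → K) :
    (Matrix.of fun i j => ∏ l ∈ Finset.univ.erase j, (x i - y l)).det =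
      (∏ i, ∏ j ∈ Finset.Ioi i, (x j - x i)) * ∏ i, ∏ j ∈ Finset.Ioi i, (y i - y j) := by
  classical
  by_cases hy : Function.Injective y
  · let Q : Fin n → Polynomial K := fun j =>
      ∏ l ∈ Finset.univ.erase j, (Polynomial.X - Polynomial.C (y l))
    have hdeg : ∀ j, (Q j).natDegree < n := by
      intro j
      have h0 : 0 < n := j.pos
      rw [Polynomial.natDegree_finsetProd_X_sub_C_eq_card]
      rw [Finset.card_erase_of_mem (Finset.mem_univ _), Finset.card_univ, Fintype.card_fin]
      omega
    have hfac : ∀ v : Fin n → K, (Matrix.of fun i j => ∏ l ∈ Finset.univ.erase j, (v i - y l)) =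
        Matrix.vandermonde v * Matrix.of fun (k : Fin n) j => (Q j).coeff k := by
      intro v
      ext i j
      have h1 : (Q j).eval (v i) = ∏ l ∈ Finset.univ.erase j, (v i - y l) := by
        simp [Q, Polynomial.eval_prod]
      rw [Matrix.of_apply, ← h1, Polynomial.eval_eq_sum_range' (hdeg j), Matrix.mul_apply,
        Finset.sum_range]
      refine Finset.sum_congr rfl fun k _ => ?_
      rw [Matrix.vandermonde_apply, Matrix.of_apply, mul_comm]
    have hdiag : (Matrix.of fun i j => ∏ l ∈ Finset.univ.erase j, (y i - y l)).det =
        ∏ i, ∏ l ∈ Finset.univ.erase i, (y i - y l) := by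
      have : (Matrix.of fun i j => ∏ l ∈ Finset.univ.erase j, (y i - y l)) =
          Matrix.diagonal fun i => ∏ l ∈ Finset.univ.erase i, (y i - y l) := by
        ext i j
        by_cases hij : i = j
        · subst hij; simp
        · rw [Matrix.diagonal_apply_ne _ hij, Matrix.of_apply]
          exact Finset.prod_eq_zero (Finset.mem_erase.2 ⟨hij, Finset.mem_univ _⟩) (sub_self _)
      rw [this, Matrix.det_diagonal]
    have hoff : ∏ i, ∏ l ∈ Finset.univ.erase i, (y i - y l) =
        (∏ i, ∏ j ∈ Finset.Ioi i, (y j - y i)) * ∏ i, ∏ j ∈ Finset.Ioi i, (y i - y j) := by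
      have := Finset.prod_prod_Ioi_mul_eq_prod_prod_off_diag (fun i j : Fin n => y j - y i)
      rw [← Finset.prod_mul_distrib]
      simp_rw [← Finset.prod_mul_distrib]
      have he : ∀ i : Fin n, Finset.univ.erase i = {i}ᶜ := fun i => by ext; simp
      simp_rw [he]
      rw [← this]
      exact Finset.prod_congr rfl fun i _ => Finset.prod_congr rfl fun j _ => mul_comm _ _
    have hV : (Matrix.vandermonde y).det ≠ 0 := Matrix.det_vandermonde_ne_zero_iff.2 hy
    have h1 := congrArg Matrix.det (hfac y)
    rw [Matrix.det_mul, hdiag, hoff, ← Matrix.det_vandermonde] at h1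
    rw [hfac x, Matrix.det_mul, ← mul_left_cancel₀ hV h1, Matrix.det_vandermonde]
  · simp only [Function.Injective, not_forall] at hy
    obtain ⟨a, b, hab, hne⟩ := hy
    have hR : ∏ i, ∏ j ∈ Finset.Ioi i, (y i - y j) = 0 := by
      rcases lt_or_gt_of_ne hne with h | h
      · exact Finset.prod_eq_zero (Finset.mem_univ a)
          (Finset.prod_eq_zero (Finset.mem_Ioi.2 h) (by rw [hab, sub_self]))
      · exact Finset.prod_eq_zero (Finset.mem_univ b)
          (Finset.prod_eq_zero (Finset.mem_Ioi.2 h) (by rw [hab, sub_self]))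
    rw [hR, mul_zero]
    refine Matrix.det_zero_of_column_eq hne fun i => ?_
    simp only [Matrix.of_apply]
    rw [← Finset.mul_prod_erase (Finset.univ.erase a) _
        (Finset.mem_erase.2 ⟨Ne.symm hne, Finset.mem_univ b⟩),
      ← Finset.mul_prod_erase (Finset.univ.erase b) _
        (Finset.mem_erase.2 ⟨hne, Finset.mem_univ a⟩), hab, Finset.erase_right_comm]

/-- The product of `[z_i ± z_j]` over `i < j`. -/
def delta (L : PeriodPair) (g : ℂ) {n : ℕ} (z : Fin n → ℂ) : ℂ :=
  ∏ i, ∏ j ∈ Finset.Ioi i, brpm L g (z i) (z j)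

/-- Each index lies in n - 1 pairs. -/
lemma prod_Ioi_swap {n : ℕ} (f : Fin n → ℂ) :
    ∏ i, ∏ j ∈ Finset.Ioi i, (f i * f j) = ∏ i, ∏ _l ∈ Finset.univ.erase i, f i := by
  have he : ∀ i : Fin n, Finset.univ.erase i = {i}ᶜ := fun i => by ext; simp
  simp_rw [he]
  exact Finset.prod_prod_Ioi_mul_eq_prod_prod_off_diag (fun _ j : Fin n => f j)

/-- The elliptic Cauchy determinant of type `C`. -/
lemma det_one_div_brpm {n : ℕ} (z t : Fin n → ℂ) (h : ∀ i j, brpm L g (z i) (t j) ≠ 0) :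
    (Matrix.of fun i j => 1 / brpm L g (z i) (t j)).det =
      delta L g z * (∏ i, ∏ j ∈ Finset.Ioi i, brpm L g (t j) (t i)) /
        ∏ i, ∏ j, brpm L g (z i) (t j) := by
  classical
  -- With generic p and q the three-term relation reads [u ± v] = β(u)β(v)(X(u) - X(v)), which
  -- reduces the determinant to the rational one in X. Avoiding all z_i and t_j keeps β nonzero at
  -- them.
  obtain ⟨q, hq2, hq⟩ := exists_avoiding L (Sum.elim z t)
  obtain ⟨p, hp2, hp⟩ := exists_avoiding L (fun _ : Unit => q)
  have hpq : brpm L g p q ≠ 0 := brpm_ne_zero (hp ()).1 (hp ()).2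
  let β : ℂ → ℂ := fun z => brpm L g z q
  let X : ℂ → ℂ := fun z => brpm L g z p / brpm L g p q / β z
  have hβz : ∀ i, β (z i) ≠ 0 := fun i => by
    simp only [β]; rw [brpm_swap, neg_ne_zero]
    exact brpm_ne_zero (hq (Sum.inl i)).1 (hq (Sum.inl i)).2
  have hβt : ∀ i, β (t i) ≠ 0 := fun i => by
    simp only [β]; rw [brpm_swap, neg_ne_zero]
    exact brpm_ne_zero (hq (Sum.inr i)).1 (hq (Sum.inr i)).2
  have key : ∀ u v, β u ≠ 0 → β v ≠ 0 → brpm L g u v = β u * β v * (X u - X v) := by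
    intro u v hu hv
    have h3 := three_term (L := L) (g := g) hp2 hq2 (hp ()).1 (hp ()).2 u v
    simp only [X]
    field_simp
    simp only [β]
    linear_combination h3
  have hX : ∀ i j, X (z i) - X (t j) ≠ 0 := fun i j h0 => h i j (by
    rw [key _ _ (hβz i) (hβt j), h0, mul_zero])
  have hdet : (Matrix.of fun i j => 1 / brpm L g (z i) (t j)).det =
      (∏ i, (β (z i) * ∏ l, (X (z i) - X (t l)))⁻¹) * ((∏ j, (β (t j))⁻¹) *
      (Matrix.of fun i j => ∏ l ∈ Finset.univ.erase j, (X (z i) - X (t l))).det) := by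
    rw [← Matrix.det_mul_row, ← Matrix.det_mul_column]
    congr 1
    ext i j
    simp only [Matrix.of_apply]
    rw [key _ _ (hβz i) (hβt j), ← Finset.mul_prod_erase _ _ (Finset.mem_univ j)]
    have h1 : ∏ l ∈ Finset.univ.erase j, (X (z i) - X (t l)) ≠ 0 :=
      Finset.prod_ne_zero_iff.2 fun l _ => hX i l
    have h2 := hX i j
    have h3 := hβz i
    have h4 := hβt j
    field_simp
  have h1 : delta L g z = (∏ i, ∏ _l ∈ Finset.univ.erase i, β (z i)) *
      ∏ i, ∏ j ∈ Finset.Ioi i, (X (z i) - X (z j)) := by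
    rw [delta, ← prod_Ioi_swap, ← Finset.prod_mul_distrib]
    simp_rw [← Finset.prod_mul_distrib]
    exact Finset.prod_congr rfl fun i _ => Finset.prod_congr rfl fun j _ =>
      key _ _ (hβz i) (hβz j)
  have h2 : ∏ i, ∏ j ∈ Finset.Ioi i, brpm L g (t j) (t i) =
      (∏ i, ∏ _l ∈ Finset.univ.erase i, β (t i)) *
      ∏ i, ∏ j ∈ Finset.Ioi i, (X (t j) - X (t i)) := by
    rw [← prod_Ioi_swap, ← Finset.prod_mul_distrib]
    simp_rw [← Finset.prod_mul_distrib]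
    refine Finset.prod_congr rfl fun i _ => Finset.prod_congr rfl fun j _ => ?_
    rw [key _ _ (hβt j) (hβt i)]; ring
  have h3 : ∏ i, ∏ j, brpm L g (z i) (t j) = (∏ i, ∏ _l : Fin n, β (z i)) *
      (∏ j, ∏ _l : Fin n, β (t j)) * ∏ i, ∏ j, (X (z i) - X (t j)) := by
    rw [Finset.prod_comm (f := fun j _l => β (t j)), ← Finset.prod_mul_distrib,
      ← Finset.prod_mul_distrib]
    simp_rw [← Finset.prod_mul_distrib]
    exact Finset.prod_congr rfl fun i _ => Finset.prod_congr rfl fun j _ =>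
      key _ _ (hβz i) (hβt j)
  have h4 : ∀ f : Fin n → ℂ, ∏ i, ∏ _l : Fin n, f i =
      (∏ i, f i) * ∏ i, ∏ _l ∈ Finset.univ.erase i, f i := by
    intro f
    rw [← Finset.prod_mul_distrib]
    exact Finset.prod_congr rfl fun i _ => (Finset.mul_prod_erase _ _ (Finset.mem_univ i)).symm
  have h5 : (∏ i, ∏ j ∈ Finset.Ioi i, (X (z j) - X (z i))) *
      ∏ i, ∏ j ∈ Finset.Ioi i, (X (t i) - X (t j)) =
      (∏ i, ∏ j ∈ Finset.Ioi i, (X (z i) - X (z j))) *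
      ∏ i, ∏ j ∈ Finset.Ioi i, (X (t j) - X (t i)) := by
    rw [← Finset.prod_mul_distrib, ← Finset.prod_mul_distrib]
    simp_rw [← Finset.prod_mul_distrib]
    exact Finset.prod_congr rfl fun i _ => Finset.prod_congr rfl fun j _ => by ring
  rw [hdet, det_prod_erase_sub (fun i => X (z i)) (fun i => X (t i)), h5, h1, h2, h3,
    h4 (fun i => β (z i)), h4 (fun i => β (t i))]
  simp only [mul_inv, Finset.prod_inv_distrib, Finset.prod_mul_distrib]
  have n1 : ∏ i, β (z i) ≠ 0 := Finset.prod_ne_zero_iff.2 fun i _ => hβz i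
  have n2 : ∏ i, β (t i) ≠ 0 := Finset.prod_ne_zero_iff.2 fun i _ => hβt i
  have n3 : ∏ i, ∏ _l ∈ Finset.univ.erase i, β (z i) ≠ 0 :=
    Finset.prod_ne_zero_iff.2 fun i _ => Finset.prod_ne_zero_iff.2 fun _ _ => hβz i
  have n4 : ∏ i, ∏ _l ∈ Finset.univ.erase i, β (t i) ≠ 0 :=
    Finset.prod_ne_zero_iff.2 fun i _ => Finset.prod_ne_zero_iff.2 fun _ _ => hβt i
  have n5 : ∏ i, ∏ j, (X (z i) - X (t j)) ≠ 0 :=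
    Finset.prod_ne_zero_iff.2 fun i _ => Finset.prod_ne_zero_iff.2 fun j _ => hX i j
  field_simp

end EllipticBC

end

open scoped BigOperators

noncomputable section

namespace EllipticBC

open Filter Topology

variable {L : PeriodPair} {g δ : ℂ} {a : Fin 8 → ℂ} {c : Fin 4 → ℂ}

/-! ### The van Diejen operator in one variable -/

/-- The operator `A⁺(z) T_δ + A⁰(z) + A⁻(z) T_{-δ}`. -/
def vanDiejen (L : PeriodPair) (g δ : ℂ) (a : Fin 8 → ℂ) (c : Fin 4 → ℂ) (f : ℂ → ℂ) (z : ℂ) : ℂ :=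
  Aplus L g δ a z * f (z + δ) + Azero L g δ a c z * f z + Aminus L g δ a z * f (z - δ)

lemma Aplus_neg (z : ℂ) : Aplus L g δ a (-z) = Aminus L g δ a z := by
  have h1 : ∀ p, br L g (-z + a p) = -br L g (z - a p) := fun p => by
    rw [← br_neg]; congr 1; ring
  have h2 : br L g (2 * -z) = -br L g (2 * z) := by rw [← br_neg]; congr 1; ring
  have h3 : br L g (2 * -z + δ) = -br L g (2 * z - δ) := by rw [← br_neg]; congr 1; ring
  rw [Aplus, Aminus, h2, h3, neg_mul_neg]
  congr 1
  simp_rw [h1, Finset.prod_neg, Finset.card_univ, Fintype.card_fin]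
  norm_num

lemma Aminus_neg (z : ℂ) : Aminus L g δ a (-z) = Aplus L g δ a z := by
  rw [← Aplus_neg, neg_neg]

lemma AzeroTerm_neg (r : Fin 4) (c z : ℂ) :
    AzeroTerm L g δ a r c (-z) = AzeroTerm L g δ a r c z := by
  simp only [AzeroTerm, brpm_neg_left, brpm_neg_right]

lemma Azero_neg (z : ℂ) : Azero L g δ a c (-z) = Azero L g δ a c z := by
  simp only [Azero, AzeroTerm_neg]

lemma vanDiejen_neg {f : ℂ → ℂ} (hf : ∀ z, f (-z) = f z) (z : ℂ) :
    vanDiejen L g δ a c f (-z) = vanDiejen L g δ a c f z := by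
  have h1 : f (-z + δ) = f (z - δ) := by rw [← hf]; congr 1; ring
  have h2 : f (-z - δ) = f (z + δ) := by rw [← hf]; congr 1; ring
  rw [vanDiejen, vanDiejen, Aplus_neg, Aminus_neg, Azero_neg, h1, h2, hf]
  ring

lemma br_add_two_mul {ω : ℂ} (hω : ω ∈ L.lattice) (u : ℂ) :
    br L g (u + 2 * ω) = e (eta L g ω * (2 * u + 2 * ω)) * br L g u := by
  have e1 : u + 2 * ω = u + ω + ω := by ring
  have e2 : eta L g ω * (2 * u + 2 * ω) =
    eta L g ω * (u + ω + ω / 2) + eta L g ω * (u + ω / 2) := by ring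
  rw [e1, br_add L g hω, br_add L g hω, e2, e_add]
  linear_combination (e (eta L g ω * (u + ω + ω / 2)) * (e (eta L g ω * (u + ω / 2)) * br L g u)) *
    eps_mul_self L ω

lemma prod_br_add {ω : ℂ} (hω : ω ∈ L.lattice) (v : Fin 8 → ℂ) :
    ∏ p, br L g (v p + ω) = e (eta L g ω * (∑ p, v p + 4 * ω)) * ∏ p, br L g (v p) := by
  simp_rw [br_add L g hω]
  rw [Finset.prod_mul_distrib, Finset.prod_mul_distrib, ← e_sum, ← Finset.mul_sum]
  have h1 : ∑ p, (v p + ω / 2) = ∑ p, v p + 4 * ω := by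
    rw [Finset.sum_add_distrib]; simp; ring
  have h2 : ∏ _p : Fin 8, eps L ω = 1 := by
    have : (eps L ω) ^ 8 = (eps L ω * eps L ω) ^ 4 := by ring
    rw [Finset.prod_const, Finset.card_univ, Fintype.card_fin, this, eps_mul_self, one_pow]
  rw [h1, h2, one_mul]

lemma Aplus_add {ω : ℂ} (hω : ω ∈ L.lattice) (z : ℂ) :
    Aplus L g δ a (z + ω) = e (eta L g ω * (∑ p, a p - 2 * δ)) * Aplus L g δ a z := by
  have h1 : ∏ p, br L g (z + ω + a p) =
      e (eta L g ω * (8 * z + ∑ p, a p + 4 * ω)) * ∏ p, br L g (z + a p) := by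
    have e1 : ∀ p, z + ω + a p = z + a p + ω := fun p => by ring
    simp_rw [e1]
    rw [prod_br_add hω, Finset.sum_add_distrib]
    simp
  have h2 : br L g (2 * (z + ω)) = e (eta L g ω * (4 * z + 2 * ω)) * br L g (2 * z) := by
    rw [mul_add, br_add_two_mul hω]; congr 3; ring
  have h3 : br L g (2 * (z + ω) + δ) =
      e (eta L g ω * (4 * z + 2 * δ + 2 * ω)) * br L g (2 * z + δ) := by
    have : 2 * (z + ω) + δ = 2 * z + δ + 2 * ω := by ring
    rw [this, br_add_two_mul hω]; congr 3; ring
  have h4 : e (eta L g ω * (8 * z + ∑ p, a p + 4 * ω)) =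
      e (eta L g ω * (∑ p, a p - 2 * δ)) *
        (e (eta L g ω * (4 * z + 2 * ω)) * e (eta L g ω * (4 * z + 2 * δ + 2 * ω))) := by
    rw [← e_add, ← e_add]; congr 1; ring
  rw [Aplus, Aplus, h1, h2, h3, h4]
  have n1 := e_ne_zero (eta L g ω * (4 * z + 2 * ω))
  have n2 := e_ne_zero (eta L g ω * (4 * z + 2 * δ + 2 * ω))
  rw [mul_mul_mul_comm (e (eta L g ω * (4 * z + 2 * ω))), mul_right_comm,
    mul_comm _ (e (eta L g ω * (4 * z + 2 * ω)) * e (eta L g ω * (4 * z + 2 * δ + 2 * ω))),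
    mul_div_mul_left _ _ (mul_ne_zero n1 n2), mul_div_assoc]

lemma Aminus_add {ω : ℂ} (hω : ω ∈ L.lattice) (z : ℂ) :
    Aminus L g δ a (z + ω) = e (-(eta L g ω * (∑ p, a p - 2 * δ))) * Aminus L g δ a z := by
  have h := Aplus_add (L := L) (g := g) (δ := δ) (a := a) hω (-(z + ω))
  have e1 : -(z + ω) + ω = -z := by ring
  rw [e1, Aplus_neg, Aplus_neg] at h
  rw [h, e_neg, inv_mul_cancel_left₀ (e_ne_zero _)]

/-- The multipliers of [z ± c] and of [(ω_r - δ)/2 ± z] coincide and cancel. -/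
lemma Azero_add {ω : ℂ} (hω : ω ∈ L.lattice) (z : ℂ) :
    Azero L g δ a c (z + ω) = Azero L g δ a c z := by
  rw [Azero, Azero]
  refine Finset.sum_congr rfl fun r _ => ?_
  rw [AzeroTerm, AzeroTerm]
  congr 1
  have h1 := quasiPer_brpm (L := L) (g := g) (c r) ω hω z
  have h2 : brpm L g ((om L r - δ) / 2) (z + ω) =
      e (eta L g ω * (1 * (2 * z + ω))) * brpm L g ((om L r - δ) / 2) z := by
    rw [brpm_swap _ (z + ω), brpm_swap _ z]
    have := quasiPer_brpm (L := L) (g := g) ((om L r - δ) / 2) ω hω z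
    simp only at this
    rw [this, mul_neg]
  simp only at h1
  rw [h1, h2]
  have n1 := e_ne_zero (eta L g ω * (1 * (2 * z + ω)))
  rw [mul_assoc (e _), mul_left_comm 2 (e _), mul_assoc (e _), mul_div_mul_left _ _ n1]

/-- Replacing z by z ± δ changes the multiplier of f by e(±2kδη), and the balancing condition makes
the multiplier of A^± exactly its inverse. -/
lemma QuasiPer.vanDiejen {k : ℂ} {f : ℂ → ℂ} (hf : QuasiPer L g k f)
    (hbal : ∑ p, a p = 2 * δ - 2 * k * δ) : QuasiPer L g k (vanDiejen L g δ a c f) := by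
  intro ω hω z
  have e1 : z + ω + δ = z + δ + ω := by ring
  have e2 : z + ω - δ = z - δ + ω := by ring
  rw [EllipticBC.vanDiejen, EllipticBC.vanDiejen, Aplus_add hω, Aminus_add hω, Azero_add hω, e1, e2,
    hf ω hω, hf ω hω, hf ω hω, hbal]
  have h1 : e (eta L g ω * (k * (2 * z + ω))) =
      e (eta L g ω * (2 * δ - 2 * k * δ - 2 * δ)) * e (eta L g ω * (k * (2 * (z + δ) + ω))) := by
    rw [← e_add]; congr 1; ring
  have h2 : e (eta L g ω * (k * (2 * z + ω))) =
      e (-(eta L g ω * (2 * δ - 2 * k * δ - 2 * δ))) * e (eta L g ω * (k * (2 * (z - δ) + ω))) := by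
    rw [← e_add]; congr 1; ring
  linear_combination -(Aplus L g δ a z * f (z + δ)) * h1 - (Aminus L g δ a z * f (z - δ)) * h2

/-! ### Half periods -/

lemma om_mem (r : Fin 4) : om L r ∈ L.lattice := by
  have h1 := L.ω₁_mem_lattice
  have h2 := L.ω₂_mem_lattice
  fin_cases r
  · simp [om]
  · simpa [om] using h1
  · simpa [om] using h2
  · simpa [om] using sub_mem (neg_mem h1) h2

lemma exists_om_add_two_mul {ω : ℂ} (hω : ω ∈ L.lattice) :
    ∃ r, ∃ l ∈ L.lattice, ω = om L r + 2 * l := by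
  obtain ⟨m, n, rfl⟩ := PeriodPair.mem_lattice.1 hω
  have hmem (m n : ℤ) : (m * L.ω₁ + n * L.ω₂ : ℂ) ∈ L.lattice :=
    PeriodPair.mem_lattice.2 ⟨m, n, rfl⟩
  rcases Int.even_or_odd' m with ⟨m', rfl | rfl⟩ <;> rcases Int.even_or_odd' n with ⟨n', rfl | rfl⟩
  · exact ⟨0, _, hmem m' n', by simp [om]; ring⟩
  · exact ⟨2, _, hmem m' n', by simp [om]; ring⟩
  · exact ⟨1, _, hmem m' n', by simp [om]; ring⟩
  · exact ⟨3, _, hmem (m' + 1) (n' + 1), by simp [om]; ring⟩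

lemma half_mem_aux {m n : ℤ} (h : (m * L.ω₁ + n * L.ω₂ : ℂ) / 2 ∈ L.lattice) :
    (2 : ℤ) ∣ m ∧ (2 : ℤ) ∣ n := by
  have h1 : ((m / 2 : ℚ) * L.ω₁ + (n / 2 : ℚ) * L.ω₂ : ℂ) ∈ L.lattice := by
    convert! h using 1; push_cast; ring
  obtain ⟨h2, h3⟩ := PeriodPair.mul_ω₁_add_mul_ω₂_mem_lattice.1 h1
  have key : ∀ m : ℤ, ((m / 2 : ℚ)).den = 1 → (2 : ℤ) ∣ m := by
    intro m hm
    have h4 := Rat.den_eq_one_iff _ |>.1 hm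
    refine ⟨(m / 2 : ℚ).num, ?_⟩
    have : (m : ℚ) = 2 * (m / 2 : ℚ) := by ring
    rw [← h4] at this
    exact_mod_cast this
  exact ⟨key m h2, key n h3⟩

lemma om_eq (r : Fin 4) :
    om L r = ((![0, 1, 0, -1] : Fin 4 → ℤ) r) * L.ω₁ + ((![0, 0, 1, -1] : Fin 4 → ℤ) r) * L.ω₂ := by
  fin_cases r <;> simp [om]; ring

/-- The four ω_r are distinct modulo 2Ω, so the pole of A⁰_r at (ω_r - δ)/2 is not shared by any
other A⁰_s. -/
lemma om_sub_om_half_notMem {r s : Fin 4} (h : r ≠ s) : (om L r - om L s) / 2 ∉ L.lattice := by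
  intro hm
  have key : ∀ r s : Fin 4, r ≠ s →
      ¬((2 : ℤ) ∣ (![0, 1, 0, -1] : Fin 4 → ℤ) r - (![0, 1, 0, -1] : Fin 4 → ℤ) s ∧
        (2 : ℤ) ∣ (![0, 0, 1, -1] : Fin 4 → ℤ) r - (![0, 0, 1, -1] : Fin 4 → ℤ) s) := by decide
  refine key r s h (half_mem_aux (L := L) ?_)
  convert! hm using 1
  rw [om_eq, om_eq]; push_cast; ring

lemma notMem_of_two_mul {u : ℂ} (h : 2 * u ∉ L.lattice) : u ∉ L.lattice := fun hu => h (by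
  rw [two_mul]; exact add_mem hu hu)

/-! ### Regularity -/

/-- No nonzero integral multiple of `δ` is a period. -/
def Transverse (L : PeriodPair) (δ : ℂ) : Prop := ∀ k : ℤ, k ≠ 0 → (k : ℂ) * δ ∉ L.lattice

lemma analyticAt_Aplus {p : ℂ} (h1 : 2 * p ∉ L.lattice) (h2 : 2 * p + δ ∉ L.lattice) :
    AnalyticAt ℂ (Aplus L g δ a) p := by
  unfold Aplus
  refine AnalyticAt.fun_div (Finset.analyticAt_fun_prod _ fun i _ => ?_) ?_
    (mul_ne_zero (br_ne_zero h1) (br_ne_zero h2))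
  · exact (analyticAt_br L g _).fun_comp (by fun_prop)
  · exact ((analyticAt_br L g _).fun_comp (by fun_prop)).fun_mul
      ((analyticAt_br L g _).fun_comp (by fun_prop))

lemma analyticAt_Aminus {p : ℂ} (h1 : 2 * p ∉ L.lattice) (h2 : 2 * p - δ ∉ L.lattice) :
    AnalyticAt ℂ (Aminus L g δ a) p := by
  have : Aminus L g δ a = fun z => Aplus L g δ a (-z) := by funext z; rw [Aplus_neg]
  rw [this]
  refine (analyticAt_Aplus ?_ ?_).fun_comp_of_eq (by fun_prop) rfl
  · rw [mul_neg, neg_mem_iff]; exact h1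
  · rw [← neg_mem_iff]; convert! h2 using 1; ring_nf

lemma analyticAt_AzeroTerm {p d : ℂ} {r : Fin 4} (h1 : (om L r - δ) / 2 + p ∉ L.lattice)
    (h2 : (om L r - δ) / 2 - p ∉ L.lattice) : AnalyticAt ℂ (AzeroTerm L g δ a r d) p := by
  -- If the factor involving d vanishes, the term is identically zero by the convention for
  -- division, so no condition on d is needed.
  by_cases hd : brpm L g ((om L r - δ) / 2) d = 0
  · have : AzeroTerm L g δ a r d = fun _ => 0 := by
      funext z; rw [AzeroTerm, hd, mul_zero, div_zero, mul_zero]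
    rw [this]; exact analyticAt_const
  · unfold AzeroTerm
    refine AnalyticAt.fun_mul analyticAt_const (AnalyticAt.fun_div ?_ ?_
      (mul_ne_zero (mul_ne_zero two_ne_zero (brpm_ne_zero h1 h2)) hd))
    · exact (analyticAt_brpm (by fun_prop) (by fun_prop)).fun_mul analyticAt_const
    · exact (analyticAt_const.fun_mul (analyticAt_brpm (by fun_prop) (by fun_prop))).fun_mul
        analyticAt_const

lemma analyticAt_Azero {p : ℂ} (h1 : 2 * p + δ ∉ L.lattice) (h2 : 2 * p - δ ∉ L.lattice) :
    AnalyticAt ℂ (Azero L g δ a c) p := by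
  unfold Azero
  refine Finset.analyticAt_fun_sum _ fun r _ => analyticAt_AzeroTerm ?_ ?_
  · refine notMem_of_two_mul fun h => h2 ?_
    convert! sub_mem h (om_mem r) using 1; ring
  · refine notMem_of_two_mul fun h => h1 ?_
    convert! sub_mem (om_mem r) h using 1; ring

lemma QuasiPer.analyticAt_add {k : ℂ} {f : ℂ → ℂ} {p ω : ℂ} (hf : QuasiPer L g k f)
    (hω : ω ∈ L.lattice) (h : AnalyticAt ℂ f p) : AnalyticAt ℂ f (p + ω) := by
  have h1 : f = fun z => e (eta L g ω * (k * (2 * (z - ω) + ω))) * f (z - ω) := by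
    funext z; rw [← hf ω hω, sub_add_cancel]
  rw [h1]
  refine AnalyticAt.fun_mul ?_ (h.fun_comp_of_eq (by fun_prop) (by ring))
  have := differentiable_e
  refine Differentiable.analyticAt ?_ _
  fun_prop

lemma analyticAt_shift {f : ℂ → ℂ} {p d : ℂ} (h : AnalyticAt ℂ f (p + d)) :
    AnalyticAt ℂ (fun z => f (z + d)) p := h.fun_comp_of_eq (g := f) (by fun_prop) rfl

lemma analyticAt_shift_sub {f : ℂ → ℂ} {p d : ℂ} (h : AnalyticAt ℂ f (p - d)) :
    AnalyticAt ℂ (fun z => f (z - d)) p := h.fun_comp_of_eq (g := f) (by fun_prop) rfl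

lemma meromorphicAt_Aplus (p : ℂ) : MeromorphicAt (Aplus L g δ a) p := by
  unfold Aplus
  refine MeromorphicAt.fun_div (AnalyticAt.meromorphicAt (Finset.analyticAt_fun_prod _ fun i _ => ?_))
    (AnalyticAt.meromorphicAt ?_)
  · exact (analyticAt_br L g _).fun_comp (by fun_prop)
  · exact ((analyticAt_br L g _).fun_comp (by fun_prop)).fun_mul
      ((analyticAt_br L g _).fun_comp (by fun_prop))

lemma meromorphicAt_Aminus (p : ℂ) : MeromorphicAt (Aminus L g δ a) p := by
  have : Aminus L g δ a = fun z => Aplus L g δ a (-z) := by funext z; rw [Aplus_neg]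
  rw [this]
  exact (meromorphicAt_Aplus (-p)).comp_analyticAt (g := fun z => -z) (by fun_prop)

lemma meromorphicAt_AzeroTerm (p d : ℂ) (r : Fin 4) : MeromorphicAt (AzeroTerm L g δ a r d) p := by
  unfold AzeroTerm
  refine analyticAt_const.meromorphicAt.fun_mul (MeromorphicAt.fun_div (AnalyticAt.meromorphicAt ?_)
    (AnalyticAt.meromorphicAt ?_))
  · exact (analyticAt_brpm (by fun_prop) (by fun_prop)).fun_mul analyticAt_const
  · exact (analyticAt_const.fun_mul (analyticAt_brpm (by fun_prop) (by fun_prop))).fun_mul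
        analyticAt_const

/-- At 2p ∈ Ω both A⁺ and A⁻ have a simple pole. The reflection z ↦ 2p - z preserves Df up to a
multiplier equal to 1 at p, while it reverses the sign of z - p; the residue is therefore its own
negative. -/
lemma regular_vanDiejen_two_mul {k : ℂ} {f : ℂ → ℂ} {p : ℂ} (hδ : Transverse L δ)
    (hf : QuasiPer L g k f) (heven : ∀ z, f (-z) = f z) (hbal : ∑ p, a p = 2 * δ - 2 * k * δ)
    (hp : 2 * p ∈ L.lattice) (h0 : AnalyticAt ℂ f p) (h1 : AnalyticAt ℂ f (p + δ))
    (h2 : AnalyticAt ℂ f (p - δ)) : Regular (vanDiejen L g δ a c f) p := by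
  have hδ1 : δ ∉ L.lattice := by simpa using hδ 1 one_ne_zero
  have hpp : 2 * p + δ ∉ L.lattice := fun h => hδ1 (by simpa using sub_mem h hp)
  have hpm : 2 * p - δ ∉ L.lattice := fun h => hδ1 (by simpa using sub_mem hp h)
  have hmer : MeromorphicAt (vanDiejen L g δ a c f) p := by
    unfold vanDiejen
    exact (((meromorphicAt_Aplus p).fun_mul (analyticAt_shift h1).meromorphicAt).fun_add
      ((analyticAt_Azero hpp hpm).meromorphicAt.fun_mul h0.meromorphicAt)).fun_add
      ((meromorphicAt_Aminus p).fun_mul (analyticAt_shift_sub h2).meromorphicAt)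
  have hres := tendsto_sub_div_br (L := L) (g := g) (a := 2) (c := 0) (p := p) two_ne_zero hp
    (by ring)
  have hnum (σ : ℂ) : AnalyticAt ℂ (fun z => ∏ q, br L g (z + σ * a q)) p :=
    Finset.analyticAt_fun_prod _ fun i _ => (analyticAt_br L g _).fun_comp (by fun_prop)
  have hbrp : AnalyticAt ℂ (fun z => (br L g (2 * z + δ))⁻¹) p :=
    ((analyticAt_br L g _).fun_comp (by fun_prop)).fun_inv (br_ne_zero hpp)
  have hbrm : AnalyticAt ℂ (fun z => (br L g (2 * z - δ))⁻¹) p :=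
    ((analyticAt_br L g _).fun_comp (by fun_prop)).fun_inv (br_ne_zero hpm)
  have hid : Tendsto (fun z : ℂ => z - p) (𝓝[≠] p) (𝓝 0) := by
    have : AnalyticAt ℂ (fun z : ℂ => z - p) p := by fun_prop
    simpa using AnalyticAt.tendsto_punctured this
  have t1 := hres.mul (AnalyticAt.tendsto_punctured
    (((hnum 1).fun_mul hbrp).fun_mul (analyticAt_shift h1)))
  have t2 := hres.mul (AnalyticAt.tendsto_punctured
    (((hnum (-1)).fun_mul hbrm).fun_mul (analyticAt_shift_sub h2)))
  have t3 := hid.mul (AnalyticAt.tendsto_punctured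
    ((analyticAt_Azero (a := a) (c := c) (g := g) hpp hpm).fun_mul h0))
  -- Only the existence of the residue is needed; its value follows from symmetry.
  obtain ⟨l, hl⟩ : ∃ l, Tendsto (fun z => (z - p) * vanDiejen L g δ a c f z) (𝓝[≠] p) (𝓝 l) := by
    refine ⟨_, ((t1.add t3).add t2).congr fun z => ?_⟩
    simp only [vanDiejen, Aplus, Aminus, one_mul, neg_mul, ← sub_eq_add_neg, add_zero]
    simp only [div_eq_mul_inv, mul_inv]
    ring
  have hrefl : Tendsto (fun z : ℂ => -z + 2 * p) (𝓝[≠] p) (𝓝[≠] p) := by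
    refine tendsto_nhdsWithin_of_tendsto_nhds_of_eventually_within _ ?_ ?_
    · have : ContinuousAt (fun z : ℂ => -z + 2 * p) p := by fun_prop
      have h := this.tendsto
      rw [show -p + 2 * p = p by ring] at h
      exact h.mono_left nhdsWithin_le_nhds
    · filter_upwards [self_mem_nhdsWithin] with z hz h
      apply hz
      have h : -z + 2 * p = p := h
      show z = p
      linear_combination -h
  have hl2 := hl.comp hrefl
  have hE : Tendsto (fun z => e (eta L g (2 * p) * (k * (2 * -z + 2 * p)))) (𝓝[≠] p) (𝓝 1) := by
    have h3 : Differentiable ℂ fun z => e (eta L g (2 * p) * (k * (2 * -z + 2 * p))) := by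
      have := differentiable_e
      fun_prop
    have h4 := AnalyticAt.tendsto_punctured (h3.analyticAt p)
    have h5 : eta L g (2 * p) * (k * (2 * -p + 2 * p)) = 0 := by ring
    rwa [h5, e_zero] at h4
  have hl3 := (hE.mul hl).neg
  have hl4 : l = -(1 * l) := by
    refine tendsto_nhds_unique hl2 (hl3.congr fun z => ?_)
    simp only [Function.comp_apply]
    rw [hf.vanDiejen hbal _ hp, vanDiejen_neg heven]
    ring
  have hl0 : l = 0 := by
    have : 2 * l = 0 := by linear_combination hl4
    simpa using this
  exact .of_tendsto_zero hmer (hl0 ▸ hl)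

/-- At p = (ω_r - δ)/2 only A⁺ and A⁰_r have poles. Since p + δ = -p + ω_r, evenness and
quasi-periodicity express f(p + δ) through f(p), and the exponential prefactor of A⁰_r is what makes
the two residues cancel. -/
lemma regular_vanDiejen_half_period {k : ℂ} {f : ℂ → ℂ} (r : Fin 4) (hδ : Transverse L δ)
    (hf : QuasiPer L g k f) (heven : ∀ z, f (-z) = f z) (hbal : ∑ p, a p = 2 * δ - 2 * k * δ)
    (hc : brpm L g ((om L r - δ) / 2) (c r) ≠ 0)
    (h0 : AnalyticAt ℂ f ((om L r - δ) / 2)) (h1 : AnalyticAt ℂ f ((om L r - δ) / 2 + δ))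
    (h2 : AnalyticAt ℂ f ((om L r - δ) / 2 - δ)) :
    Regular (vanDiejen L g δ a c f) ((om L r - δ) / 2) := by
  classical
  set p := (om L r - δ) / 2 with hp
  have hδ1 : δ ∉ L.lattice := by simpa using hδ 1 one_ne_zero
  have hδ2 : 2 * δ ∉ L.lattice := by simpa using hδ 2 two_ne_zero
  have h2p : 2 * p = om L r - δ := by rw [hp]; ring
  have hp2 : 2 * p ∉ L.lattice := fun h => hδ1 (by
    rw [h2p] at h; simpa using sub_mem (om_mem r) h)
  have hpm : 2 * p - δ ∉ L.lattice := fun h => hδ2 (by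
    rw [h2p] at h; convert! sub_mem (om_mem r) h using 1; ring)
  have hother : ∀ s ≠ r, AnalyticAt ℂ (AzeroTerm L g δ a s (c s)) p := by
    intro s hs
    refine analyticAt_AzeroTerm (notMem_of_two_mul fun h => hδ2 ?_) fun h => ?_
    · have := sub_mem (add_mem (om_mem (L := L) s) (om_mem r)) h
      convert! this using 1; rw [hp]; ring
    · refine om_sub_om_half_notMem (L := L) hs ?_
      convert! h using 1; rw [hp]; ring
  have hres := tendsto_sub_div_br (L := L) (g := g) (a := 2) (c := δ) (p := p) two_ne_zero
    (om_mem r) (by rw [h2p]; ring)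
  have hres2 := tendsto_sub_div_br (L := L) (g := g) (a := 1) (c := -p) (p := p) one_ne_zero
    (zero_mem _) (by ring)
  have hnum : AnalyticAt ℂ (fun z => ∏ q, br L g (z + a q)) p :=
    Finset.analyticAt_fun_prod _ fun i _ => (analyticAt_br L g _).fun_comp (by fun_prop)
  have hbr2 : AnalyticAt ℂ (fun z => (br L g (2 * z))⁻¹) p :=
    ((analyticAt_br L g _).fun_comp (by fun_prop)).fun_inv (br_ne_zero hp2)
  have hbr3 : AnalyticAt ℂ (fun z => (br L g (p + z))⁻¹) p := by
    refine ((analyticAt_br L g _).fun_comp (by fun_prop)).fun_inv (br_ne_zero ?_)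
    rwa [← two_mul]
  -- The factors of A⁰_r independent of z, so that A⁰_r(z) = κ [z ± c_r]/[p ± z].
  set κ := eps L (om L r) * e ((δ - om L r / 2 - (∑ p, a p) / 2) * eta L g (om L r)) *
    (∏ q, br L g (p + a q)) / (2 * brpm L g p (c r)) with hκ
  have hpair : Regular (fun z => Aplus L g δ a z * f (z + δ) +
      AzeroTerm L g δ a r (c r) z * f z) p := by
    refine .of_tendsto_zero (((meromorphicAt_Aplus p).fun_mul
      (analyticAt_shift h1).meromorphicAt).fun_add
      ((meromorphicAt_AzeroTerm p _ r).fun_mul h0.meromorphicAt)) ?_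
    have t1 := hres.mul (AnalyticAt.tendsto_punctured
      ((hnum.fun_mul hbr2).fun_mul (analyticAt_shift h1)))
    have hbrc : AnalyticAt ℂ (fun z => brpm L g z (c r)) p :=
      analyticAt_brpm (by fun_prop) (by fun_prop)
    have t2 := (hres2.mul (AnalyticAt.tendsto_punctured
      ((hbr3.fun_mul hbrc).fun_mul h0))).const_mul (-κ)
    have t3 := t1.add t2
    refine (t3.congr fun z => ?_).trans ?_
    · simp only [Aplus, AzeroTerm, ← hp]
      have e1 : brpm L g p z = -(br L g (p + z) * br L g (1 * z + -p)) := by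
        rw [brpm, ← mul_neg, ← br_neg]; congr 2; ring
      rw [e1, hκ]
      simp only [div_eq_mul_inv, mul_inv, inv_neg]
      ring
    · have e2 : f (p + δ) = e (eta L g (om L r) * (k * δ)) * f p := by
        have e3 : p + δ = -p + om L r := by rw [hp]; ring
        rw [e3, hf _ (om_mem r), heven]
        congr 3; rw [hp]; ring
      have e4 : e ((δ - om L r / 2 - (∑ p, a p) / 2) * eta L g (om L r)) =
          e (-(eta L g (om L r) * (om L r / 2))) * e (eta L g (om L r) * (k * δ)) := by
        rw [← e_add, hbal]; congr 1; ring
      have e5 : eps L 0 * e (-(eta L g 0 * (0 / 2))) / 1 = 1 := by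
        have : eps L 0 = 1 := by
          rw [eps, if_pos ⟨0, zero_mem _, by simp⟩]
        rw [this]; simp [e_zero]
      rw [e5, hκ, e4, e2, ← two_mul]
      have : ∀ x y : ℂ, x = y → 𝓝 x ≤ 𝓝 y := fun x y h => h ▸ le_rfl
      apply this
      field_simp
      ring
  have hrest : Regular (fun z => (∑ s ∈ Finset.univ.erase r, AzeroTerm L g δ a s (c s) z) * f z +
      Aminus L g δ a z * f (z - δ)) p := by
    refine (AnalyticAt.regular ?_)
    exact ((Finset.analyticAt_fun_sum _ fun s hs => hother s (Finset.ne_of_mem_erase hs)).fun_mul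
      h0).fun_add ((analyticAt_Aminus hp2 hpm).fun_mul (analyticAt_shift_sub h2))
  refine (hpair.add hrest).congr (.of_forall fun z => ?_)
  simp only [vanDiejen, Azero]
  rw [← Finset.add_sum_erase _ _ (Finset.mem_univ r)]
  ring

/-- The van Diejen operator creates no poles at the zeros of the denominators of its coefficients. -/
lemma regular_vanDiejen {k : ℂ} {f : ℂ → ℂ} {p : ℂ} (hδ : Transverse L δ)
    (hf : QuasiPer L g k f) (heven : ∀ z, f (-z) = f z) (hbal : ∑ p, a p = 2 * δ - 2 * k * δ)
    (hc : ∀ r, brpm L g ((om L r - δ) / 2) (c r) ≠ 0)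
    (h0 : AnalyticAt ℂ f p) (h1 : AnalyticAt ℂ f (p + δ)) (h2 : AnalyticAt ℂ f (p - δ)) :
    Regular (vanDiejen L g δ a c f) p := by
  -- A lattice translation moves p to one of the four points (ω_r - δ)/2. The mirror case 2p - δ ∈ Ω
  -- reduces to this one by evenness.
  have hB : ∀ p, 2 * p + δ ∈ L.lattice → AnalyticAt ℂ f p → AnalyticAt ℂ f (p + δ) →
      AnalyticAt ℂ f (p - δ) → Regular (vanDiejen L g δ a c f) p := by
    intro p hp h0 h1 h2
    obtain ⟨r, l, hl, h⟩ := exists_om_add_two_mul hp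
    have e1 : p + -l = (om L r - δ) / 2 := by linear_combination h / 2
    have hl' := neg_mem hl
    refine .of_quasiPer (hf.vanDiejen hbal) hl' ?_
    rw [e1]
    refine regular_vanDiejen_half_period r hδ hf heven hbal (hc r) ?_ ?_ ?_
    · rw [← e1]; exact hf.analyticAt_add hl' h0
    · rw [← e1, add_right_comm]; exact hf.analyticAt_add hl' h1
    · rw [← e1, add_sub_right_comm]; exact hf.analyticAt_add hl' h2
  have hneg : ∀ q, AnalyticAt ℂ f q → AnalyticAt ℂ f (-q) := by
    intro q hq
    have : f = fun z => f (-z) := by funext z; rw [heven]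
    rw [this]
    exact hq.fun_comp_of_eq (by fun_prop) (by ring)
  by_cases hA : 2 * p ∈ L.lattice
  · exact regular_vanDiejen_two_mul hδ hf heven hbal hA h0 h1 h2
  by_cases hp : 2 * p + δ ∈ L.lattice
  · exact hB p hp h0 h1 h2
  by_cases hm : 2 * p - δ ∈ L.lattice
  · refine .of_neg (vanDiejen_neg heven) (hB (-p) ?_ (hneg _ h0) ?_ ?_)
    · rw [← neg_mem_iff]; convert! hm using 1; ring
    · convert! hneg _ h2 using 1; ring
    · convert! hneg _ h1 using 1; ring
  · exact (((analyticAt_Aplus hA hp).fun_mul (analyticAt_shift h1)).fun_add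
      ((analyticAt_Azero hp hm).fun_mul h0)).fun_add
      ((analyticAt_Aminus hA hm).fun_mul (analyticAt_shift_sub h2)) |>.regular

end EllipticBC

end

open scoped BigOperators

noncomputable section

namespace EllipticBC

open Filter Topology

variable {L : PeriodPair} {g δ : ℂ} {a : Fin 8 → ℂ} {c : Fin 4 → ℂ}

/-! ### Theta functions and kernels -/

/-- `∏_l [z ± s_l]`. -/
def gauge (L : PeriodPair) (g : ℂ) {d : ℕ} (s : Fin d → ℂ) (z : ℂ) : ℂ := ∏ l, brpm L g z (s l)

/-- The Lagrange-type basis `∏_{l ≠ k} [z ± s_l]` of even theta functions. -/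
def lagr (L : PeriodPair) (g : ℂ) {d : ℕ} (s : Fin d → ℂ) (k : Fin d) (z : ℂ) : ℂ :=
  ∏ l ∈ Finset.univ.erase k, brpm L g z (s l)

/-- The Cauchy kernel `∏_l [z ± s_l] / ([z ± w] ∏_l [w ± s_l])`. -/
def kern (L : PeriodPair) (g : ℂ) {d : ℕ} (s : Fin d → ℂ) (w z : ℂ) : ℂ :=
  gauge L g s z / (brpm L g z w * gauge L g s w)

variable {d : ℕ} {s : Fin d → ℂ}

lemma gauge_neg (z : ℂ) : gauge L g s (-z) = gauge L g s z := by
  simp only [gauge, brpm_neg_left]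

lemma lagr_neg (k : Fin d) (z : ℂ) : lagr L g s k (-z) = lagr L g s k z := by
  simp only [lagr, brpm_neg_left]

lemma kern_neg (w z : ℂ) : kern L g s w (-z) = kern L g s w z := by
  simp only [kern, brpm_neg_left, gauge_neg]

lemma kern_neg_left (w z : ℂ) : kern L g s (-w) z = kern L g s w z := by
  simp only [kern, brpm_neg_right, gauge_neg]

@[fun_prop]
lemma analyticAt_gauge (p : ℂ) : AnalyticAt ℂ (gauge L g s) p :=
  Finset.analyticAt_fun_prod _ fun _ _ => analyticAt_brpm (by fun_prop) (by fun_prop)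

lemma analyticAt_lagr (k : Fin d) (p : ℂ) : AnalyticAt ℂ (lagr L g s k) p :=
  Finset.analyticAt_fun_prod _ fun _ _ => analyticAt_brpm (by fun_prop) (by fun_prop)

lemma analyticAt_kern {w p : ℂ} (h1 : p + w ∉ L.lattice) (h2 : p - w ∉ L.lattice) :
    AnalyticAt ℂ (kern L g s w) p := by
  by_cases h : gauge L g s w = 0
  · have : kern L g s w = fun _ => 0 := by funext z; rw [kern, h, mul_zero, div_zero]
    rw [this]; exact analyticAt_const
  · exact AnalyticAt.fun_div (analyticAt_gauge p)
      ((analyticAt_brpm (by fun_prop) (by fun_prop)).fun_mul analyticAt_const)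
      (mul_ne_zero (brpm_ne_zero h1 h2) h)

lemma quasiPer_gauge : QuasiPer L g d (gauge L g s) := by
  have := QuasiPer.prod (s := Finset.univ) fun l _ => quasiPer_brpm (L := L) (g := g) (s l)
  rw [Finset.card_univ, Fintype.card_fin, mul_one] at this
  exact this

lemma quasiPer_lagr (k : Fin d) : QuasiPer L g ((d : ℂ) - 1) (lagr L g s k) := by
  have := QuasiPer.prod (s := Finset.univ.erase k)
    fun l _ => quasiPer_brpm (L := L) (g := g) (s l)
  rw [Finset.card_erase_of_mem (Finset.mem_univ _), Finset.card_univ, Fintype.card_fin,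
    Nat.cast_sub k.pos, Nat.cast_one, mul_one] at this
  exact this

lemma quasiPer_kern (w : ℂ) : QuasiPer L g ((d : ℂ) - 1) (kern L g s w) := by
  have := (quasiPer_gauge (L := L) (g := g) (s := s)).div
    ((quasiPer_brpm (L := L) (g := g) w).const_mul (gauge L g s w))
  simp only [mul_comm (gauge L g s w)] at this
  exact this

lemma lagr_self_ne_zero (hs : Separated L s) (k : Fin d) : lagr L g s k (s k) ≠ 0 := by
  refine Finset.prod_ne_zero_iff.2 fun l hl => ?_
  have := (Finset.ne_of_mem_erase hl).symm
  exact brpm_ne_zero (hs.add _ _ this) (hs.sub _ _ this)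

lemma brpm_self (z : ℂ) : brpm L g z z = 0 := by rw [brpm, sub_self, br_zero, mul_zero]

lemma lagr_of_ne {k l : Fin d} (h : l ≠ k) : lagr L g s k (s l) = 0 :=
  Finset.prod_eq_zero (Finset.mem_erase.2 ⟨h, Finset.mem_univ _⟩) (brpm_self _)

/-- Lagrange interpolation of even theta functions of degree `2(d-1)`. -/
lemma lagrange_interpolation (hs : Separated L s) {E : ℂ → ℂ} (hreg : ∀ p, Regular E p)
    (heven : ∀ z, E (-z) = E z) (hper : QuasiPer L g ((d : ℂ) - 1) E)
    (han : ∀ l, AnalyticAt ℂ E (s l)) {p : ℂ} (hp : AnalyticAt ℂ E p) :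
    E p = ∑ l, E (s l) / lagr L g s l (s l) * lagr L g s l p := by
  let F : ℂ → ℂ := fun z => E z - ∑ l, E (s l) / lagr L g s l (s l) * lagr L g s l z
  have hsum : ∀ z, AnalyticAt ℂ
      (fun z => ∑ l, E (s l) / lagr L g s l (s l) * lagr L g s l z) z := fun z =>
    Finset.analyticAt_fun_sum _ fun l _ => analyticAt_const.fun_mul (analyticAt_lagr l z)
  have h := tendsto_zero_of_quasiPer hs (E := F) (fun z => (hreg z).sub (hsum z).regular)
    (fun z => by simp only [F, heven, lagr_neg])
    (by
      have h1 : QuasiPer L g ((d : ℂ) - 1)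
          (fun z => ∑ l, E (s l) / lagr L g s l (s l) * lagr L g s l z) :=
        QuasiPer.sum fun l _ => (quasiPer_lagr l).const_mul _
      have := hper.sub h1
      rw [Fintype.card_fin]
      exact this)
    (fun l => by
      have h1 := AnalyticAt.tendsto_punctured ((han l).fun_sub (hsum (s l)))
      convert! h1 using 2
      rw [Finset.sum_eq_single l, div_mul_cancel₀ _ (lagr_self_ne_zero hs l), sub_self]
      · intro k _ hk
        rw [lagr_of_ne hk.symm, mul_zero]
      · simp) p
  have h1 := tendsto_nhds_unique (AnalyticAt.tendsto_punctured (hp.fun_sub (hsum p))) h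
  exact sub_eq_zero.1 h1

/-! ### Generic position relative to shifts by multiples of δ -/

/-- `2p` avoids all translates of the lattice by multiples of `δ`. -/
def Gen (L : PeriodPair) (δ p : ℂ) : Prop := ∀ j : ℤ, 2 * p + j * δ ∉ L.lattice

/-- `p ± q` avoids all translates of the lattice by multiples of `δ`. -/
def Apart (L : PeriodPair) (δ p q : ℂ) : Prop :=
  ∀ j : ℤ, p + q + j * δ ∉ L.lattice ∧ p - q + j * δ ∉ L.lattice

lemma Gen.shift {p : ℂ} (h : Gen L δ p) (k : ℤ) : Gen L δ (p + k * δ) := by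
  intro j
  have := h (2 * k + j)
  convert! this using 1; push_cast; ring_nf

lemma Gen.shift_eq {p q : ℂ} (h : Gen L δ p) (k : ℤ) (hq : q = p + k * δ) : Gen L δ q :=
  hq ▸ h.shift k

lemma Gen.two_mul {p : ℂ} (h : Gen L δ p) : 2 * p ∉ L.lattice := by simpa using h 0

lemma Gen.add {p : ℂ} (h : Gen L δ p) : 2 * p + δ ∉ L.lattice := by simpa using h 1

lemma Gen.sub {p : ℂ} (h : Gen L δ p) : 2 * p - δ ∉ L.lattice := by
  simpa [sub_eq_add_neg] using h (-1)

lemma Gen.neg {p : ℂ} (h : Gen L δ p) : Gen L δ (-p) := by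
  intro j
  have := h (-j)
  rw [← neg_mem_iff] at this
  convert! this using 1; push_cast; ring_nf

lemma Gen.analyticAt_coeff {p : ℂ} (h : Gen L δ p) : AnalyticAt ℂ (Aplus L g δ a) p ∧
    AnalyticAt ℂ (Azero L g δ a c) p ∧ AnalyticAt ℂ (Aminus L g δ a) p :=
  ⟨analyticAt_Aplus h.two_mul h.add, analyticAt_Azero h.add h.sub,
    analyticAt_Aminus h.two_mul h.sub⟩

lemma Gen.analyticAt_vanDiejen {p : ℂ} (h : Gen L δ p) {f : ℂ → ℂ} (h0 : AnalyticAt ℂ f p)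
    (h1 : AnalyticAt ℂ f (p + δ)) (h2 : AnalyticAt ℂ f (p - δ)) :
    AnalyticAt ℂ (vanDiejen L g δ a c f) p := by
  obtain ⟨k1, k2, k3⟩ := h.analyticAt_coeff (g := g) (a := a) (c := c)
  exact ((k1.fun_mul (analyticAt_shift h1)).fun_add (k2.fun_mul h0)).fun_add
    (k3.fun_mul (analyticAt_shift_sub h2))

lemma Apart.symm {p q : ℂ} (h : Apart L δ p q) : Apart L δ q p := by
  intro j
  refine ⟨by rw [add_comm q]; exact (h j).1, ?_⟩
  rw [← neg_mem_iff]
  convert! (h (-j)).2 using 1; push_cast; ring_nf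

lemma Apart.shift {p q : ℂ} (h : Apart L δ p q) (k l : ℤ) :
    Apart L δ (p + k * δ) (q + l * δ) := by
  intro j
  refine ⟨?_, ?_⟩
  · convert! (h (k + l + j)).1 using 1; push_cast; ring_nf
  · convert! (h (k - l + j)).2 using 1; push_cast; ring_nf

lemma Apart.shift_eq {p q p' q' : ℂ} (h : Apart L δ p q) (k l : ℤ) (hp : p' = p + k * δ)
    (hq : q' = q + l * δ) : Apart L δ p' q' := hp ▸ hq ▸ h.shift k l

lemma Apart.add {p q : ℂ} (h : Apart L δ p q) : p + q ∉ L.lattice := by simpa using (h 0).1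

lemma Apart.sub {p q : ℂ} (h : Apart L δ p q) : p - q ∉ L.lattice := by simpa using (h 0).2

lemma Apart.brpm_ne_zero {p q : ℂ} (h : Apart L δ p q) : brpm L g p q ≠ 0 :=
  EllipticBC.brpm_ne_zero h.add h.sub

/-- The operator maps the even theta functions of degree `2(d-1)` to themselves. -/
lemma vanDiejen_lagr (hδ : Transverse L δ) (hs : Separated L s) (hgs : ∀ l, Gen L δ (s l))
    (hbal : ∑ p, a p = (4 - 2 * (d : ℂ)) * δ)
    (hc : ∀ r, brpm L g ((om L r - δ) / 2) (c r) ≠ 0) (k : Fin d) {z : ℂ} (hz : Gen L δ z) :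
    vanDiejen L g δ a c (lagr L g s k) z =
      ∑ l, vanDiejen L g δ a c (lagr L g s k) (s l) / lagr L g s l (s l) * lagr L g s l z := by
  have hbal' : ∑ p, a p = 2 * δ - 2 * ((d : ℂ) - 1) * δ := by rw [hbal]; ring
  refine lagrange_interpolation hs (fun p => ?_) (vanDiejen_neg (lagr_neg k))
    ((quasiPer_lagr k).vanDiejen hbal') (fun l => ?_) ?_
  · exact regular_vanDiejen hδ (quasiPer_lagr k) (lagr_neg k) hbal' hc (analyticAt_lagr k _)
      (analyticAt_lagr k _) (analyticAt_lagr k _)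
  · exact (hgs l).analyticAt_vanDiejen (analyticAt_lagr k _) (analyticAt_lagr k _)
      (analyticAt_lagr k _)
  · exact hz.analyticAt_vanDiejen (analyticAt_lagr k _) (analyticAt_lagr k _)
      (analyticAt_lagr k _)

/-! ### Dual parameters -/

/-- The dual parameters are the numbers δ - a_p with the entries 0 and 7 exchanged; symmetric
expressions do not see the exchange. -/
lemma prod_dualParams (F : ℂ → ℂ) : ∏ p, F (dualParams δ a p) = ∏ p, F (δ - a p) := by
  simp [Fin.prod_univ_eight, dualParams]
  ring

lemma sum_dualParams : ∑ p, dualParams δ a p = 8 * δ - ∑ p, a p := by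
  simp [Fin.sum_univ_eight, dualParams]
  ring

lemma Aplus_dual (z : ℂ) : Aplus L g δ (dualParams δ a) z =
    (∏ p, br L g (z + δ - a p)) / (br L g (2 * z) * br L g (2 * z + δ)) := by
  rw [Aplus, prod_dualParams (fun v => br L g (z + v))]
  simp only [add_sub_assoc]

/-- Since (ω_r - δ)/2 + (δ - a_p) = ω_r - ((ω_r - δ)/2 + a_p), each numerator changes by a
multiplier that the change of Σ a_p in the prefactor compensates. This self-duality is needed at the
pole z = w of the kernel identity. -/
lemma Azero_dual (z : ℂ) : Azero L g δ (dualParams δ a) c z = Azero L g δ a c z := by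
  rw [Azero, Azero]
  refine Finset.sum_congr rfl fun r _ => ?_
  have h1 : ∏ p, br L g ((om L r - δ) / 2 + dualParams δ a p) =
      e (eta L g (om L r) * (4 * δ - ∑ p, a p)) * ∏ p, br L g ((om L r - δ) / 2 + a p) := by
    rw [prod_dualParams (fun v => br L g ((om L r - δ) / 2 + v))]
    have e1 : ∀ p, (om L r - δ) / 2 + (δ - a p) = -((om L r - δ) / 2 + a p) + om L r := fun p => by
      ring
    simp_rw [e1]
    rw [prod_br_add (om_mem r)]
    congr 1
    · congr 2
      rw [Finset.sum_neg_distrib, Finset.sum_add_distrib]; simp; ring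
    · simp_rw [br_neg]
      rw [Finset.prod_neg, Finset.card_univ, Fintype.card_fin]; norm_num
  have h2 : e ((δ - om L r / 2 - (∑ p, a p) / 2) * eta L g (om L r)) =
      e ((δ - om L r / 2 - (∑ p, dualParams δ a p) / 2) * eta L g (om L r)) *
        e (eta L g (om L r) * (4 * δ - ∑ p, a p)) := by
    rw [← e_add, sum_dualParams]; congr 1; ring
  rw [AzeroTerm, AzeroTerm, h1, h2]
  ring

/-! ### The kernel function identity -/

/-- The difference of the two sides of the kernel function identity. -/
def kernDiff (L : PeriodPair) (g δ : ℂ) (a : Fin 8 → ℂ) (c : Fin 4 → ℂ) {d : ℕ} (s : Fin d → ℂ)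
    (w z : ℂ) : ℂ :=
  vanDiejen L g δ a c (kern L g s w) z -
    vanDiejen L g δ (dualParams δ a) c (fun w => kern L g s w z) w

lemma kernDiff_neg (w z : ℂ) : kernDiff L g δ a c s w (-z) = kernDiff L g δ a c s w z := by
  rw [kernDiff, kernDiff, vanDiejen_neg (kern_neg w)]
  simp only [kern_neg]

lemma kernDiff_neg_left (w z : ℂ) : kernDiff L g δ a c s (-w) z = kernDiff L g δ a c s w z := by
  rw [kernDiff, kernDiff, vanDiejen_neg (f := fun w => kern L g s w z)
    fun w => kern_neg_left w z]
  congr 2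
  funext z
  exact kern_neg_left w z

/-- The operator acting on w has coefficients constant in z, so its value is a linear combination of
kernels, all with the same quasi-periods in z. -/
lemma quasiPer_kernDiff (hbal : ∑ p, a p = (4 - 2 * (d : ℂ)) * δ) (w : ℂ) :
    QuasiPer L g ((d : ℂ) - 1) (kernDiff L g δ a c s w) := by
  have hbal' : ∑ p, a p = 2 * δ - 2 * ((d : ℂ) - 1) * δ := by rw [hbal]; ring
  exact ((quasiPer_kern w).vanDiejen hbal').sub
    ((((quasiPer_kern _).const_mul _).add ((quasiPer_kern _).const_mul _)).add
      ((quasiPer_kern _).const_mul _))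

lemma tendsto_sub_div_br_sub (p : ℂ) :
    Tendsto (fun z => (z - p) / br L g (z - p)) (𝓝[≠] p) (𝓝 1) := by
  have h := tendsto_sub_div_br (L := L) (g := g) (a := 1) (c := -p) (p := p) one_ne_zero
    (zero_mem _) (by ring)
  have e5 : eps L 0 * e (-(eta L g 0 * (0 / 2))) / 1 = 1 := by
    have : eps L 0 = 1 := by
      rw [eps, if_pos ⟨0, zero_mem _, by simp⟩]
    rw [this]; simp [e_zero]
  rw [e5] at h
  simpa only [one_mul, ← sub_eq_add_neg] using h

/-- A quotient with a simple zero in the denominator and a zero of the numerator. -/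
lemma regular_div_br_sub {N : ℂ → ℂ} {p : ℂ} (hN : AnalyticAt ℂ N p) (h0 : N p = 0) :
    Regular (fun z => N z / br L g (z - p)) p := by
  refine .of_tendsto_zero (hN.meromorphicAt.fun_div
    ((analyticAt_br L g _).fun_comp (by fun_prop)).meromorphicAt) ?_
  have h1 := (tendsto_sub_div_br_sub (L := L) (g := g) p).mul (AnalyticAt.tendsto_punctured hN)
  rw [h0, mul_zero] at h1
  refine h1.congr fun z => ?_
  ring

/-- Only the two A⁰ terms are singular at z = w. By `Azero_dual` they combine to (A⁰(z) - A⁰(w))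
Φ(w, z), whose numerator vanishes there. -/
lemma regular_kernDiff_self (hδ : Transverse L δ) {w : ℂ} (hw : Gen L δ w) :
    Regular (kernDiff L g δ a c s w) w := by
  have hδ1 : δ ∉ L.lattice := by simpa using hδ 1 one_ne_zero
  obtain ⟨k1, k2, k3⟩ := hw.analyticAt_coeff (g := g) (a := a) (c := c)
  have hp : AnalyticAt ℂ (kern L g s w) (w + δ) := analyticAt_kern
    (by convert! hw.add using 1; ring_nf) (by simpa using hδ1)
  have hm : AnalyticAt ℂ (kern L g s w) (w - δ) := analyticAt_kern
    (by convert! hw.sub using 1; ring_nf) (by simpa using hδ1)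
  have hp' : AnalyticAt ℂ (kern L g s (w + δ)) w := analyticAt_kern
    (by convert! hw.add using 1; ring_nf) (by simpa using hδ1)
  have hm' : AnalyticAt ℂ (kern L g s (w - δ)) w := analyticAt_kern
    (by convert! hw.sub using 1; ring_nf) (by simpa using hδ1)
  have r1 : AnalyticAt ℂ (fun z => Aplus L g δ a z * kern L g s w (z + δ) +
      Aminus L g δ a z * kern L g s w (z - δ) -
      (Aplus L g δ (dualParams δ a) w * kern L g s (w + δ) z +
        Aminus L g δ (dualParams δ a) w * kern L g s (w - δ) z)) w :=
    ((k1.fun_mul (analyticAt_shift hp)).fun_add (k3.fun_mul (analyticAt_shift_sub hm))).fun_sub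
      ((analyticAt_const.fun_mul hp').fun_add (analyticAt_const.fun_mul hm'))
  have hbr : AnalyticAt ℂ (fun z => (br L g (z + w))⁻¹) w := by
    refine ((analyticAt_br L g _).fun_comp (by fun_prop)).fun_inv (br_ne_zero ?_)
    rw [← two_mul]; exact hw.two_mul
  have r2 : Regular (fun z => ((Azero L g δ a c z - Azero L g δ a c w) * gauge L g s z *
      (br L g (z + w))⁻¹ * (gauge L g s w)⁻¹) / br L g (z - w)) w := by
    refine regular_div_br_sub ?_ (by simp)
    exact (((k2.fun_sub analyticAt_const).fun_mul (analyticAt_gauge w)).fun_mul hbr).fun_mul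
      analyticAt_const
  refine (r1.regular.add r2).congr (.of_forall fun z => ?_)
  simp only [kernDiff, vanDiejen, Azero_dual]
  have : kern L g s w z = gauge L g s z * (br L g (z + w))⁻¹ * (gauge L g s w)⁻¹ *
      (br L g (z - w))⁻¹ := by
    rw [kern, brpm, div_eq_mul_inv, mul_inv, mul_inv]; ring
  rw [this]
  ring

/-- The singular terms at z = w + δ are A⁻(z; a) Φ(w, z - δ) and A⁺(w; b) Φ(w + δ, z). Their
residues agree because b consists of the numbers δ - a_p, which is where the form of the dual
parameters comes from. -/
lemma regular_kernDiff_add (hδ : Transverse L δ) {w : ℂ} (hw : Gen L δ w)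
    (hws : ∀ l, Apart L δ w (s l)) : Regular (kernDiff L g δ a c s w) (w + δ) := by
  have hδ1 : δ ∉ L.lattice := by simpa using hδ 1 one_ne_zero
  have hδ2 : 2 * δ ∉ L.lattice := by simpa using hδ 2 two_ne_zero
  have hwδ : Gen L δ (w + δ) := by simpa using hw.shift 1
  obtain ⟨k1, k2, k3⟩ := hwδ.analyticAt_coeff (g := g) (a := a) (c := c)
  have hp : AnalyticAt ℂ (kern L g s w) (w + δ + δ) := analyticAt_kern
    (by convert! hw 2 using 1; push_cast; ring_nf) (by convert! hδ2 using 1; ring_nf)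
  have h0 : AnalyticAt ℂ (kern L g s w) (w + δ) := analyticAt_kern
    (by convert! hw.add using 1; ring_nf) (by simpa using hδ1)
  have hm' : AnalyticAt ℂ (kern L g s (w - δ)) (w + δ) := analyticAt_kern
    (by convert! hw.two_mul using 1; ring_nf) (by convert! hδ2 using 1; ring_nf)
  have r1 : AnalyticAt ℂ (fun z => Aplus L g δ a z * kern L g s w (z + δ) +
      Azero L g δ a c z * kern L g s w z -
      (Azero L g δ (dualParams δ a) c w * kern L g s w z +
        Aminus L g δ (dualParams δ a) w * kern L g s (w - δ) z)) (w + δ) :=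
    ((k1.fun_mul (analyticAt_shift hp)).fun_add (k2.fun_mul h0)).fun_sub
      ((analyticAt_const.fun_mul h0).fun_add (analyticAt_const.fun_mul hm'))
  have hb1 : AnalyticAt ℂ (fun z => (br L g (z - δ + w))⁻¹) (w + δ) := by
    refine ((analyticAt_br L g _).fun_comp (by fun_prop)).fun_inv (br_ne_zero ?_)
    convert! hw.two_mul using 1; ring_nf
  have hb2 : AnalyticAt ℂ (fun z => (br L g (z + (w + δ)))⁻¹) (w + δ) := by
    refine ((analyticAt_br L g _).fun_comp (by fun_prop)).fun_inv (br_ne_zero ?_)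
    convert! hwδ.two_mul using 1; ring_nf
  have hg1 : gauge L g s w ≠ 0 := Finset.prod_ne_zero_iff.2 fun l _ => (hws l).brpm_ne_zero
  have hg2 : gauge L g s (w + δ) ≠ 0 := Finset.prod_ne_zero_iff.2 fun l _ =>
    ((hws l).shift_eq 1 0 (by simp) (by simp)).brpm_ne_zero
  have hga : AnalyticAt ℂ (fun z => gauge L g s (z - δ)) (w + δ) :=
    analyticAt_shift_sub (analyticAt_gauge _)
  have r2 : Regular (fun z => (Aminus L g δ a z * gauge L g s (z - δ) *
      (br L g (z - δ + w))⁻¹ * (gauge L g s w)⁻¹ -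
      Aplus L g δ (dualParams δ a) w * gauge L g s z * (br L g (z + (w + δ)))⁻¹ *
        (gauge L g s (w + δ))⁻¹) / br L g (z - (w + δ))) (w + δ) := by
    refine regular_div_br_sub ?_ ?_
    · exact (((k3.fun_mul hga).fun_mul hb1).fun_mul analyticAt_const).fun_sub
        (((analyticAt_const.fun_mul (analyticAt_gauge _)).fun_mul hb2).fun_mul analyticAt_const)
    · rw [Aplus_dual, Aminus]
      have e1 : w + δ - δ = w := by ring
      have e2 : w + w = 2 * w := by ring
      have e3 : 2 * (w + δ) - δ = 2 * w + δ := by ring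
      have e4 : w + δ + (w + δ) = 2 * (w + δ) := by ring
      rw [e1, e2, e3, e4]
      field_simp
      ring
  refine (r1.regular.add r2).congr (.of_forall fun z => ?_)
  simp only [kernDiff, vanDiejen]
  have h1 : kern L g s w (z - δ) = gauge L g s (z - δ) * (br L g (z - δ + w))⁻¹ *
      (gauge L g s w)⁻¹ * (br L g (z - (w + δ)))⁻¹ := by
    have : z - δ - w = z - (w + δ) := by ring
    rw [kern, brpm, this, div_eq_mul_inv, mul_inv, mul_inv]; ring
  have h2 : kern L g s (w + δ) z = gauge L g s z * (br L g (z + (w + δ)))⁻¹ *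
      (gauge L g s (w + δ))⁻¹ * (br L g (z - (w + δ)))⁻¹ := by
    rw [kern, brpm, div_eq_mul_inv, mul_inv, mul_inv]; ring
  rw [h1, h2]
  ring

lemma regular_kernDiff (hδ : Transverse L δ) {w : ℂ} (hw : Gen L δ w)
    (hws : ∀ l, Apart L δ w (s l)) (hbal : ∑ p, a p = (4 - 2 * (d : ℂ)) * δ)
    (hc : ∀ r, brpm L g ((om L r - δ) / 2) (c r) ≠ 0) (p : ℂ) :
    Regular (kernDiff L g δ a c s w) p := by
  have hbal' : ∑ p, a p = 2 * δ - 2 * ((d : ℂ) - 1) * δ := by rw [hbal]; ring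
  have heven := kernDiff_neg (L := L) (g := g) (δ := δ) (a := a) (c := c) (s := s) w
  have hper := quasiPer_kernDiff (L := L) (g := g) (c := c) (s := s) hbal w
  -- The difference is even in w and in z, so w - δ is the point w + δ for -w, reflected.
  have hsub : Regular (kernDiff L g δ a c s w) (w - δ) := by
    refine .of_neg heven ?_
    have h1 := regular_kernDiff_add (g := g) (a := a) (c := c) (s := s) hδ hw.neg (fun l j => by
      have := hws l (-j)
      rw [← neg_mem_iff, ← neg_mem_iff (x := _ - _ + _)] at this
      refine ⟨?_, ?_⟩
      · convert! this.2 using 1; push_cast; ring_nf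
      · convert! this.1 using 1; push_cast; ring_nf)
    rw [show -(w - δ) = -w + δ by ring]
    exact h1.congr (.of_forall fun z => kernDiff_neg_left w z)
  have hbase : ∀ q, Regular (kernDiff L g δ a c s w) q → ∀ p, p - q ∈ L.lattice →
      Regular (kernDiff L g δ a c s w) p := fun q hq p h =>
    .of_quasiPer hper (neg_mem h) (by simpa using hq)
  have hboth : ∀ q, Regular (kernDiff L g δ a c s w) q → ∀ p, p - q ∈ L.lattice ∨ p + q ∈ L.lattice →
      Regular (kernDiff L g δ a c s w) p := by
    rintro q hq p (h | h)
    · exact hbase q hq p h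
    · refine .of_neg heven (hbase q hq (-p) ?_)
      rw [← neg_mem_iff]; convert! h using 1; ring
  by_cases h1 : p - w ∈ L.lattice ∨ p + w ∈ L.lattice
  · exact hboth w (regular_kernDiff_self hδ hw) p h1
  by_cases h2 : p - (w + δ) ∈ L.lattice ∨ p + (w + δ) ∈ L.lattice
  · exact hboth _ (regular_kernDiff_add hδ hw hws) p h2
  by_cases h3 : p - (w - δ) ∈ L.lattice ∨ p + (w - δ) ∈ L.lattice
  · exact hboth _ hsub p h3
  push Not at h1 h2 h3
  have e0 : AnalyticAt ℂ (kern L g s w) p := analyticAt_kern h1.2 h1.1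
  have e1 : AnalyticAt ℂ (kern L g s w) (p + δ) := analyticAt_kern
    (by convert! h2.2 using 1; ring_nf) (by convert! h3.1 using 1; ring_nf)
  have e2 : AnalyticAt ℂ (kern L g s w) (p - δ) := analyticAt_kern
    (by convert! h3.2 using 1; ring_nf) (by convert! h2.1 using 1; ring_nf)
  have e3 : AnalyticAt ℂ (kern L g s (w + δ)) p := analyticAt_kern h2.2 h2.1
  have e4 : AnalyticAt ℂ (kern L g s (w - δ)) p := analyticAt_kern h3.2 h3.1
  refine (regular_vanDiejen hδ (quasiPer_kern w) (kern_neg w) hbal' hc e0 e1 e2).sub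
    (AnalyticAt.regular ?_)
  exact ((analyticAt_const.fun_mul e3).fun_add (analyticAt_const.fun_mul e0)).fun_add
    (analyticAt_const.fun_mul e4)

lemma analyticAt_kernDiff {w p : ℂ} (hp : Gen L δ p) (hpw : Apart L δ p w) :
    AnalyticAt ℂ (kernDiff L g δ a c s w) p := by
  have hk : ∀ k l : ℤ, AnalyticAt ℂ (kern L g s (w + l * δ)) (p + k * δ) := fun k l =>
    analyticAt_kern (hpw.shift k l).add (hpw.shift k l).sub
  have e0 := hk 0 0
  have e1 := hk 1 0
  have e2 := hk (-1) 0
  have e3 := hk 0 1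
  have e4 := hk 0 (-1)
  simp only [Int.cast_zero, zero_mul, add_zero, Int.cast_one, one_mul, Int.cast_neg, neg_mul,
    ← sub_eq_add_neg] at e0 e1 e2 e3 e4
  exact (hp.analyticAt_vanDiejen e0 e1 e2).fun_sub
    (((analyticAt_const.fun_mul e3).fun_add (analyticAt_const.fun_mul e0)).fun_add
    (analyticAt_const.fun_mul e4))

/-- The kernel function identity, modulo even theta functions of degree `2(d-1)`. -/
lemma vanDiejen_kern (hδ : Transverse L δ) (hs : Separated L s) (hgs : ∀ l, Gen L δ (s l))
    (hbal : ∑ p, a p = (4 - 2 * (d : ℂ)) * δ)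
    (hc : ∀ r, brpm L g ((om L r - δ) / 2) (c r) ≠ 0) {w z : ℂ} (hw : Gen L δ w)
    (hws : ∀ l, Apart L δ w (s l)) (hz : Gen L δ z) (hzw : Apart L δ z w) :
    vanDiejen L g δ a c (kern L g s w) z =
      vanDiejen L g δ (dualParams δ a) c (fun w => kern L g s w z) w +
      ∑ l, kernDiff L g δ a c s w (s l) / lagr L g s l (s l) * lagr L g s l z := by
  rw [← lagrange_interpolation hs (regular_kernDiff hδ hw hws hbal hc) (kernDiff_neg w)
    (quasiPer_kernDiff hbal w) (fun l => analyticAt_kernDiff (hgs l) (hws l).symm)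
    (analyticAt_kernDiff hz hzw)]
  rw [kernDiff]; ring

end EllipticBC

end

open scoped BigOperators

noncomputable section

namespace EllipticBC

/-! ### Expansion of chains in the exterior algebra -/

section Chain

variable {V : Type*} [AddCommGroup V] [Module ℂ V]

open ExteriorAlgebra

lemma list_prod_mul_ι (l : List V) (v : V) :
    (l.map (ι ℂ)).prod * ι ℂ v = (-1 : ℂ) ^ l.length • (ι ℂ v * (l.map (ι ℂ)).prod) := by
  induction l with
  | nil => simp
  | cons a l ih =>
    have h : ι ℂ a * ι ℂ v = -(ι ℂ v * ι ℂ a) := eq_neg_of_add_eq_zero_left (ι_add_mul_swap a v)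
    rw [List.map_cons, List.prod_cons, mul_assoc, ih, List.length_cons, mul_smul_comm, ← mul_assoc,
      h, pow_succ, mul_smul, neg_mul, mul_assoc, neg_smul, one_smul]

/-- Repeated vectors kill a wedge product; this is what makes the expansion along a chain collapse.
-/
lemma list_prod_mul_ι_of_mem {l : List V} {v : V} (h : v ∈ l) :
    (l.map (ι ℂ)).prod * ι ℂ v = 0 := by
  induction l with
  | nil => simp at h
  | cons a l ih =>
    rw [List.map_cons, List.prod_cons, mul_assoc]
    rcases List.mem_cons.1 h with rfl | h
    · rw [list_prod_mul_ι, mul_smul_comm, ← mul_assoc, ι_sq_zero, zero_mul, smul_zero]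
    · rw [ih h, mul_zero]

/-- The increasing enumeration of the natural numbers other than `ν` and `μ + 1` (`ν ≤ μ`). -/
def skip (ν μ k : ℕ) : ℕ := if k < ν then k else if k < μ then k + 1 else k + 2

/-- The wedge product of the first `n` vectors in the sequence omitting `ν` and `μ + 1`. -/
def chainWedge (v : ℕ → V) (n ν μ : ℕ) : ExteriorAlgebra ℂ V :=
  (((List.range n).map fun k => v (skip ν μ k)).map (ι ℂ)).prod

lemma chainWedge_succ (v : ℕ → V) (n ν μ : ℕ) :
    chainWedge v (n + 1) ν μ = chainWedge v n ν μ * ι ℂ (v (skip ν μ n)) := by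
  simp [chainWedge, List.range_succ]

lemma chainWedge_congr {v : ℕ → V} {n ν μ ν' μ' : ℕ}
    (h : ∀ k < n, skip ν μ k = skip ν' μ' k) : chainWedge v n ν μ = chainWedge v n ν' μ' := by
  rw [chainWedge, chainWedge]
  congr 2
  refine List.map_congr_left fun k hk => ?_
  rw [h k (List.mem_range.1 hk)]

lemma chainWedge_mul_of_mem {v : ℕ → V} {n ν μ j : ℕ} (h : ∃ k < n, skip ν μ k = j) :
    chainWedge v n ν μ * ι ℂ (v j) = 0 := by
  obtain ⟨k, hk, rfl⟩ := h
  exact list_prod_mul_ι_of_mem (List.mem_map.2 ⟨k, List.mem_range.2 hk, rfl⟩)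

lemma chainWedge_mul_add_two {v : ℕ → V} {n ν μ : ℕ} (h1 : ν ≤ μ) (h2 : μ ≤ n) :
    chainWedge v n ν μ * ι ℂ (v (n + 2)) = chainWedge v (n + 1) ν μ := by
  have : skip ν μ n = n + 2 := by unfold skip; split_ifs <;> omega
  rw [chainWedge_succ, this]

/-- The vector v (n + 1) is already present unless it is the second omitted one; then n + 2 takes
over as the omitted index. -/
lemma chainWedge_mul_add_one {v : ℕ → V} {n ν μ : ℕ} (h1 : ν ≤ μ) (h2 : μ ≤ n) :
    chainWedge v n ν μ * ι ℂ (v (n + 1)) = if μ = n then chainWedge v (n + 1) ν (n + 1) else 0 := by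
  split_ifs with h
  · subst h
    rw [chainWedge_succ]
    congr 1
    · refine chainWedge_congr fun k hk => ?_
      unfold skip; split_ifs <;> omega
    · congr 2
      unfold skip; split_ifs <;> omega
  · refine chainWedge_mul_of_mem ⟨n - 1, by omega, ?_⟩
    unfold skip; split_ifs <;> omega

/-- The vector v n survives only if n is ν or μ + 1. In the second case it must pass v (n + 1),
hence the sign that becomes the minus sign of the continuant recurrence. -/
lemma chainWedge_mul_self {v : ℕ → V} {n ν μ : ℕ} (h1 : ν ≤ μ) (h2 : μ ≤ n) :
    chainWedge v n ν μ * ι ℂ (v n) =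
      if ν = n then chainWedge v (n + 1) (n + 1) (n + 1)
      else if μ + 1 = n then -chainWedge v (n + 1) ν (n + 1) else 0 := by
  split_ifs with h h'
  · obtain rfl : μ = n := by omega
    subst h
    rw [chainWedge_succ]
    congr 1
    · refine chainWedge_congr fun k hk => ?_
      unfold skip; split_ifs <;> omega
    · congr 2
      unfold skip; split_ifs <;> omega
  · subst h'
    rw [chainWedge_succ, chainWedge_succ, chainWedge_succ, mul_assoc, mul_assoc]
    have e1 : skip ν μ μ = μ + 2 := by unfold skip; split_ifs <;> omega
    have e2 : skip ν (μ + 1 + 1) μ = μ + 1 := by unfold skip; split_ifs <;> omega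
    have e3 : skip ν (μ + 1 + 1) (μ + 1) = μ + 2 := by unfold skip; split_ifs <;> omega
    have e4 : chainWedge v μ ν (μ + 1 + 1) = chainWedge v μ ν μ :=
      chainWedge_congr fun k hk => by unfold skip; split_ifs <;> omega
    rw [e1, e2, e3, e4, ← mul_neg]
    congr 1
    exact eq_neg_of_add_eq_zero_left (ι_add_mul_swap _ _)
  · refine chainWedge_mul_of_mem ?_
    by_cases h3 : μ = n
    · refine ⟨n - 1, by omega, ?_⟩
      unfold skip; split_ifs <;> omega
    · refine ⟨n - 2, by omega, ?_⟩
      unfold skip; split_ifs <;> omega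

/-- The continuant of a tridiagonal matrix. -/
def continuant (P Q R : ℕ → ℂ) (ν : ℕ) : ℕ → ℂ
  | 0 => 1
  | 1 => Q ν
  | σ + 2 => Q (ν + σ + 1) * continuant P Q R ν (σ + 1) -
      R (ν + σ) * P (ν + σ + 1) * continuant P Q R ν σ

/-- Expansion of a wedge product of three-term combinations of consecutive vectors. -/
lemma prod_three_term (P Q R : ℕ → ℂ) (v : ℕ → V) (n : ℕ) :
    ((List.range n).map fun k => ι ℂ (P k • v k + Q k • v (k + 1) + R k • v (k + 2))).prod =
      ∑ μ ∈ Finset.range (n + 1), ∑ ν ∈ Finset.range (μ + 1),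
        ((∏ k ∈ Finset.range ν, P k) * (∏ k ∈ Finset.Ico μ n, R k) *
          continuant P Q R ν (μ - ν)) • chainWedge v n ν μ := by
  induction n with
  | zero => simp [chainWedge, continuant]
  | succ n ih =>
    rw [List.range_succ, List.map_append, List.prod_append, ih, List.map_singleton,
      List.prod_singleton, map_add, map_add, map_smul, map_smul, map_smul, mul_add, mul_add]
    set c : ℕ → ℕ → ℂ := fun ν μ => (∏ k ∈ Finset.range ν, P k) * (∏ k ∈ Finset.Ico μ n, R k) *
          continuant P Q R ν (μ - ν) with hc
    have hR : (∑ μ ∈ Finset.range (n + 1), ∑ ν ∈ Finset.range (μ + 1),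
        c ν μ • chainWedge v n ν μ) * R n • ι ℂ (v (n + 2)) =
        ∑ μ ∈ Finset.range (n + 1), ∑ ν ∈ Finset.range (μ + 1),
        ((∏ k ∈ Finset.range ν, P k) * (∏ k ∈ Finset.Ico μ (n + 1), R k) *
          continuant P Q R ν (μ - ν)) • chainWedge v (n + 1) ν μ := by
      simp_rw [Finset.sum_mul]
      refine Finset.sum_congr rfl fun μ hμ => Finset.sum_congr rfl fun ν hν => ?_
      rw [Finset.mem_range] at hμ hν
      rw [smul_mul_smul_comm, chainWedge_mul_add_two (by omega) (by omega),
        Finset.prod_Ico_succ_top (by omega), hc]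
      congr 1; ring
    have hQ : (∑ μ ∈ Finset.range (n + 1), ∑ ν ∈ Finset.range (μ + 1),
        c ν μ • chainWedge v n ν μ) * Q n • ι ℂ (v (n + 1)) =
        ∑ ν ∈ Finset.range (n + 1), (Q n * c ν n) • chainWedge v (n + 1) ν (n + 1) := by
      simp_rw [Finset.sum_mul]
      rw [Finset.sum_range_succ, Finset.sum_eq_zero, zero_add]
      · refine Finset.sum_congr rfl fun ν hν => ?_
        rw [Finset.mem_range] at hν
        rw [smul_mul_smul_comm, chainWedge_mul_add_one (by omega) (by omega), if_pos rfl, mul_comm]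
      · intro μ hμ
        refine Finset.sum_eq_zero fun ν hν => ?_
        rw [Finset.mem_range] at hμ hν
        rw [smul_mul_smul_comm, chainWedge_mul_add_one (by omega) (by omega), if_neg (by omega),
          smul_zero]
    have hP : (∑ μ ∈ Finset.range (n + 1), ∑ ν ∈ Finset.range (μ + 1),
        c ν μ • chainWedge v n ν μ) * P n • ι ℂ (v n) =
        (P n * c n n) • chainWedge v (n + 1) (n + 1) (n + 1) -
        ∑ ν ∈ Finset.range n, (P n * c ν (n - 1)) • chainWedge v (n + 1) ν (n + 1) := by
      simp_rw [Finset.sum_mul]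
      rw [Finset.sum_range_succ, Finset.sum_range_succ _ n, add_comm, sub_eq_add_neg]
      rw [add_comm (∑ ν ∈ Finset.range n, _), add_assoc]
      congr 1
      · rw [smul_mul_smul_comm, chainWedge_mul_self le_rfl le_rfl, if_pos rfl, mul_comm]
      · rw [Finset.sum_eq_zero, zero_add]
        · rcases n with _ | n
          · simp
          · rw [Finset.sum_range_succ, Finset.sum_eq_zero, zero_add, ← Finset.sum_neg_distrib]
            · refine Finset.sum_congr rfl fun ν hν => ?_
              rw [Finset.mem_range] at hν
              rw [smul_mul_smul_comm, chainWedge_mul_self (by omega) (by omega),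
                if_neg (by omega), if_pos rfl, smul_neg, mul_comm, Nat.add_sub_cancel]
            · intro μ hμ
              refine Finset.sum_eq_zero fun ν hν => ?_
              rw [Finset.mem_range] at hμ hν
              rw [smul_mul_smul_comm, chainWedge_mul_self (by omega) (by omega),
                if_neg (by omega), if_neg (by omega), smul_zero]
        · intro ν hν
          rw [Finset.mem_range] at hν
          rw [smul_mul_smul_comm, chainWedge_mul_self (by omega) (by omega),
                if_neg (by omega), if_neg (by omega), smul_zero]
    rw [hR, hQ, hP, Finset.sum_range_succ _ (n + 1), Finset.sum_range_succ _ (n + 1), add_comm]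
    congr 1
    rw [sub_add_eq_add_sub, add_sub_assoc, add_comm]
    congr 1
    · rw [Finset.sum_range_succ, Finset.sum_range_succ, add_sub_right_comm,
        ← Finset.sum_sub_distrib]
      congr 1
      · refine Finset.sum_congr rfl fun ν hν => ?_
        rw [Finset.mem_range] at hν
        -- The contributions of v (n + 1) and v n with the same ν add up to the three-term
        -- recurrence of the continuant. The factor R (n - 1) in it is the one factor left in the
        -- product over [n - 1, n).
        obtain ⟨σ, rfl⟩ : ∃ σ, n = ν + σ + 1 := ⟨n - ν - 1, by omega⟩
        rw [← sub_smul, hc]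
        have e1 : ν + σ + 1 - ν = σ + 1 := by omega
        have e2 : ν + σ - ν = σ := by omega
        have e3 : ν + σ + 1 + 1 - ν = σ + 2 := by omega
        simp only [e1, e2, e3, Nat.add_sub_cancel, continuant, Finset.Ico_self, Finset.prod_empty,
          Nat.Ico_succ_singleton, Finset.prod_singleton]
        congr 1; ring
      · simp [hc, continuant, mul_comm]
    · simp [hc, continuant, Finset.prod_range_succ, mul_comm]

end Chain

end EllipticBC

end

open scoped BigOperators

noncomputable section

namespace EllipticBC

/-! ### The coefficients `Cfun` are continuants -/

lemma mem_xiSeqs {σ r : ℕ} {ξ : Fin r → ℕ} : ξ ∈ xiSeqs σ r ↔ (∀ p, 0 < ξ p ∧ ξ p < σ) ∧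
    ∀ p q : Fin r, p < q → ξ p + 2 ≤ ξ q := by
  classical
  rw [xiSeqs, Finset.mem_filter, Fintype.mem_piFinset]
  simp only [Finset.mem_Ioo]
  refine and_congr_right fun _ => ⟨fun h p q hpq => ?_, fun h => ⟨fun p q hpq => ?_, fun p q hpq =>
    h p q (by rw [Fin.lt_def]; omega)⟩⟩
  · have hq : (p : ℕ) + 1 < r := by have := q.2; rw [Fin.lt_def] at hpq; omega
    have h1 := h.2 p ⟨p + 1, hq⟩ rfl
    have h2 := h.1.monotone (a := ⟨p + 1, hq⟩) (b := q) (by rw [Fin.le_def]; exact hpq)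
    omega
  · have := h p q hpq; omega

/-- Admissible sequences for `σ + 2` that do not end at `σ + 1`. -/
lemma xiSeqs_filter_ne (σ r : ℕ) :
    ((xiSeqs (σ + 2) r).filter fun ξ => ¬∃ p, ξ p = σ + 1) = xiSeqs (σ + 1) r := by
  ext ξ
  rw [Finset.mem_filter, mem_xiSeqs, mem_xiSeqs]
  push Not
  constructor
  · rintro ⟨⟨h1, h2⟩, h3⟩
    refine ⟨fun p => ⟨(h1 p).1, ?_⟩, h2⟩
    have := h1 p; have := h3 p; omega
  · rintro ⟨h1, h2⟩
    refine ⟨⟨fun p => ⟨(h1 p).1, ?_⟩, h2⟩, fun p => ?_⟩ <;> have := h1 p <;> omega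

/-- Summation over the admissible sequences for `σ + 2` that end at `σ + 1`. -/
lemma sum_xiSeqs_filter_eq (σ r : ℕ) (F : (Fin (r + 1) → ℕ) → ℂ) :
    ∑ ξ ∈ (xiSeqs (σ + 2) (r + 1)).filter (fun ξ => ∃ p, ξ p = σ + 1), F ξ =
      ∑ ξ ∈ xiSeqs σ r, F (Fin.snoc (α := fun _ => ℕ) ξ (σ + 1)) := by
  symm
  refine Finset.sum_nbij' (fun ξ => Fin.snoc (α := fun _ => ℕ) ξ (σ + 1)) (fun ξ => Fin.init ξ)
    ?_ ?_ ?_ ?_ ?_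
  · intro ξ hξ
    rw [mem_xiSeqs] at hξ
    rw [Finset.mem_filter, mem_xiSeqs]
    refine ⟨⟨fun p => ?_, fun p q hpq => ?_⟩, Fin.last r, Fin.snoc_last _ _⟩
    · induction p using Fin.lastCases with
      | last => simp
      | cast p => have := hξ.1 p; rw [Fin.snoc_castSucc]; omega
    · induction q using Fin.lastCases with
      | last =>
        induction p using Fin.lastCases with
        | last => simp at hpq
        | cast p => have := hξ.1 p; rw [Fin.snoc_castSucc, Fin.snoc_last]; omega
      | cast q =>
        induction p using Fin.lastCases with
        | last => exact absurd hpq (by rw [not_lt]; exact (Fin.castSucc_lt_last q).le)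
        | cast p => rw [Fin.snoc_castSucc, Fin.snoc_castSucc]; exact hξ.2 p q (by simpa using hpq)
  · intro ξ hξ
    rw [Finset.mem_filter, mem_xiSeqs] at hξ
    rw [mem_xiSeqs]
    obtain ⟨⟨h1, h2⟩, p, hp⟩ := hξ
    have hl : ξ (Fin.last r) = σ + 1 := by
      rcases eq_or_ne p (Fin.last r) with rfl | h
      · exact hp
      · have := h2 p (Fin.last r) (Fin.lt_last_iff_ne_last.2 h)
        have := h1 (Fin.last r)
        omega
    refine ⟨fun q => ⟨(h1 _).1, ?_⟩, fun p q hpq => h2 _ _ (by simpa using hpq)⟩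
    have := h2 q.castSucc (Fin.last r) (Fin.castSucc_lt_last q)
    simp only [Fin.init]; omega
  · intro ξ _
    exact Fin.init_snoc _ _
  · intro ξ hξ
    rw [Finset.mem_filter, mem_xiSeqs] at hξ
    obtain ⟨⟨h1, h2⟩, p, hp⟩ := hξ
    have hl : ξ (Fin.last r) = σ + 1 := by
      rcases eq_or_ne p (Fin.last r) with rfl | h
      · exact hp
      · have := h2 p (Fin.last r) (Fin.lt_last_iff_ne_last.2 h)
        have := h1 (Fin.last r)
        omega
    conv_rhs => rw [← Fin.snoc_init_self ξ, hl]
  · intro ξ _; rfl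

variable {L : PeriodPair} {g δ : ℂ} {a : Fin 8 → ℂ} {c : Fin 4 → ℂ}

open Classical in
/-- The contribution of one admissible sequence to `Cfun`. -/
def xiTerm (P Q R : ℕ → ℂ) (σ r : ℕ) (ξ : Fin r → ℕ) : ℂ :=
  (∏ p, R (ξ p - 1) * P (ξ p)) *
    ∏ k ∈ (Finset.range σ).filter (fun k => ∀ p, k + 1 ≠ ξ p ∧ k ≠ ξ p), Q k

/-- The generic form of `Cfun`. -/
def xiSum (P Q R : ℕ → ℂ) (σ : ℕ) : ℂ :=
  ∑ r ∈ Finset.range (σ / 2 + 1), (-1) ^ r * ∑ ξ ∈ xiSeqs σ r, xiTerm P Q R σ r ξ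

/-- Gaps of at least 2 force the entry with zero-based index k to be at least 2k + 1. The sum over r
can thus be extended to a common range for σ, σ + 1 and σ + 2. -/
lemma xiSeqs_eq_empty {σ r : ℕ} (h : σ < 2 * r) : xiSeqs σ r = ∅ := by
  rw [Finset.eq_empty_iff_forall_notMem]
  intro ξ hξ
  rw [mem_xiSeqs] at hξ
  have key : ∀ k (hk : k < r), 2 * k + 1 ≤ ξ ⟨k, hk⟩ := by
    intro k
    induction k with
    | zero => intro hk; exact (hξ.1 _).1
    | succ k ih =>
      intro hk
      have := ih (by omega)
      have := hξ.2 ⟨k, by omega⟩ ⟨k + 1, hk⟩ (by simp)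
      omega
  have h1 := key (r - 1) (by omega)
  have h2 := (hξ.1 ⟨r - 1, by omega⟩).2
  omega

lemma xiSum_eq (P Q R : ℕ → ℂ) {σ n : ℕ} (h : σ / 2 + 1 ≤ n) :
    xiSum P Q R σ = ∑ r ∈ Finset.range n, (-1) ^ r * ∑ ξ ∈ xiSeqs σ r, xiTerm P Q R σ r ξ := by
  refine Finset.sum_subset (Finset.range_mono h) fun r _ hr => ?_
  rw [xiSeqs_eq_empty, Finset.sum_empty, mul_zero]
  rw [Finset.mem_range] at hr
  omega

lemma xiTerm_succ (P Q R : ℕ → ℂ) {σ r : ℕ} {ξ : Fin r → ℕ} (h : ξ ∈ xiSeqs (σ + 1) r) :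
    xiTerm P Q R (σ + 2) r ξ = Q (σ + 1) * xiTerm P Q R (σ + 1) r ξ := by
  classical
  rw [mem_xiSeqs] at h
  rw [xiTerm, xiTerm, Finset.range_add_one, Finset.filter_insert, if_pos, Finset.prod_insert]
  · ring
  · simp
  · intro p; have := h.1 p; omega

/-- A last entry σ + 1 uses up both indices σ and σ + 1, leaving an admissible sequence for σ. -/
lemma xiTerm_snoc (P Q R : ℕ → ℂ) {σ r : ℕ} (ξ : Fin r → ℕ) :
    xiTerm P Q R (σ + 2) (r + 1) (Fin.snoc (α := fun _ => ℕ) ξ (σ + 1)) =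
      R σ * P (σ + 1) * xiTerm P Q R σ r ξ := by
  classical
  rw [xiTerm, xiTerm, Fin.prod_univ_castSucc]
  simp only [Fin.snoc_castSucc, Fin.snoc_last, Nat.add_sub_cancel]
  have : (Finset.range (σ + 2)).filter (fun k => ∀ p,
      k + 1 ≠ (Fin.snoc (α := fun _ => ℕ) ξ (σ + 1) : Fin (r + 1) → ℕ) p ∧
      k ≠ (Fin.snoc (α := fun _ => ℕ) ξ (σ + 1) : Fin (r + 1) → ℕ) p) =
      (Finset.range σ).filter (fun k => ∀ p, k + 1 ≠ ξ p ∧ k ≠ ξ p) := by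
    ext k
    simp only [Finset.mem_filter, Finset.mem_range, Fin.forall_fin_succ', Fin.snoc_castSucc,
      Fin.snoc_last]
    constructor
    · rintro ⟨h1, h2, h3⟩
      exact ⟨by omega, h2⟩
    · rintro ⟨h1, h2⟩
      exact ⟨by omega, h2, by omega⟩
  rw [this]
  ring

/-- The admissible sequences are split according to whether σ + 1 occurs in them; the extra pair
costs one sign. This is the continuant recurrence. -/
lemma xiSum_add_two (P Q R : ℕ → ℂ) (σ : ℕ) : xiSum P Q R (σ + 2) =
    Q (σ + 1) * xiSum P Q R (σ + 1) - R σ * P (σ + 1) * xiSum P Q R σ := by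
  classical
  have hsplit : ∀ r, ∑ ξ ∈ xiSeqs (σ + 2) r, xiTerm P Q R (σ + 2) r ξ =
      Q (σ + 1) * ∑ ξ ∈ xiSeqs (σ + 1) r, xiTerm P Q R (σ + 1) r ξ +
      ∑ ξ ∈ (xiSeqs (σ + 2) r).filter (fun ξ => ∃ p, ξ p = σ + 1), xiTerm P Q R (σ + 2) r ξ := by
    intro r
    rw [← Finset.sum_filter_add_sum_filter_not _ (fun ξ : Fin r → ℕ => ∃ p, ξ p = σ + 1), add_comm,
      Finset.filter_congr_decidable, xiSeqs_filter_ne, Finset.mul_sum]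
    congr 1
    exact Finset.sum_congr rfl fun ξ hξ => xiTerm_succ P Q R hξ
  rw [xiSum_eq P Q R (σ := σ + 2) (n := σ + 2 + 1) (by omega),
    xiSum_eq P Q R (σ := σ + 1) (n := σ + 2 + 1) (by omega),
    xiSum_eq P Q R (σ := σ) (n := σ + 2) (by omega)]
  simp_rw [hsplit, mul_add, Finset.sum_add_distrib]
  rw [Finset.mul_sum, sub_eq_add_neg, Finset.mul_sum]
  congr 1
  · exact Finset.sum_congr rfl fun r _ => by ring
  · rw [Finset.sum_range_succ', Finset.filter_eq_empty_iff.2, Finset.sum_empty, mul_zero, add_zero,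
      ← Finset.sum_neg_distrib]
    · refine Finset.sum_congr rfl fun r _ => ?_
      rw [sum_xiSeqs_filter_eq, Finset.sum_congr rfl fun ξ _ => xiTerm_snoc P Q R ξ,
        ← Finset.mul_sum]
      ring
    · rintro ξ - ⟨p, -⟩
      exact p.elim0

lemma xiSum_zero (P Q R : ℕ → ℂ) : xiSum P Q R 0 = 1 := by
  have : xiSeqs 0 0 = Finset.univ :=
    Finset.eq_univ_of_forall fun ξ => mem_xiSeqs.2 ⟨fun p => p.elim0, fun p => p.elim0⟩
  simp [xiSum, this, xiTerm]

lemma xiSum_one (P Q R : ℕ → ℂ) : xiSum P Q R 1 = Q 0 := by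
  have : xiSeqs 1 0 = Finset.univ :=
    Finset.eq_univ_of_forall fun ξ => mem_xiSeqs.2 ⟨fun p => p.elim0, fun p => p.elim0⟩
  simp [xiSum, this, xiTerm]

lemma xiSum_eq_continuant (P Q R : ℕ → ℂ) (ν σ : ℕ) :
    xiSum (fun k => P (ν + k)) (fun k => Q (ν + k)) (fun k => R (ν + k)) σ =
      continuant P Q R ν σ := by
  induction σ using Nat.twoStepInduction with
  | zero => rw [xiSum_zero, continuant]
  | one => rw [xiSum_one, continuant, add_zero]
  | more σ h1 h2 => rw [xiSum_add_two, h1, h2, continuant, add_assoc]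

lemma Cfun_eq_xiSum (σ : ℕ) (z : ℂ) : Cfun L g δ a c σ z =
    xiSum (fun k => Aminus L g δ a (z + k * δ)) (fun k => Azero L g δ a c (z + k * δ))
      (fun k => Aplus L g δ a (z + k * δ)) σ := by
  rw [Cfun, xiSum]
  refine Finset.sum_congr rfl fun r _ => congrArg _ (Finset.sum_congr rfl fun ξ hξ => ?_)
  rw [mem_xiSeqs] at hξ
  rw [xiTerm]
  refine congrArg (· * _) (Finset.prod_congr rfl fun p _ => ?_)
  rw [Nat.cast_sub (hξ.1 p).1, Nat.cast_one]

lemma Cfun_eq_continuant (x : ℂ) (ν σ : ℕ) : Cfun L g δ a c σ (x + ν * δ) =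
    continuant (fun k => Aminus L g δ a (x + k * δ)) (fun k => Azero L g δ a c (x + k * δ))
      (fun k => Aplus L g δ a (x + k * δ)) ν σ := by
  rw [Cfun_eq_xiSum, ← xiSum_eq_continuant]
  congr 1 <;>
  · funext k
    congr 1
    push_cast
    ring

end EllipticBC

end

open scoped BigOperators

noncomputable section

namespace EllipticBC

/-! ### Products over sequences with omitted indices -/

/-- The increasing enumeration of the natural numbers other than `ν`. -/
def skipOne (ν k : ℕ) : ℕ := if k < ν then k else k + 1

lemma skip_eq {ν μ : ℕ} (h : ν ≤ μ) (k : ℕ) : skip ν μ k = skipOne (μ + 1) (skipOne ν k) := by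
  unfold skip skipOne; split_ifs <;> omega

lemma prod_skipOne (f : ℕ → ℂ) {ν n : ℕ} (h : ν ≤ n) :
    (∏ k ∈ Finset.range n, f (skipOne ν k)) * f ν = ∏ k ∈ Finset.range (n + 1), f k := by
  induction n, h using Nat.le_induction with
  | base =>
    rw [Finset.prod_range_succ]
    congr 1
    refine Finset.prod_congr rfl fun k hk => ?_
    rw [skipOne, if_pos (Finset.mem_range.1 hk)]
  | succ n h ih =>
    rw [Finset.prod_range_succ, Finset.prod_range_succ _ (n + 1), ← ih, skipOne, if_neg (by omega)]
    ring

lemma prod_skip (f : ℕ → ℂ) {ν μ n : ℕ} (h : ν ≤ μ) (h' : μ ≤ n) :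
    (∏ k ∈ Finset.range n, f (skip ν μ k)) * (f ν * f (μ + 1)) =
      ∏ k ∈ Finset.range (n + 2), f k := by
  have e : skipOne (μ + 1) ν = ν := by unfold skipOne; split_ifs <;> omega
  rw [← prod_skipOne f (show μ + 1 ≤ n + 1 by omega),
    ← prod_skipOne (fun k => f (skipOne (μ + 1) k)) (h.trans h'), e]
  simp only [skip_eq h]
  ring

/-- The product of `E a b` over all `b ≠ a` with `b < n`. -/
def offDiag (E : ℕ → ℕ → ℂ) (n a : ℕ) : ℂ := ∏ b ∈ Finset.range n, if b = a then 1 else E a b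

/-- The pairs lost by omitting ν are those containing ν; antisymmetry for the ν partners below it
gives the sign. -/
lemma prod_pairs_skipOne {E : ℕ → ℕ → ℂ} (hE : ∀ a b, E b a = -E a b) {ν n : ℕ} (h : ν ≤ n) :
    (∏ k ∈ Finset.range n, ∏ l ∈ Finset.range k, E (skipOne ν l) (skipOne ν k)) *
      ((-1) ^ ν * offDiag E (n + 1) ν) =
      ∏ k ∈ Finset.range (n + 1), ∏ l ∈ Finset.range k, E l k := by
  induction n, h using Nat.le_induction with
  | base =>
    rw [Finset.prod_range_succ, offDiag, Finset.prod_range_succ, if_pos rfl, mul_one]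
    congr 1
    · refine Finset.prod_congr rfl fun k hk => Finset.prod_congr rfl fun l hl => ?_
      rw [Finset.mem_range] at hk hl
      rw [skipOne, skipOne, if_pos hk, if_pos (by omega)]
    · have h0 := Finset.prod_neg (s := Finset.range ν) (f := fun b => if b = ν then 1 else E ν b)
      rw [Finset.card_range] at h0
      rw [← h0]
      refine Finset.prod_congr rfl fun b hb => ?_
      rw [Finset.mem_range] at hb
      rw [if_neg (by omega), hE, neg_neg]
  | succ n h ih =>
    have h1 := prod_skipOne (fun a => E a (n + 1)) h
    have h2 : offDiag E (n + 1 + 1) ν = offDiag E (n + 1) ν * E ν (n + 1) := by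
      rw [offDiag, Finset.prod_range_succ, if_neg (by omega), offDiag]
    rw [Finset.prod_range_succ, Finset.prod_range_succ _ (n + 1), ← ih, h2, ← h1,
      show skipOne ν n = n + 1 by unfold skipOne; split_ifs <;> omega]
    ring

/-- The pair of the two omitted indices is counted in both rows, so it reappears on the right. The
multiplied-out form avoids any nonvanishing assumption. -/
lemma prod_pairs_skip {E : ℕ → ℕ → ℂ} (hE : ∀ a b, E b a = -E a b) {ν μ n : ℕ} (h : ν ≤ μ)
    (h' : μ ≤ n) :
    (∏ k ∈ Finset.range n, ∏ l ∈ Finset.range k, E (skip ν μ l) (skip ν μ k)) *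
      (offDiag E (n + 2) ν * offDiag E (n + 2) (μ + 1)) =
      (-1) ^ (ν + μ + 1) * (∏ k ∈ Finset.range (n + 2), ∏ l ∈ Finset.range k, E l k) *
        E ν (μ + 1) := by
  have e : skipOne (μ + 1) ν = ν := by unfold skipOne; split_ifs <;> omega
  have h1 := prod_pairs_skipOne hE (show μ + 1 ≤ n + 1 by omega)
  have h2 := prod_pairs_skipOne (E := fun a b => E (skipOne (μ + 1) a) (skipOne (μ + 1) b))
    (fun a b => hE _ _) (h.trans h')
  have h3 := prod_skipOne (fun b => if b = ν then 1 else E ν b) (show μ + 1 ≤ n + 1 by omega)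
  rw [if_neg (by omega)] at h3
  have h4 : offDiag (fun a b => E (skipOne (μ + 1) a) (skipOne (μ + 1) b)) (n + 1) ν =
      ∏ k ∈ Finset.range (n + 1), (fun b => if b = ν then 1 else E ν b) (skipOne (μ + 1) k) := by
    refine Finset.prod_congr rfl fun b _ => ?_
    simp only [e]
    congr 1
    unfold skipOne
    rw [eq_iff_iff]
    split_ifs <;> omega
  simp only [← skip_eq h, h4] at h2
  change _ = offDiag E (n + 2) ν at h3
  rw [← h1, ← h2, ← h3]
  have h5 : ((-1 : ℂ) ^ (ν + μ + 1)) * (-1) ^ ν * (-1) ^ (μ + 1) = 1 := by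
    rw [mul_assoc, ← pow_add, ← pow_add, Even.neg_one_pow ⟨ν + μ + 1, by omega⟩]
  linear_combination (-(∏ k ∈ Finset.range n, ∏ l ∈ Finset.range k, E (skip ν μ l) (skip ν μ k)) *
    (∏ k ∈ Finset.range (n + 1), if skipOne (μ + 1) k = ν then 1 else E ν (skipOne (μ + 1) k)) *
    offDiag E (n + 2) (μ + 1) * E ν (μ + 1)) * h5

/-- Two rows and two columns are removed from a rectangle; their four intersections are removed
twice and must be restored. -/
lemma prod_cross_skip (h : ℕ → ℕ → ℂ) {ν μ n ν' μ' n' : ℕ} (h1 : ν ≤ μ) (h2 : μ ≤ n)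
    (h1' : ν' ≤ μ') (h2' : μ' ≤ n') :
    (∏ k ∈ Finset.range n, ∏ l ∈ Finset.range n', h (skip ν μ k) (skip ν' μ' l)) *
      ((∏ b ∈ Finset.range (n' + 2), h ν b) * (∏ b ∈ Finset.range (n' + 2), h (μ + 1) b) *
      ((∏ a ∈ Finset.range (n + 2), h a ν') * (∏ a ∈ Finset.range (n + 2), h a (μ' + 1)))) =
      (∏ a ∈ Finset.range (n + 2), ∏ b ∈ Finset.range (n' + 2), h a b) *
      (h ν ν' * h (μ + 1) (μ' + 1) * (h ν (μ' + 1) * h (μ + 1) ν')) := by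
  have e1 := fun k => prod_skip (fun b => h (skip ν μ k) b) h1' h2'
  have e2 := prod_skip (fun a => ∏ b ∈ Finset.range (n' + 2), h a b) h1 h2
  have e3 := prod_skip (fun a => h a ν') h1 h2
  have e4 := prod_skip (fun a => h a (μ' + 1)) h1 h2
  rw [← e2, ← e3, ← e4]
  simp_rw [← e1, Finset.prod_mul_distrib]
  ring

/-- Telescoping of a quotient of two shifted products. -/
lemma prod_range_telescope (F : ℕ → ℂ) (ν N : ℕ) :
    (∏ b ∈ Finset.range N, F b) * ∏ k ∈ Finset.range ν, F (k + N) =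
      (∏ k ∈ Finset.range ν, F k) * ∏ b ∈ Finset.range N, F (ν + b) := by
  rw [← Finset.prod_range_add, add_comm ν N, Finset.prod_range_add]
  simp only [add_comm]

lemma prod_div_telescope (F : ℕ → ℂ) (ν N : ℕ) (h1 : ∀ k < ν, F (k + N) ≠ 0)
    (h2 : ∀ b < N, F (ν + b) ≠ 0) :
    (∏ b ∈ Finset.range N, F b) / (∏ b ∈ Finset.range N, F (ν + b)) =
      (∏ k ∈ Finset.range ν, F k) / ∏ k ∈ Finset.range ν, F (k + N) := by
  rw [div_eq_div_iff, prod_range_telescope]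
  · exact Finset.prod_ne_zero_iff.2 fun b hb => h2 b (Finset.mem_range.1 hb)
  · exact Finset.prod_ne_zero_iff.2 fun b hb => h1 b (Finset.mem_range.1 hb)

end EllipticBC

end

open scoped BigOperators

noncomputable section

namespace EllipticBC

/-! ### Lists of points -/

variable {L : PeriodPair} {g δ : ℂ} {a : Fin 8 → ℂ} {c : Fin 4 → ℂ}

lemma prod_map_range {M : Type*} [CommMonoid M] (f : ℕ → M) (n : ℕ) :
    ((List.range n).map f).prod = ∏ k ∈ Finset.range n, f k := by
  induction n with
  | zero => simp
  | succ n ih => simp [List.range_succ, Finset.prod_range_succ, ih]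

/-- `∏_{i < j} [z_i ± z_j]` for a list of points. -/
def deltaList (L : PeriodPair) (g : ℂ) : List ℂ → ℂ
  | [] => 1
  | z :: l => (l.map (brpm L g z)).prod * deltaList L g l

lemma deltaList_append (l l' : List ℂ) : deltaList L g (l ++ l') =
    deltaList L g l * deltaList L g l' * (l.map fun z => (l'.map (brpm L g z)).prod).prod := by
  induction l with
  | nil => simp [deltaList]
  | cons z l ih =>
    rw [List.cons_append, deltaList, ih, deltaList, List.map_append, List.prod_append,
      List.map_cons, List.prod_cons]
    ring

lemma deltaList_range (q : ℕ → ℂ) (n : ℕ) : deltaList L g ((List.range n).map q) =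
    ∏ k ∈ Finset.range n, ∏ l ∈ Finset.range k, brpm L g (q l) (q k) := by
  induction n with
  | zero => simp [deltaList]
  | succ n ih =>
    rw [List.range_succ, List.map_append, deltaList_append, ih, Finset.prod_range_succ,
      ← prod_map_range fun l => brpm L g (q l) (q n)]
    simp [deltaList, Function.comp_def]

lemma deltaList_ofFn {n : ℕ} (z : Fin n → ℂ) : deltaList L g (List.ofFn z) = delta L g z := by
  induction n with
  | zero => simp [deltaList, delta]
  | succ n ih =>
    rw [List.ofFn_succ, deltaList, ih, delta, delta, Fin.prod_univ_succ]
    congr 1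
    · rw [List.map_ofFn, List.prod_ofFn, Fin.prod_Ioi_zero]
      rfl
    · refine Finset.prod_congr rfl fun i _ => ?_
      rw [Fin.prod_Ioi_succ]

/-- The concatenation of the chains `q i 0, …, q i (α i - 1)`. -/
def chains {m : ℕ} (α : Fin m → ℕ) (q : Fin m → ℕ → ℂ) : List ℂ :=
  (List.ofFn fun i => (List.range (α i)).map (q i)).flatten

lemma length_chains {m : ℕ} (α : Fin m → ℕ) (q : Fin m → ℕ → ℂ) :
    (chains α q).length = ∑ i, α i := by
  simp [chains, List.length_flatten, List.map_ofFn, List.sum_ofFn]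

lemma prod_map_chains {m : ℕ} (α : Fin m → ℕ) (q : Fin m → ℕ → ℂ) (f : ℂ → ℂ) :
    ((chains α q).map f).prod = ∏ i, ∏ k ∈ Finset.range (α i), f (q i k) := by
  simp [chains, List.map_flatten, List.prod_flatten, List.map_ofFn, List.prod_ofFn,
    ← prod_map_range, Function.comp_def]

lemma mem_chains {m : ℕ} {α : Fin m → ℕ} {q : Fin m → ℕ → ℂ} {z : ℂ} :
    z ∈ chains α q ↔ ∃ i, ∃ k < α i, q i k = z := by
  simp [chains, List.mem_flatten, List.mem_ofFn]

lemma chains_succ {m : ℕ} (α : Fin (m + 1) → ℕ) (q : Fin (m + 1) → ℕ → ℂ) :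
    chains α q = (List.range (α 0)).map (q 0) ++ chains (fun i => α i.succ) fun i => q i.succ := by
  simp [chains, List.ofFn_succ]

lemma deltaList_chains {m : ℕ} (α : Fin m → ℕ) (q : Fin m → ℕ → ℂ) :
    deltaList L g (chains α q) =
      (∏ i, ∏ k ∈ Finset.range (α i), ∏ l ∈ Finset.range k, brpm L g (q i l) (q i k)) *
      ∏ i, ∏ j ∈ Finset.Ioi i, ∏ k ∈ Finset.range (α i), ∏ l ∈ Finset.range (α j),
        brpm L g (q i k) (q j l) := by
  induction m with
  | zero => simp [chains, deltaList]
  | succ m ih =>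
    rw [chains_succ, deltaList_append, ih, deltaList_range, Fin.prod_univ_succ,
      Fin.prod_univ_succ (fun i => ∏ j ∈ Finset.Ioi i, _), Fin.prod_Ioi_zero]
    simp_rw [Fin.prod_Ioi_succ, prod_map_chains]
    rw [List.map_map, prod_map_range]
    simp only [Function.comp_def]
    rw [Finset.prod_comm]
    ring

/-! ### Expansion of several chains -/

section Expand

variable {V : Type*} [AddCommGroup V] [Module ℂ V]

open ExteriorAlgebra

lemma prod_ofFn_sum {A ι : Type*} [Ring A] [Algebra ℂ A] [DecidableEq ι] {m : ℕ} (s : Fin m → Finset ι)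
    (F : Fin m → ι → A) : (List.ofFn fun i => ∑ j ∈ s i, F i j).prod =
      ∑ r ∈ Fintype.piFinset s, (List.ofFn fun i => F i (r i)).prod := by
  have := (MultilinearMap.mkPiAlgebraFin ℂ m A).map_sum_finset F s
  simpa only [MultilinearMap.mkPiAlgebraFin_apply] using this

lemma prod_ofFn_smul {A : Type*} [Ring A] [Algebra ℂ A] {m : ℕ} (r : Fin m → ℂ)
    (F : Fin m → A) : (List.ofFn fun i => r i • F i).prod = (∏ i, r i) • (List.ofFn F).prod := by
  have := (MultilinearMap.mkPiAlgebraFin ℂ m A).map_smul_univ r F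
  simpa only [MultilinearMap.mkPiAlgebraFin_apply] using this

/-- The chains expand independently by `prod_three_term`, and multilinearity of the ordered product
gives the double sum over multi-indices. -/
lemma prod_chains_expand {m : ℕ} (α : Fin m → ℕ) (P Q R : Fin m → ℕ → ℂ) (p : Fin m → ℕ → ℂ)
    (v : ℂ → V) :
    (List.ofFn fun i => ((List.range (α i)).map fun k => ι ℂ
      (P i k • v (p i k) + Q i k • v (p i (k + 1)) + R i k • v (p i (k + 2)))).prod).prod =
      ∑ μ ∈ Finset.Icc 0 α, ∑ ν ∈ Finset.Icc 0 μ,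
        (∏ i, (∏ k ∈ Finset.range (ν i), P i k) * (∏ k ∈ Finset.Ico (μ i) (α i), R i k) *
          continuant (P i) (Q i) (R i) (ν i) (μ i - ν i)) •
        ((chains α fun i k => p i (skip (ν i) (μ i) k)).map fun z => ι ℂ (v z)).prod := by
  classical
  have hIcc : ∀ α : Fin m → ℕ, Finset.Icc 0 α = Fintype.piFinset fun i => Finset.range (α i + 1) := by
    intro α; ext μ
    simp [Pi.le_def, Fintype.mem_piFinset]
  have h1 := fun i => prod_three_term (P i) (Q i) (R i) (fun k => v (p i k)) (α i)
  simp_rw [h1]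
  rw [prod_ofFn_sum, hIcc]
  refine Finset.sum_congr rfl fun μ _ => ?_
  rw [prod_ofFn_sum, hIcc]
  refine Finset.sum_congr rfl fun ν _ => ?_
  rw [prod_ofFn_smul]
  congr 1
  simp only [chains, List.map_flatten, List.prod_flatten, List.map_ofFn, Function.comp_def,
    chainWedge, List.map_map]

end Expand

end EllipticBC

end

open scoped BigOperators

noncomputable section

namespace EllipticBC

/-! ### The Cauchy weight of shifted chains -/

variable {L : PeriodPair} {g δ : ℂ} {m n : ℕ}

/-- The points of a chain, numbered so that the chain itself is `node δ x 1, …, node δ x n`. -/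
def node (δ x : ℂ) (k : ℕ) : ℂ := x + k * δ - δ

lemma node_zero (x : ℂ) : node δ x 0 = x - δ := by simp [node]

lemma node_succ (x : ℂ) (k : ℕ) : node δ x (k + 1) = x + k * δ := by
  simp only [node]; push_cast; ring

lemma brpm_node (x x' : ℂ) (k l : ℕ) : brpm L g (node δ x k) (node δ x' l) =
    br L g (x + x' + ((k : ℤ) + l - 2 : ℤ) * δ) * br L g (x - x' + ((k : ℤ) - l : ℤ) * δ) := by
  rw [brpm]
  congr 2 <;> simp only [node] <;> push_cast <;> ring

lemma prod_prod_eq_diag_mul (f : Fin m → Fin m → ℂ) : ∏ i, ∏ j, f i j =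
    (∏ i, f i i) * ∏ i, ∏ j ∈ Finset.Ioi i, f i j * f j i := by
  classical
  rw [Finset.prod_prod_Ioi_mul_eq_prod_prod_off_diag (fun i j => f j i), ← Finset.prod_mul_distrib]
  refine Finset.prod_congr rfl fun i _ => ?_
  rw [← Finset.mul_prod_erase Finset.univ _ (Finset.mem_univ i), Finset.compl_singleton]

/-- The product of the interactions of a point with a chain, other than with itself. -/
def rowProd (L : PeriodPair) (g δ : ℂ) (x : Fin m → ℂ) (α : Fin m → ℕ) (i j : Fin m) (k : ℕ) : ℂ :=
  ∏ l ∈ Finset.range (α j + 2),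
    if j = i ∧ l = k then 1 else brpm L g (node δ (x i) k) (node δ (x j) l)

/-- The point is that K is independent of ν and μ: up to sign it is the product over all pairs in
the extended chains of α_i + 2 points, and it disappears from ratios. -/
lemma exists_deltaList_chains_skip (x : Fin m → ℂ) (α : Fin m → ℕ) : ∃ K : ℂ, ∀ ν μ : Fin m → ℕ,
    ν ≤ μ → μ ≤ α →
    deltaList L g (chains α fun i k => node δ (x i) (skip (ν i) (μ i) k)) *
      (∏ i, ∏ j, rowProd L g δ x α i j (ν i) * rowProd L g δ x α i j (μ i + 1)) =
    K * (-1) ^ (∑ i, ν i + ∑ i, μ i) *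
      (∏ i, ∏ j ∈ Finset.Ioi i, brpm L g (node δ (x i) (ν i)) (node δ (x j) (ν j)) *
        brpm L g (node δ (x i) (μ i + 1)) (node δ (x j) (μ j + 1))) *
      ∏ i, ∏ j, brpm L g (node δ (x i) (ν i)) (node δ (x j) (μ j + 1)) := by
  let H : Fin m → Fin m → ℕ → ℕ → ℂ := fun i j k l => brpm L g (node δ (x i) k) (node δ (x j) l)
  -- The first minus sign is the +1 in the exponent of `prod_pairs_skip`; the second comes from
  -- writing one corner of each cross product with i and j exchanged.
  refine ⟨(∏ i, -∏ k ∈ Finset.range (α i + 2), ∏ l ∈ Finset.range k, H i i l k) *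
    ∏ i, ∏ j ∈ Finset.Ioi i, -∏ k ∈ Finset.range (α i + 2), ∏ l ∈ Finset.range (α j + 2), H i j k l,
    fun ν μ hν hμ => ?_⟩
  have hdiag : ∀ i, (∏ k ∈ Finset.range (α i), ∏ l ∈ Finset.range k,
      H i i (skip (ν i) (μ i) l) (skip (ν i) (μ i) k)) *
      (rowProd L g δ x α i i (ν i) * rowProd L g δ x α i i (μ i + 1)) =
      (-∏ k ∈ Finset.range (α i + 2), ∏ l ∈ Finset.range k, H i i l k) *
        ((-1) ^ (ν i + μ i) * H i i (ν i) (μ i + 1)) := by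
    intro i
    have := prod_pairs_skip (E := H i i) (fun a b => brpm_swap _ _) (hν i) (hμ i)
    have e1 : ∀ k, rowProd L g δ x α i i k = offDiag (H i i) (α i + 2) k := fun k => by
      simp only [rowProd, offDiag, true_and]; rfl
    rw [e1, e1, this]
    ring
  have hrow : ∀ {i j}, i ≠ j → ∀ k, rowProd L g δ x α i j k =
      ∏ l ∈ Finset.range (α j + 2), H i j k l := by
    intro i j h k
    refine Finset.prod_congr rfl fun l _ => ?_
    rw [if_neg (fun h' => h h'.1.symm)]
  have hcol : ∀ {i j}, i ≠ j → ∀ k, rowProd L g δ x α j i k = (-1) ^ (α i + 2) *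
      ∏ l ∈ Finset.range (α i + 2), H i j l k := by
    intro i j h k
    rw [hrow h.symm]
    have := Finset.prod_neg (s := Finset.range (α i + 2)) (f := fun l => H i j l k)
    rw [Finset.card_range] at this
    rw [← this]
    exact Finset.prod_congr rfl fun l _ => brpm_swap _ _
  have hcross : ∀ i j, i < j → (∏ k ∈ Finset.range (α i), ∏ l ∈ Finset.range (α j),
      H i j (skip (ν i) (μ i) k) (skip (ν j) (μ j) l)) *
      ((rowProd L g δ x α i j (ν i) * rowProd L g δ x α i j (μ i + 1)) *
        (rowProd L g δ x α j i (ν j) * rowProd L g δ x α j i (μ j + 1))) =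
      (-∏ k ∈ Finset.range (α i + 2), ∏ l ∈ Finset.range (α j + 2), H i j k l) *
        ((H i j (ν i) (ν j) * H i j (μ i + 1) (μ j + 1)) *
          (H i j (ν i) (μ j + 1) * H j i (ν j) (μ i + 1))) := by
    intro i j h
    have h1 := prod_cross_skip (H i j) (hν i) (hμ i) (hν j) (hμ j)
    have h2 : H j i (ν j) (μ i + 1) = -H i j (μ i + 1) (ν j) := brpm_swap _ _
    have h3 : ((-1 : ℂ) ^ (α i + 2)) * (-1) ^ (α i + 2) = 1 := by
      rw [← pow_add, Even.neg_one_pow ⟨_, rfl⟩]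
    rw [hrow h.ne, hrow h.ne, hcol h.ne, hcol h.ne, h2]
    linear_combination h1 + (∏ k ∈ Finset.range (α i), ∏ l ∈ Finset.range (α j),
      H i j (skip (ν i) (μ i) k) (skip (ν j) (μ j) l)) * 
      ((∏ b ∈ Finset.range (α j + 2), H i j (ν i) b) *
        (∏ b ∈ Finset.range (α j + 2), H i j (μ i + 1) b) *
      ((∏ a ∈ Finset.range (α i + 2), H i j a (ν j)) *
        (∏ a ∈ Finset.range (α i + 2), H i j a (μ j + 1)))) * h3
  have hD := Finset.prod_congr (s₁ := Finset.univ) rfl fun i _ => hdiag i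
  have hC := Finset.prod_congr (s₁ := Finset.univ) rfl fun i _ =>
    Finset.prod_congr rfl fun j hj => hcross i j (Finset.mem_Ioi.1 hj)
  rw [deltaList_chains, prod_prod_eq_diag_mul (fun i j => brpm L g _ _),
    prod_prod_eq_diag_mul (fun i j => rowProd _ _ _ _ _ _ _ _ * _)]
  simp only [Finset.prod_mul_distrib, Finset.prod_pow_eq_pow_sum, Finset.sum_add_distrib, H]
    at hD hC ⊢
  have h := congrArg₂ (· * ·) hD hC
  linear_combination h

end EllipticBC

end

open scoped BigOperators

noncomputable section

namespace EllipticBC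

/-! ### Ratios of interactions within one family of chains -/

variable {L : PeriodPair} {g δ : ℂ} {m n : ℕ}

/-- The points of the two families of chains are in general position. -/
structure GenericPoints (L : PeriodPair) (δ : ℂ) (x : Fin m → ℂ) (y : Fin n → ℂ) : Prop where
  transverse : Transverse L δ
  gen_left : ∀ i, Gen L δ (x i)
  gen_right : ∀ k, Gen L δ (y k)
  apart_left : ∀ i j, i ≠ j → Apart L δ (x i) (x j)
  apart_right : ∀ i j, i ≠ j → Apart L δ (y i) (y j)
  apart : ∀ i k, Apart L δ (x i) (y k)

lemma GenericPoints.symm {x : Fin m → ℂ} {y : Fin n → ℂ} (h : GenericPoints L δ x y) :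
    GenericPoints L δ y x :=
  ⟨h.1, h.3, h.2, h.5, h.4, fun i k => (h.apart k i).symm⟩

/-- The factors of `[z + z']` along two chains. -/
def sumFactor (L : PeriodPair) (g δ : ℂ) (x : Fin m → ℂ) (i j : Fin m) (k : ℤ) : ℂ :=
  br L g (x i + x j + ((k - 2 : ℤ) : ℂ) * δ)

/-- The factors of `[z - z']` along two chains, omitting a zero factor. -/
def diffFactor (L : PeriodPair) (g δ : ℂ) (x : Fin m → ℂ) (i j : Fin m) (k : ℤ) : ℂ :=
  if j = i ∧ k = 0 then 1 else br L g (x i - x j + (k : ℂ) * δ)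

/-- The factor of `[z + z']` at coinciding points. -/
def selfFactor (L : PeriodPair) (g δ : ℂ) (x : Fin m → ℂ) (i j : Fin m) (k : ℕ) : ℂ :=
  if j = i then sumFactor L g δ x i j (2 * k) else 1

section

variable {x : Fin m → ℂ} {y : Fin n → ℂ} (hG : GenericPoints L δ x y)

include hG

lemma sumFactor_ne_zero (i j : Fin m) (k : ℤ) : sumFactor L g δ x i j k ≠ 0 := by
  refine br_ne_zero ?_
  rcases eq_or_ne i j with rfl | h
  · rw [← two_mul]; exact hG.gen_left i _
  · exact (hG.apart_left i j h _).1

lemma br_sub_ne_zero {i j : Fin m} {k : ℤ} (h : j = i → k ≠ 0) :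
    br L g (x i - x j + (k : ℂ) * δ) ≠ 0 := by
  refine br_ne_zero ?_
  rcases eq_or_ne j i with rfl | h'
  · rw [sub_self, zero_add]; exact hG.transverse k (h rfl)
  · exact (hG.apart_left i j h'.symm _).2

lemma diffFactor_ne_zero (i j : Fin m) (k : ℤ) : diffFactor L g δ x i j k ≠ 0 := by
  rw [diffFactor]
  split_ifs with h
  · exact one_ne_zero
  · exact br_sub_ne_zero hG (fun h1 h2 => h ⟨h1, h2⟩)

lemma selfFactor_ne_zero (i j : Fin m) (k : ℕ) : selfFactor L g δ x i j k ≠ 0 := by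
  rw [selfFactor]
  split_ifs
  · exact sumFactor_ne_zero hG _ _ _
  · exact one_ne_zero

omit hG

lemma diffFactor_of_ne {i j : Fin m} {k : ℤ} (h : j = i → k ≠ 0) :
    diffFactor L g δ x i j k = br L g (x i - x j + (k : ℂ) * δ) :=
  if_neg fun h' => h h'.1 h'.2

lemma brpm_node_eq {i j : Fin m} {k l : ℕ} (h : j = i → k ≠ l) :
    brpm L g (node δ (x i) k) (node δ (x j) l) =
      sumFactor L g δ x i j (k + l) * diffFactor L g δ x i j (k - l) := by
  rw [brpm_node, diffFactor_of_ne (fun h' => by have := h h'; omega), sumFactor]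

/-- The row omits the whole factor [z ± z], although only its half [z - z] vanishes. Restoring [z +
z] makes the sum and difference factors run over full ranges, as telescoping requires. -/
lemma rowProd_mul_selfFactor (α : Fin m → ℕ) {i j : Fin m} {k : ℕ} (hk : j = i → k < α j + 2) :
    rowProd L g δ x α i j k * selfFactor L g δ x i j k =
      (∏ l ∈ Finset.range (α j + 2), sumFactor L g δ x i j (k + l)) *
      ∏ l ∈ Finset.range (α j + 2), diffFactor L g δ x i j (k - l) := by
  have h1 : selfFactor L g δ x i j k = ∏ l ∈ Finset.range (α j + 2),
      if l = k then selfFactor L g δ x i j k else 1 := by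
    rw [Finset.prod_ite_eq']
    split_ifs with h
    · rfl
    · rw [Finset.mem_range] at h
      exact if_neg fun h' => h (hk h')
  rw [h1, rowProd, ← Finset.prod_mul_distrib, ← Finset.prod_mul_distrib]
  refine Finset.prod_congr rfl fun l _ => ?_
  by_cases h : j = i ∧ l = k
  · obtain ⟨rfl, rfl⟩ := h
    rw [if_pos ⟨rfl, rfl⟩, if_pos rfl, selfFactor, if_pos rfl, diffFactor, if_pos ⟨rfl, by omega⟩]
    rw [one_mul, mul_one]
    congr 1; ring
  · rw [if_neg h, brpm_node_eq (fun h' h'' => h ⟨h', h''.symm⟩), selfFactor]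
    split_ifs with h1 h2
    · exact absurd ⟨h2, h1⟩ h
    · rw [mul_one]
    · rw [mul_one]

include hG

lemma rowProd_ne_zero (α : Fin m → ℕ) {i j : Fin m} {k : ℕ} (hk : j = i → k < α j + 2) :
    rowProd L g δ x α i j k ≠ 0 := by
  refine left_ne_zero_of_mul (b := selfFactor L g δ x i j k) ?_
  rw [rowProd_mul_selfFactor α hk]
  exact mul_ne_zero (Finset.prod_ne_zero_iff.2 fun l _ => sumFactor_ne_zero hG _ _ _)
    (Finset.prod_ne_zero_iff.2 fun l _ => diffFactor_ne_zero hG _ _ _)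

/-- The quotient of brackets cancels the last factor l = α_j + 1 of each row; the remaining α_j + 1
factors telescope into ν factors. This split also keeps the zero difference factor out of the
Pochhammer symbols. -/
lemma rowProd_zero_div (α : Fin m → ℕ) {i j : Fin m} {ν : ℕ} (hν : ν ≤ α i) :
    rowProd L g δ x α i j 0 / rowProd L g δ x α i j ν *
      (brpm L g (node δ (x i) ν) (node δ (x j) (α j + 1)) /
        brpm L g (node δ (x i) 0) (node δ (x j) (α j + 1))) =
    selfFactor L g δ x i j ν / selfFactor L g δ x i j 0 *
      ((brPoch L g δ (x i + x j - 2 * δ) ν /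
        brPoch L g δ (x i + x j + ((α j : ℂ) - 1) * δ) ν) *
      (brPoch L g δ (x i - x j - α j * δ) ν / brPoch L g δ (x i - x j + δ) ν)) := by
  have hS := sumFactor_ne_zero (g := g) hG i j
  have hD := diffFactor_ne_zero (g := g) hG i j
  have hT := selfFactor_ne_zero (g := g) hG i j
  have e0 := rowProd_mul_selfFactor (L := L) (g := g) (δ := δ) (x := x) α (i := i) (j := j) (k := 0)
    (by omega)
  have e1 := rowProd_mul_selfFactor (L := L) (g := g) (δ := δ) (x := x) α (i := i) (j := j) (k := ν)
    (by rintro rfl; omega)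
  have t1 := prod_div_telescope (fun b => sumFactor L g δ x i j b) ν (α j + 1)
    (fun _ _ => hS _) (fun _ _ => hS _)
  have t2 := prod_div_telescope (fun b => diffFactor L g δ x i j (b - α j)) ν (α j + 1)
    (fun _ _ => hD _) (fun _ _ => hD _)
  have r : ∀ k : ℕ, ∏ l ∈ Finset.range (α j + 1), diffFactor L g δ x i j (k - l) =
      ∏ b ∈ Finset.range (α j + 1), diffFactor L g δ x i j ((k + b : ℕ) - α j) := by
    intro k
    rw [← Finset.prod_range_reflect]
    refine Finset.prod_congr rfl fun b hb => ?_
    rw [Finset.mem_range] at hb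
    congr 1; omega
  have p1 : brPoch L g δ (x i + x j - 2 * δ) ν =
      ∏ k ∈ Finset.range ν, sumFactor L g δ x i j k := by
    refine Finset.prod_congr rfl fun k _ => ?_
    rw [sumFactor]; congr 1; push_cast; ring
  have p2 : brPoch L g δ (x i + x j + ((α j : ℂ) - 1) * δ) ν =
      ∏ k ∈ Finset.range ν, sumFactor L g δ x i j ((k + (α j + 1) : ℕ)) := by
    refine Finset.prod_congr rfl fun k _ => ?_
    rw [sumFactor]; congr 1; push_cast; ring
  have p3 : brPoch L g δ (x i - x j - α j * δ) ν =
      ∏ k ∈ Finset.range ν, diffFactor L g δ x i j (k - α j) := by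
    refine Finset.prod_congr rfl fun k hk => ?_
    rw [Finset.mem_range] at hk
    rw [diffFactor_of_ne (by rintro rfl; omega)]; congr 1; push_cast; ring
  have p4 : brPoch L g δ (x i - x j + δ) ν =
      ∏ k ∈ Finset.range ν, diffFactor L g δ x i j ((k + (α j + 1) : ℕ) - α j) := by
    refine Finset.prod_congr rfl fun k hk => ?_
    rw [diffFactor_of_ne (by rintro rfl; omega)]; congr 1; push_cast; ring
  rw [p1, p2, p3, p4, ← t1, ← t2]
  rw [brpm_node_eq (by rintro rfl; omega), brpm_node_eq (by rintro rfl; omega)]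
  rw [Finset.prod_range_succ, Finset.prod_range_succ _ (α j + 1), r] at e0 e1
  have n0 := rowProd_ne_zero (g := g) hG α (i := i) (j := j) (k := 0) (by omega)
  have n1 := rowProd_ne_zero (g := g) hG α (i := i) (j := j) (k := ν) (by rintro rfl; omega)
  rw [← eq_div_iff (hT _)] at e0 e1
  rw [e0, e1]
  simp only [Nat.cast_add, Nat.cast_zero, zero_add]
  have q1 : ∏ b ∈ Finset.range (α j + 1), sumFactor L g δ x i j (ν + b) ≠ 0 :=
    Finset.prod_ne_zero_iff.2 fun l _ => hS _
  have q2 : ∏ b ∈ Finset.range (α j + 1), diffFactor L g δ x i j (ν + b - α j) ≠ 0 :=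
    Finset.prod_ne_zero_iff.2 fun l _ => hD _
  have s1 := hS (ν + ((α j : ℕ) + (1 : ℕ) : ℤ))
  have s2 := hS ((α j : ℕ) + (1 : ℕ) : ℤ)
  have s3 := hD (ν - ((α j : ℕ) + (1 : ℕ) : ℤ))
  have s4 := hD (0 - ((α j : ℕ) + (1 : ℕ) : ℤ))
  have s5 := hT 0
  have s6 := hT ν
  field_simp

/-- The mirror image of `rowProd_zero_div` at the upper end of the chain: the factor l = 0 is split
off, and telescoping runs downwards from α_i + 1. -/
lemma rowProd_succ_div (α : Fin m → ℕ) {i j : Fin m} {μ : ℕ} (hμ : μ ≤ α i) :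
    rowProd L g δ x α i j (α i + 1) / rowProd L g δ x α i j (μ + 1) *
      (brpm L g (node δ (x i) (μ + 1)) (node δ (x j) 0) /
        brpm L g (node δ (x i) (α i + 1)) (node δ (x j) 0)) =
    selfFactor L g δ x i j (μ + 1) / selfFactor L g δ x i j (α i + 1) *
      (brPoch L g δ (-x i - x j - ((α i : ℂ) + α j) * δ) (α i - μ) /
        brPoch L g δ (-x i - x j - ((α i : ℂ) - 1) * δ) (α i - μ) *
      (brPoch L g δ (-x i + x j - α i * δ) (α i - μ) /
        brPoch L g δ (-x i + x j + ((α j : ℂ) - α i + 1) * δ) (α i - μ))) := by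
  have hS := sumFactor_ne_zero (g := g) hG i j
  have hD := diffFactor_ne_zero (g := g) hG i j
  have hT := selfFactor_ne_zero (g := g) hG i j
  have e0 := rowProd_mul_selfFactor (L := L) (g := g) (δ := δ) (x := x) α (i := i) (j := j)
    (k := α i + 1) (by rintro rfl; omega)
  have e1 := rowProd_mul_selfFactor (L := L) (g := g) (δ := δ) (x := x) α (i := i) (j := j)
    (k := μ + 1) (by rintro rfl; omega)
  have t1 := prod_div_telescope (fun b => sumFactor L g δ x i j (α i + α j + 2 - b)) (α i - μ)
    (α j + 1) (fun _ _ => hS _) (fun _ _ => hS _)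
  have t2 := prod_div_telescope (fun b => diffFactor L g δ x i j (α i - b)) (α i - μ) (α j + 1)
    (fun _ _ => hD _) (fun _ _ => hD _)
  have r : ∀ k : ℕ, k ≤ α i → ∏ l ∈ Finset.range (α j + 1),
      sumFactor L g δ x i j ((k + 1 : ℕ) + (l + 1 : ℕ)) =
      ∏ b ∈ Finset.range (α j + 1), sumFactor L g δ x i j (α i + α j + 2 - (α i - k + b : ℕ)) := by
    intro k hk
    rw [← Finset.prod_range_reflect]
    refine Finset.prod_congr rfl fun b hb => ?_
    rw [Finset.mem_range] at hb
    congr 1; omega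
  have r' : ∀ k : ℕ, k ≤ α i → ∏ l ∈ Finset.range (α j + 1),
      diffFactor L g δ x i j ((k + 1 : ℕ) - (l + 1 : ℕ)) =
      ∏ b ∈ Finset.range (α j + 1), diffFactor L g δ x i j (α i - (α i - k + b : ℕ)) := by
    intro k hk
    refine Finset.prod_congr rfl fun b hb => ?_
    congr 1; omega
  have neg_div : ∀ (F G : ℕ → ℂ) (N : ℕ), (∏ k ∈ Finset.range N, -F k) /
      (∏ k ∈ Finset.range N, -G k) = (∏ k ∈ Finset.range N, F k) / ∏ k ∈ Finset.range N, G k := by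
    intro F G N
    rw [← Finset.prod_div_distrib, ← Finset.prod_div_distrib]
    simp only [neg_div_neg_eq]
  have p1 : brPoch L g δ (-x i - x j - ((α i : ℂ) + α j) * δ) (α i - μ) =
      ∏ k ∈ Finset.range (α i - μ), -sumFactor L g δ x i j (α i + α j + 2 - k) := by
    refine Finset.prod_congr rfl fun k _ => ?_
    rw [sumFactor, ← br_neg]; congr 1; push_cast; ring
  have p2 : brPoch L g δ (-x i - x j - ((α i : ℂ) - 1) * δ) (α i - μ) =
      ∏ k ∈ Finset.range (α i - μ),
        -sumFactor L g δ x i j (α i + α j + 2 - (k + (α j + 1) : ℕ)) := by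
    refine Finset.prod_congr rfl fun k _ => ?_
    rw [sumFactor, ← br_neg]; congr 1; push_cast; ring
  have p3 : brPoch L g δ (-x i + x j - α i * δ) (α i - μ) =
      ∏ k ∈ Finset.range (α i - μ), -diffFactor L g δ x i j (α i - k) := by
    refine Finset.prod_congr rfl fun k hk => ?_
    rw [Finset.mem_range] at hk
    rw [diffFactor_of_ne (by rintro rfl; omega), ← br_neg]; congr 1; push_cast; ring
  have p4 : brPoch L g δ (-x i + x j + ((α j : ℂ) - α i + 1) * δ) (α i - μ) =
      ∏ k ∈ Finset.range (α i - μ), -diffFactor L g δ x i j (α i - (k + (α j + 1) : ℕ)) := by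
    refine Finset.prod_congr rfl fun k hk => ?_
    rw [diffFactor_of_ne (by rintro rfl; omega), ← br_neg]; congr 1; push_cast; ring
  rw [p1, p2, p3, p4, neg_div, neg_div, ← t1, ← t2]
  rw [brpm_node_eq (by rintro rfl; omega), brpm_node_eq (by rintro rfl; omega)]
  rw [Finset.prod_range_succ', Finset.prod_range_succ' _ (α j + 1)] at e0 e1
  rw [r _ le_rfl, r' _ le_rfl] at e0
  rw [r _ hμ, r' _ hμ] at e1
  rw [← eq_div_iff (hT _)] at e0 e1
  rw [e0, e1]
  simp only [Nat.sub_self, zero_add]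
  have q1 : ∏ b ∈ Finset.range (α j + 1),
      sumFactor L g δ x i j (α i + α j + 2 - (α i - μ + b : ℕ)) ≠ 0 :=
    Finset.prod_ne_zero_iff.2 fun l _ => hS _
  have q2 : ∏ b ∈ Finset.range (α j + 1), diffFactor L g δ x i j (α i - (α i - μ + b : ℕ)) ≠ 0 :=
    Finset.prod_ne_zero_iff.2 fun l _ => hD _
  have s1 := hS ((μ + 1 : ℕ) + (0 : ℕ))
  have s2 := hS ((α i + 1 : ℕ) + (0 : ℕ))
  have s3 := hD ((μ + 1 : ℕ) - (0 : ℕ))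
  have s4 := hD ((α i + 1 : ℕ) - (0 : ℕ))
  have s5 := hT (α i + 1)
  have s6 := hT (μ + 1)
  field_simp

end

end EllipticBC

end

open scoped BigOperators

noncomputable section

namespace EllipticBC

/-! ### Interactions between the two families of chains -/

variable {L : PeriodPair} {g δ : ℂ} {m n : ℕ}

/-- The interaction of a point with a single chain. -/
def mixRow (L : PeriodPair) (g δ y : ℂ) (β : ℕ) (z : ℂ) : ℂ :=
  ∏ l ∈ Finset.range β, brpm L g z (y + l * δ)

/-- The interaction of a point with several chains. -/
def mixProd (L : PeriodPair) (g δ : ℂ) (y : Fin n → ℂ) (β : Fin n → ℕ) (z : ℂ) : ℂ :=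
  ∏ k, mixRow L g δ (y k) (β k) z

lemma mixRow_ne_zero {x y : ℂ} (h : Apart L δ x y) (β k : ℕ) :
    mixRow L g δ y β (node δ x k) ≠ 0 := by
  refine Finset.prod_ne_zero_iff.2 fun l _ => Apart.brpm_ne_zero (δ := δ) ?_
  refine h.shift_eq (k - 1) l ?_ ?_
  · simp only [node]; push_cast; ring
  · push_cast; ring

/-- Moving a point ν steps past a chain of length β trades a ratio of products of length β for one
of length ν. -/
lemma mixRow_div_zero {x y : ℂ} (h : Apart L δ x y) (β ν : ℕ) :
    mixRow L g δ y β (node δ x ν) / mixRow L g δ y β (node δ x 0) =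
      brPoch L g δ (x + y + ((β : ℂ) - 1) * δ) ν / brPoch L g δ (x + y - δ) ν *
        (brPoch L g δ (x - y) ν / brPoch L g δ (x - y - β * δ) ν) := by
  let F : ℕ → ℂ := fun b => br L g (x + y - δ + b * δ)
  let G : ℕ → ℂ := fun b => br L g (x - y - β * δ + b * δ)
  have hF : ∀ b, F b ≠ 0 := fun b => br_ne_zero (by
    convert! (h (b - 1)).1 using 1; push_cast; ring_nf)
  have hG : ∀ b, G b ≠ 0 := fun b => br_ne_zero (by
    convert! (h (b - β)).2 using 1; push_cast; ring_nf)
  have e : ∀ k, mixRow L g δ y β (node δ x k) =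
      (∏ b ∈ Finset.range β, F (k + b)) * ∏ b ∈ Finset.range β, G (k + b) := by
    intro k
    simp only [mixRow, brpm]
    rw [Finset.prod_mul_distrib]
    congr 1
    · refine Finset.prod_congr rfl fun b _ => ?_
      simp only [F, node]; congr 1; push_cast; ring
    · rw [← Finset.prod_range_reflect]
      refine Finset.prod_congr rfl fun b hb => ?_
      rw [Finset.mem_range] at hb
      simp only [G, node]; congr 1
      rw [Nat.sub_sub, Nat.cast_sub (by omega)]; push_cast; ring
  have p1 : brPoch L g δ (x + y + ((β : ℂ) - 1) * δ) ν = ∏ k ∈ Finset.range ν, F (k + β) :=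
    Finset.prod_congr rfl fun k _ => by simp only [F]; congr 1; push_cast; ring
  have p2 : brPoch L g δ (x - y) ν = ∏ k ∈ Finset.range ν, G (k + β) :=
    Finset.prod_congr rfl fun k _ => by simp only [G]; congr 1; push_cast; ring
  have t1 := prod_div_telescope F ν β (fun _ _ => hF _) (fun _ _ => hF _)
  have t2 := prod_div_telescope G ν β (fun _ _ => hG _) (fun _ _ => hG _)
  rw [e, e, p1, p2, brPoch, brPoch, mul_div_mul_comm]
  simp only [zero_add]
  rw [← inv_div, t1, ← inv_div (∏ b ∈ Finset.range β, G b), t2, inv_div, inv_div]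

lemma mixRow_div_succ {x y : ℂ} (h : Apart L δ x y) (β : ℕ) {μ α : ℕ} (hμ : μ ≤ α) :
    mixRow L g δ y β (node δ x (μ + 1)) / mixRow L g δ y β (node δ x (α + 1)) =
      brPoch L g δ (-x - y - ((α : ℂ) - 1) * δ) (α - μ) /
        brPoch L g δ (-x - y - ((α : ℂ) + β - 1) * δ) (α - μ) *
      (brPoch L g δ (-x + y - ((α : ℂ) - β) * δ) (α - μ) /
        brPoch L g δ (-x + y - α * δ) (α - μ)) := by
  let F : ℕ → ℂ := fun b => br L g (-x - y - ((α : ℂ) + β - 1) * δ + b * δ)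
  let G : ℕ → ℂ := fun b => br L g (-x + y - α * δ + b * δ)
  have hF : ∀ b, F b ≠ 0 := fun b => br_ne_zero (by
    rw [← neg_mem_iff]; convert! (h (α + β - 1 - b)).1 using 1; push_cast; ring_nf)
  have hG : ∀ b, G b ≠ 0 := fun b => br_ne_zero (by
    rw [← neg_mem_iff]; convert! (h (α - b)).2 using 1; push_cast; ring_nf)
  have e : ∀ k ≤ α, mixRow L g δ y β (node δ x (k + 1)) =
      (∏ b ∈ Finset.range β, -F (α - k + b)) * ∏ b ∈ Finset.range β, -G (α - k + b) := by
    intro k hk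
    simp only [mixRow, brpm]
    rw [Finset.prod_mul_distrib]
    congr 1
    · rw [← Finset.prod_range_reflect]
      refine Finset.prod_congr rfl fun b hb => ?_
      rw [Finset.mem_range] at hb
      simp only [F, node]; rw [← br_neg]; congr 1
      rw [Nat.sub_sub, Nat.cast_sub (by omega), Nat.cast_add (α - k), Nat.cast_sub hk]
      push_cast; ring
    · refine Finset.prod_congr rfl fun b _ => ?_
      simp only [G, node]; rw [← br_neg]; congr 1
      rw [Nat.cast_add (α - k), Nat.cast_sub hk]
      push_cast; ring
  have e' : ∀ k ≤ α, mixRow L g δ y β (node δ x (k + 1)) =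
      (∏ b ∈ Finset.range β, F (α - k + b)) * ∏ b ∈ Finset.range β, G (α - k + b) := by
    intro k hk
    rw [e k hk, ← Finset.prod_mul_distrib, ← Finset.prod_mul_distrib]
    simp only [neg_mul_neg]
  have p1 : brPoch L g δ (-x - y - ((α : ℂ) - 1) * δ) (α - μ) =
      ∏ k ∈ Finset.range (α - μ), F (k + β) :=
    Finset.prod_congr rfl fun k _ => by simp only [F]; congr 1; push_cast; ring
  have p2 : brPoch L g δ (-x + y - ((α : ℂ) - β) * δ) (α - μ) =
      ∏ k ∈ Finset.range (α - μ), G (k + β) :=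
    Finset.prod_congr rfl fun k _ => by simp only [G]; congr 1; push_cast; ring
  have t1 := prod_div_telescope F (α - μ) β (fun _ _ => hF _) (fun _ _ => hF _)
  have t2 := prod_div_telescope G (α - μ) β (fun _ _ => hG _) (fun _ _ => hG _)
  rw [e' _ hμ, e' _ le_rfl, p1, p2, brPoch, brPoch, mul_div_mul_comm]
  simp only [Nat.sub_self, zero_add]
  rw [← inv_div, t1, ← inv_div (∏ b ∈ Finset.range β, G b), t2, inv_div, inv_div]

/-- The weight of a family of points in the Cauchy determinant. -/
def weight (L : PeriodPair) (g δ : ℂ) (y : Fin n → ℂ) (β : Fin n → ℕ) (l : List ℂ) : ℂ :=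
  deltaList L g l / (l.map (mixProd L g δ y β)).prod

lemma prod_mixProd_skip (x : Fin m → ℂ) (α : Fin m → ℕ) (y : Fin n → ℂ) (β : Fin n → ℕ)
    {ν μ : Fin m → ℕ} (hν : ν ≤ μ) (hμ : μ ≤ α) :
    ((chains α fun i k => node δ (x i) (skip (ν i) (μ i) k)).map (mixProd L g δ y β)).prod *
      ((∏ i, ∏ k, mixRow L g δ (y k) (β k) (node δ (x i) (ν i))) *
        ∏ i, ∏ k, mixRow L g δ (y k) (β k) (node δ (x i) (μ i + 1))) =
      ∏ i, ∏ l ∈ Finset.range (α i + 2), mixProd L g δ y β (node δ (x i) l) := by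
  rw [prod_map_chains, ← Finset.prod_mul_distrib, ← Finset.prod_mul_distrib]
  refine Finset.prod_congr rfl fun i _ => ?_
  exact prod_skip (fun k => mixProd L g δ y β (node δ (x i) k)) (hν i) (hμ i)

lemma prod_selfFactor (x : Fin m → ℂ) (k : Fin m → ℕ) :
    ∏ i, ∏ j, selfFactor L g δ x i j (k i) = ∏ i, sumFactor L g δ x i i (2 * k i) := by
  refine Finset.prod_congr rfl fun i _ => ?_
  simp only [selfFactor]
  rw [Finset.prod_ite_eq' Finset.univ i, if_pos (Finset.mem_univ _)]

end EllipticBC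

end

open scoped BigOperators

noncomputable section

namespace EllipticBC

/-! ### Identification of the terms of the series -/

variable {L : PeriodPair} {g δ : ℂ} {m n : ℕ}

/-- Pure field algebra for `weight_skip`. The letters stand for: D, M numerator and denominator of a
weight; R row products; Q products over pairs of equal type; H brackets between a lower and an upper
omitted point; S coincidence factors; X interactions with the chains in y. -/
lemma weight_ratio_algebra {C D₁ M₁ D₀ M₀ R₁ R₂ R₃ R₄ Q₁ Q₂ Q₃ Q₄ H₁ H₂ H₃ H₄ H₅ H₆ S₁ S₂ S₃ S₄
    X₁ X₂ X₃ X₄ s t K p₁ p₂ p₃ p₄ u₁ u₂ u₃ u₄ : ℂ}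
    (k1 : D₁ * (R₁ * R₃) = K * (s * t) * (Q₁ * Q₃) * H₁)
    (k0 : D₀ * (R₂ * R₄) = K * t * (Q₂ * Q₄) * H₄) (m1 : M₁ * (X₁ * X₃) = M₀ * (X₂ * X₄))
    (rν : R₂ / R₁ * (H₂ / H₄) = S₁ / S₂ * (p₁ * p₂))
    (rμ : R₄ / R₃ * (H₅ / H₆) = S₃ / S₄ * (p₃ * p₄))
    (xν : X₁ / X₂ = u₁ * u₂) (xμ : X₃ / X₄ = u₃ * u₄) (hswap : H₄ * H₅ = H₃ * H₆)
    (r1 : R₁ ≠ 0) (r2 : R₂ ≠ 0) (r3 : R₃ ≠ 0) (r4 : R₄ ≠ 0)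
    (x1 : X₁ ≠ 0) (x2 : X₂ ≠ 0) (x3 : X₃ ≠ 0) (x4 : X₄ ≠ 0)
    (h2 : H₂ ≠ 0) (h3 : H₃ ≠ 0) (h4 : H₄ ≠ 0) (h6 : H₆ ≠ 0)
    (q2 : Q₂ ≠ 0) (q4 : Q₄ ≠ 0) :
    C * (D₁ / M₁) = s * C * (S₁ / S₂ * (S₃ / S₄)) * (Q₁ / Q₂ * (Q₃ / Q₄)) *
      (H₄ / H₃ * (H₁ / H₂) * p₁ * p₂) * (p₃ * p₄) * (u₁ * u₂) * (u₃ * u₄) * (D₀ / M₀) := by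
  have e5 : H₅ = H₃ * H₆ / H₄ := by rw [eq_div_iff h4, mul_comm, hswap]
  have e1 : D₁ = K * (s * t) * (Q₁ * Q₃) * H₁ / (R₁ * R₃) := by
    rw [eq_div_iff (mul_ne_zero r1 r3), k1]
  have e0 : D₀ = K * t * (Q₂ * Q₄) * H₄ / (R₂ * R₄) := by
    rw [eq_div_iff (mul_ne_zero r2 r4), k0]
  have em : M₁ = M₀ * (X₂ * X₄) / (X₁ * X₃) := by rw [eq_div_iff (mul_ne_zero x1 x3), m1]
  have : s * C * (S₁ / S₂ * (S₃ / S₄)) * (Q₁ / Q₂ * (Q₃ / Q₄)) *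
      (H₄ / H₃ * (H₁ / H₂) * p₁ * p₂) * (p₃ * p₄) * (u₁ * u₂) * (u₃ * u₄) * (D₀ / M₀) =
      s * C * (Q₁ / Q₂ * (Q₃ / Q₄)) * (H₄ / H₃ * (H₁ / H₂)) * (S₁ / S₂ * (p₁ * p₂)) *
      (S₃ / S₄ * (p₃ * p₄)) * (u₁ * u₂) * (u₃ * u₄) * (D₀ / M₀) := by ring
  rw [this, ← rν, ← rμ, ← xν, ← xμ, em, e1, e0, e5]
  field_simp

/-- This explains the shape of S: its term is the coefficient of the chain expansion times the ratio
of the Cauchy weights of the shifted and the original points. -/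
lemma weight_skip {x : Fin m → ℂ} {y : Fin n → ℂ} (hG : GenericPoints L δ x y) (a : Fin 8 → ℂ)
    (c : Fin 4 → ℂ) (α : Fin m → ℕ) (β : Fin n → ℕ) {ν μ : Fin m → ℕ} (hν : ν ≤ μ) (hμ : μ ≤ α) :
    (∏ i, (∏ k ∈ Finset.range (ν i), Aminus L g δ a (x i + k * δ)) *
      (∏ k ∈ Finset.Ico (μ i) (α i), Aplus L g δ a (x i + k * δ)) *
      continuant (fun k => Aminus L g δ a (x i + k * δ)) (fun k => Azero L g δ a c (x i + k * δ))
        (fun k => Aplus L g δ a (x i + k * δ)) (ν i) (μ i - ν i)) *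
      weight L g δ y β (chains α fun i k => node δ (x i) (skip (ν i) (μ i) k)) =
    bcTerm L g δ a c x α y β ν μ * weight L g δ y β (chains α fun i k => x i + k * δ) := by
  have hα : ∀ i, 0 ≤ α i := fun i => Nat.zero_le _
  -- The original chains are the case ν = 0, μ = α, so both weights come from the same formula with
  -- the same constant K.
  have href : (chains α fun i k => x i + k * δ) =
      chains α fun i k => node δ (x i) (skip 0 (α i) k) := by
    simp only [chains]
    congr 2
    funext i
    refine List.map_congr_left fun k hk => ?_
    rw [List.mem_range] at hk
    rw [skip, if_neg (by omega), if_pos hk, node_succ]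
  have hA : (∏ i, (∏ k ∈ Finset.range (ν i), Aminus L g δ a (x i + k * δ)) *
      (∏ k ∈ Finset.Ico (μ i) (α i), Aplus L g δ a (x i + k * δ)) *
      continuant (fun k => Aminus L g δ a (x i + k * δ)) (fun k => Azero L g δ a c (x i + k * δ))
        (fun k => Aplus L g δ a (x i + k * δ)) (ν i) (μ i - ν i)) =
      ∏ i, shiftProd δ (Aminus L g δ a) (x i) (ν i) *
      shiftProd δ (Aplus L g δ a) (x i + μ i * δ) (α i - μ i) *
      Cfun L g δ a c (μ i - ν i) (x i + ν i * δ) := by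
    refine Finset.prod_congr rfl fun i _ => ?_
    rw [Cfun_eq_continuant, Finset.prod_Ico_eq_prod_range, shiftProd, shiftProd]
    congr 2
    refine Finset.prod_congr rfl fun k _ => ?_
    congr 1; push_cast; ring
  rw [hA, href]
  obtain ⟨K, hK⟩ := exists_deltaList_chains_skip (L := L) (g := g) (δ := δ) x α
  have k1 := hK ν μ hν hμ
  have k0 := hK 0 α (Pi.le_def.2 hα) le_rfl
  have m1 := prod_mixProd_skip (L := L) (g := g) (δ := δ) x α y β hν hμ
  have m0 := prod_mixProd_skip (L := L) (g := g) (δ := δ) x α y β (ν := 0) (Pi.le_def.2 hα) le_rfl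
  rw [← m0] at m1
  have rν := Finset.prod_congr (s₁ := Finset.univ) rfl fun i _ =>
    Finset.prod_congr (s₁ := Finset.univ) rfl fun j _ =>
      rowProd_zero_div (g := g) hG α (j := j) ((hν i).trans (hμ i))
  have rμ := Finset.prod_congr (s₁ := Finset.univ) rfl fun i _ =>
    Finset.prod_congr (s₁ := Finset.univ) rfl fun j _ =>
      rowProd_succ_div (g := g) hG α (j := j) (hμ i)
  have xν := Finset.prod_congr (s₁ := Finset.univ) rfl fun i _ =>
    Finset.prod_congr (s₁ := Finset.univ) rfl fun k _ =>
      mixRow_div_zero (g := g) (hG.apart i k) (β k) (ν i)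
  have xμ := Finset.prod_congr (s₁ := Finset.univ) rfl fun i _ =>
    Finset.prod_congr (s₁ := Finset.univ) rfl fun k _ =>
      mixRow_div_succ (g := g) (hG.apart i k) (β k) (hμ i)
  have hR : ∀ k : Fin m → ℕ, k ≤ α + 1 → ∏ i, ∏ j, rowProd L g δ x α i j (k i) ≠ 0 := fun k hk =>
    Finset.prod_ne_zero_iff.2 fun i _ => Finset.prod_ne_zero_iff.2 fun j _ =>
      rowProd_ne_zero (g := g) hG α (by rintro rfl; have := hk j; simp at this; omega)
  have hM : ∀ k : Fin m → ℕ, ∏ i, ∏ j, mixRow L g δ (y j) (β j) (node δ (x i) (k i)) ≠ 0 :=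
    fun k => Finset.prod_ne_zero_iff.2 fun i _ => Finset.prod_ne_zero_iff.2 fun j _ =>
      mixRow_ne_zero (hG.apart i j) _ _
  have hH : ∀ k l : Fin m → ℕ, (∀ i, k i ≠ l i) →
      ∏ i, ∏ j, brpm L g (node δ (x i) (k i)) (node δ (x j) (l j)) ≠ 0 := fun k l hkl =>
    Finset.prod_ne_zero_iff.2 fun i _ => Finset.prod_ne_zero_iff.2 fun j _ => by
      rw [brpm_node_eq (by rintro rfl; exact hkl j)]
      exact mul_ne_zero (sumFactor_ne_zero hG _ _ _) (diffFactor_ne_zero hG _ _ _)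
  have hP : ∀ k : Fin m → ℕ,
      ∏ i, ∏ j ∈ Finset.Ioi i, brpm L g (node δ (x i) (k i)) (node δ (x j) (k j)) ≠ 0 := fun k =>
    Finset.prod_ne_zero_iff.2 fun i _ => Finset.prod_ne_zero_iff.2 fun j hj => by
      have : j ≠ i := (Finset.mem_Ioi.1 hj).ne'
      rw [brpm_node_eq (fun h => absurd h this)]
      exact mul_ne_zero (sumFactor_ne_zero hG _ _ _) (diffFactor_ne_zero hG _ _ _)
  -- Exchanging the arguments produces m² signs on each side, which agree.
  have hswap : (∏ i, ∏ j, brpm L g (node δ (x i) 0) (node δ (x j) (α j + 1))) *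
      (∏ i, ∏ j, brpm L g (node δ (x i) (μ i + 1)) (node δ (x j) 0)) =
      (∏ i, ∏ j, brpm L g (node δ (x i) 0) (node δ (x j) (μ j + 1))) *
      (∏ i, ∏ j, brpm L g (node δ (x i) (α i + 1)) (node δ (x j) 0)) := by
    have e : ∀ k : Fin m → ℕ, ∏ i, ∏ j, brpm L g (node δ (x i) (k i)) (node δ (x j) 0) =
        ∏ i, ∏ j, -brpm L g (node δ (x i) 0) (node δ (x j) (k j)) := fun k => by
      rw [Finset.prod_comm]
      exact Finset.prod_congr rfl fun i _ => Finset.prod_congr rfl fun j _ => brpm_swap _ _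
    rw [e fun i => μ i + 1, e fun i => α i + 1]
    simp only [Finset.prod_neg, Finset.prod_mul_distrib]
    ring
  have hsgn : ((-1 : ℂ) ^ (∑ i, ν i + ∑ i, μ i)) =
      (-1) ^ ((∑ i, ν i) + ∑ i, (α i - μ i)) * (-1) ^ (∑ i, (0 : Fin m → ℕ) i + ∑ i, α i) := by
    have : ∑ i, α i = ∑ i, (α i - μ i) + ∑ i, μ i := by
      rw [← Finset.sum_add_distrib]
      exact Finset.sum_congr rfl fun i _ => (Nat.sub_add_cancel (hμ i)).symm
    rw [this, ← pow_add]
    simp only [Pi.zero_apply, Finset.sum_const_zero, zero_add]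
    rw [show ∑ i, ν i + ∑ i, (α i - μ i) + (∑ i, (α i - μ i) + ∑ i, μ i) =
      ∑ i, ν i + ∑ i, μ i + 2 * ∑ i, (α i - μ i) by ring, pow_add _ _ (2 * _), pow_mul]
    simp
  rw [hsgn] at k1
  have b1 : ∏ i, br L g (2 * x i + 2 * ((ν i : ℂ) - 1) * δ) =
      ∏ i, sumFactor L g δ x i i (2 * ν i) :=
    Finset.prod_congr rfl fun i _ => by rw [sumFactor]; congr 1; push_cast; ring
  have b2 : ∏ i, br L g (2 * x i - 2 * δ) =
      ∏ i, sumFactor L g δ x i i (2 * (0 : ℕ)) :=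
    Finset.prod_congr rfl fun i _ => by rw [sumFactor]; congr 1; push_cast; ring
  have b3 : ∏ i, br L g (2 * x i + 2 * μ i * δ) =
      ∏ i, sumFactor L g δ x i i (2 * (μ i + 1 : ℕ)) :=
    Finset.prod_congr rfl fun i _ => by rw [sumFactor]; congr 1; push_cast; ring
  have b4 : ∏ i, br L g (2 * x i + 2 * α i * δ) =
      ∏ i, sumFactor L g δ x i i (2 * (α i + 1 : ℕ)) :=
    Finset.prod_congr rfl fun i _ => by rw [sumFactor]; congr 1; push_cast; ring
  have f0 : ∀ i, x i - δ = node δ (x i) 0 := fun i => (node_zero _).symm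
  have f1 : ∀ i, x i + ν i * δ - δ = node δ (x i) (ν i) := fun i => by rw [node]
  have f2 : ∀ i, x i + μ i * δ = node δ (x i) (μ i + 1) := fun i => (node_succ _ _).symm
  have f3 : ∀ i, x i + α i * δ = node δ (x i) (α i + 1) := fun i => (node_succ _ _).symm
  have r1 := hR ν (hν.trans (hμ.trans fun i => by simp))
  have r2 := hR (fun _ => 0) (fun i => by simp)
  have r3 := hR (fun i => μ i + 1) (fun i => by simpa using hμ i)
  have r4 := hR (fun i => α i + 1) (fun i => by simp)
  have x1 := hM ν
  have x2 := hM fun _ => 0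
  have x3 := hM fun i => μ i + 1
  have x4 := hM fun i => α i + 1
  have h1 := hH ν (fun i => μ i + 1) (fun i => (Nat.lt_succ_of_le (hν i)).ne)
  have h2 := hH ν (fun i => α i + 1) (fun i => (Nat.lt_succ_of_le ((hν i).trans (hμ i))).ne)
  have h3 := hH (fun _ => 0) (fun i => μ i + 1) (fun i => (Nat.succ_ne_zero _).symm)
  have h4 := hH (fun _ => 0) (fun i => α i + 1) (fun i => (Nat.succ_ne_zero _).symm)
  have h5 := hH (fun i => μ i + 1) (fun _ => 0) (fun i => by omega)
  have h6 := hH (fun i => α i + 1) (fun _ => 0) (fun i => by omega)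
  have q1 := hP ν
  have q2 := hP fun _ => 0
  have q3 := hP fun i => μ i + 1
  have q4 := hP fun i => α i + 1
  simp only [weight, bcTerm]
  simp only [f0, f1, f2, f3]
  simp only [Finset.prod_mul_distrib, Finset.prod_div_distrib, prod_selfFactor, Pi.zero_apply, b1,
    b2, b3, b4] at *
  exact weight_ratio_algebra k1 k0 m1 rν rμ xν xμ hswap r1 r2 r3 r4 x1 x2 x3 x4 h2 h3 h4
    h6 q2 q4

end EllipticBC

end

open scoped BigOperators

noncomputable section

namespace EllipticBC

variable {L : PeriodPair} {g δ : ℂ} {a : Fin 8 → ℂ} {c : Fin 4 → ℂ} {m n : ℕ}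

/-! ### Determinants of theta functions and kernels -/

open ExteriorAlgebra

/-- The determinant as a linear functional on the exterior algebra. -/
def detFunctional (n : ℕ) : ExteriorAlgebra ℂ (Fin n → ℂ) →ₗ[ℂ] ℂ :=
  liftAlternating (Pi.single n Matrix.detRowAlternating)

lemma detFunctional_prod {n : ℕ} (v : Fin n → Fin n → ℂ) :
    detFunctional n (List.ofFn fun i => ι ℂ (v i)).prod = (Matrix.of v).det := by
  rw [← ιMulti_apply, detFunctional, liftAlternating_apply_ιMulti, Pi.single_eq_same]
  rfl

/-- A functional that takes Cauchy determinant values on wedge products takes a multiple of a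
series of type `BC` as value on a wedge product of three-term combinations along chains. -/
lemma apply_prod_chains {V : Type*} [AddCommGroup V] [Module ℂ V] (v : ℂ → V)
    (Λ : ExteriorAlgebra ℂ V →ₗ[ℂ] ℂ) (K : ℂ) {x : Fin m → ℂ} {y : Fin n → ℂ}
    (hG : GenericPoints L δ x y) (α : Fin m → ℕ) (β : Fin n → ℕ)
    (hΛ : ∀ l : List ℂ, l.length = ∑ i, α i → (∀ z ∈ l, ∃ i k, node δ (x i) k = z) →
      Λ (l.map fun z => ι ℂ (v z)).prod = K * weight L g δ y β l) :
    Λ ((chains α fun i k => x i + k * δ).map fun z => ι ℂ (Aminus L g δ a z • v (z - δ) +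
      Azero L g δ a c z • v z + Aplus L g δ a z • v (z + δ))).prod =
    bcSum L g δ a c x α y β * (K * weight L g δ y β (chains α fun i k => x i + k * δ)) := by
  have h1 := prod_chains_expand α (fun i k => Aminus L g δ a (x i + k * δ))
    (fun i k => Azero L g δ a c (x i + k * δ)) (fun i k => Aplus L g δ a (x i + k * δ))
    (fun i k => node δ (x i) k) v
  have h2 : (List.ofFn fun i => ((List.range (α i)).map fun k : ℕ => ι ℂ
      (Aminus L g δ a (x i + k * δ) • v (node δ (x i) k) +
        Azero L g δ a c (x i + k * δ) • v (node δ (x i) (k + 1)) +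
        Aplus L g δ a (x i + k * δ) • v (node δ (x i) (k + 2)))).prod).prod =
      ((chains α fun i k => x i + k * δ).map fun z => ι ℂ (Aminus L g δ a z • v (z - δ) +
      Azero L g δ a c z • v z + Aplus L g δ a z • v (z + δ))).prod := by
    simp only [chains, List.map_flatten, List.prod_flatten, List.map_ofFn, Function.comp_def,
      List.map_map]
    have e1 : ∀ i (k : ℕ), node δ (x i) k = x i + k * δ - δ := fun i k => rfl
    have e2 : ∀ i (k : ℕ), node δ (x i) (k + 1) = x i + k * δ := fun i k => node_succ _ _
    have e3 : ∀ i (k : ℕ), node δ (x i) (k + 2) = x i + k * δ + δ := fun i k => by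
      simp only [node]; push_cast; ring
    simp only [e3]
    simp only [e2]
    simp only [e1]
  rw [← h2, h1, map_sum, bcSum, Finset.sum_mul]
  refine Finset.sum_congr rfl fun μ hμ => ?_
  rw [map_sum, Finset.sum_mul]
  refine Finset.sum_congr rfl fun ν hν => ?_
  rw [Finset.mem_Icc] at hμ hν
  rw [map_smul, hΛ _ (length_chains _ _), smul_eq_mul, mul_left_comm, weight_skip hG a c α β hν.2 hμ.2]
  · ring
  · intro z hz
    obtain ⟨i, k, -, rfl⟩ := mem_chains.1 hz
    exact ⟨i, _, rfl⟩

/-- Kernels with parameters `w` followed by the Lagrange basis. -/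
def thetaFun (L : PeriodPair) (g : ℂ) {N d : ℕ} (s : Fin d → ℂ) (w : Fin N → ℂ) :
    Fin (N + d) → ℂ → ℂ :=
  Fin.append (fun K => kern L g s (w K)) (fun k => lagr L g s k)

/-- Dividing row z by ∏[z ± s_l] turns the kernels, up to column constants, and the Lagrange
functions into entries 1/[z ± t] of a single Cauchy matrix with t = (w, s). -/
lemma det_thetaFun {N d : ℕ} (s : Fin d → ℂ) (w : Fin N → ℂ) (z : Fin (N + d) → ℂ)
    (hw : ∀ I K, brpm L g (z I) (w K) ≠ 0) (hs : ∀ I l, brpm L g (z I) (s l) ≠ 0)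
    (hws : ∀ K, gauge L g s (w K) ≠ 0) :
    (Matrix.of fun I J => thetaFun L g s w J (z I)).det =
      (∏ i : Fin (N + d), ∏ _j ∈ Finset.Ioi i, (-1 : ℂ)) * delta L g s * delta L g w * delta L g z /
        ∏ I, ∏ K, brpm L g (z I) (w K) := by
  let t : Fin (N + d) → ℂ := Fin.append w s
  let r : Fin (N + d) → ℂ := Fin.append (fun K => (gauge L g s (w K))⁻¹) fun _ => 1
  have ht : ∀ I J, brpm L g (z I) (t J) ≠ 0 := by
    intro I J
    induction J using Fin.addCases with
    | left K => simpa [t] using hw I K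
    | right l => simpa [t] using hs I l
  have hM : (Matrix.of fun I J => thetaFun L g s w J (z I)) =
      Matrix.of fun I J => gauge L g s (z I) *
        (Matrix.of fun I J => r J * (Matrix.of fun I J => 1 / brpm L g (z I) (t J)) I J) I J := by
    ext I J
    simp only [Matrix.of_apply]
    induction J using Fin.addCases with
    | left K =>
      simp only [thetaFun, t, r, Fin.append_left, kern]
      have := hw I K
      have := hws K
      field_simp
    | right l =>
      simp only [thetaFun, t, r, Fin.append_right, lagr, gauge]
      rw [← Finset.mul_prod_erase _ _ (Finset.mem_univ l)]
      have := hs I l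
      field_simp
  rw [hM, Matrix.det_mul_column, Matrix.det_mul_row, det_one_div_brpm _ _ ht]
  have h1 : ∏ I, ∏ J, brpm L g (z I) (t J) =
      (∏ I, ∏ K, brpm L g (z I) (w K)) * ∏ I, gauge L g s (z I) := by
    rw [← Finset.prod_mul_distrib]
    refine Finset.prod_congr rfl fun I _ => ?_
    rw [Fin.prod_univ_add]
    simp only [t, Fin.append_left, Fin.append_right, gauge]
  have h2 : ∏ i, ∏ j ∈ Finset.Ioi i, brpm L g (t j) (t i) =
      (∏ i : Fin (N + d), ∏ _j ∈ Finset.Ioi i, (-1 : ℂ)) * delta L g t := by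
    rw [delta, ← Finset.prod_mul_distrib]
    refine Finset.prod_congr rfl fun i _ => ?_
    rw [← Finset.prod_mul_distrib]
    refine Finset.prod_congr rfl fun j _ => ?_
    rw [brpm_swap]; ring
  have h3 : delta L g t = delta L g w * delta L g s * ∏ K, gauge L g s (w K) := by
    rw [← deltaList_ofFn, ← deltaList_ofFn w, ← deltaList_ofFn s, List.ofFn_fin_append,
      deltaList_append, List.map_ofFn, List.prod_ofFn]
    congr 1
    refine Finset.prod_congr rfl fun K _ => ?_
    simp only [Function.comp_def, List.map_ofFn, List.prod_ofFn, gauge]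
  have h4 : ∏ J, r J = (∏ K, gauge L g s (w K))⁻¹ := by
    rw [Fin.prod_univ_add]
    simp [r]
  have n1 : ∏ I, gauge L g s (z I) ≠ 0 :=
    Finset.prod_ne_zero_iff.2 fun I _ => Finset.prod_ne_zero_iff.2 fun l _ => hs I l
  have n2 : ∏ K, gauge L g s (w K) ≠ 0 := Finset.prod_ne_zero_iff.2 fun K _ => hws K
  have n3 : ∏ I, ∏ K, brpm L g (z I) (w K) ≠ 0 :=
    Finset.prod_ne_zero_iff.2 fun I _ => Finset.prod_ne_zero_iff.2 fun l _ => hw I l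
  rw [h1, h2, h3, h4]
  field_simp

end EllipticBC

end

open scoped BigOperators

noncomputable section

namespace EllipticBC

variable {L : PeriodPair} {g δ : ℂ} {a : Fin 8 → ℂ} {c : Fin 4 → ℂ} {m n : ℕ}

open ExteriorAlgebra

/-! ### The duality of series up to a determinant -/

lemma exists_ofFn_eq {n : ℕ} {l : List ℂ} (h : l.length = n) : ∃ z : Fin n → ℂ, List.ofFn z = l := by
  subst h
  exact ⟨l.get, List.ofFn_get l⟩

lemma prod_eq_of_ofFn_eq_chains {N : ℕ} {w : Fin N → ℂ} {β : Fin n → ℕ} {q : Fin n → ℕ → ℂ}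
    (h : List.ofFn w = chains β q) (f : ℂ → ℂ) :
    ∏ K, f (w K) = ∏ i, ∏ k ∈ Finset.range (β i), f (q i k) := by
  rw [← prod_map_chains, ← h, List.map_ofFn, List.prod_ofFn]
  rfl

lemma mixProd_eq {N : ℕ} {w : Fin N → ℂ} {β : Fin n → ℕ} {y : Fin n → ℂ}
    (h : List.ofFn w = chains β fun k l => y k + l * δ) (z : ℂ) :
    mixProd L g δ y β z = ∏ K, brpm L g z (w K) := by
  rw [prod_eq_of_ofFn_eq_chains h fun u => brpm L g z u]
  rfl

lemma weight_ofFn {N M : ℕ} {w : Fin N → ℂ} {β : Fin n → ℕ} {y : Fin n → ℂ}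
    (h : List.ofFn w = chains β fun k l => y k + l * δ) (z : Fin M → ℂ) :
    weight L g δ y β (List.ofFn z) = delta L g z / ∏ I, ∏ K, brpm L g (z I) (w K) := by
  rw [weight, deltaList_ofFn, List.map_ofFn, List.prod_ofFn]
  simp only [Function.comp_def, mixProd_eq h]

/-- The nodes `s` are in general position with respect to the chains. -/
structure GenericNodes (L : PeriodPair) (δ : ℂ) {d : ℕ} (x : Fin m → ℂ) (y : Fin n → ℂ)
    (s : Fin d → ℂ) : Prop where
  separated : Separated L s
  gen : ∀ l, Gen L δ (s l)
  left : ∀ i l, Apart L δ (x i) (s l)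
  right : ∀ k l, Apart L δ (y k) (s l)

section

variable {N d : ℕ} {x : Fin m → ℂ} {y : Fin n → ℂ} {α : Fin m → ℕ} {β : Fin n → ℕ}
  {s : Fin d → ℂ} {z : Fin (N + d) → ℂ} {w : Fin N → ℂ}

lemma exists_of_ofFn_eq {M : ℕ} {z : Fin M → ℂ} (hz : List.ofFn z = chains α fun i k => x i + k * δ)
    (I : Fin M) : ∃ i, ∃ k : ℤ, z I = x i + k * δ := by
  have : z I ∈ chains α fun i k => x i + k * δ := by
    rw [← hz, List.mem_ofFn]; exact ⟨I, rfl⟩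
  obtain ⟨i, k, -, h⟩ := mem_chains.1 this
  exact ⟨i, k, by rw [← h]; norm_cast⟩

lemma det_thetaFun_eq (hG : GenericPoints L δ x y) (hs : GenericNodes L δ x y s)
    (hz : ∀ I, ∃ i, ∃ k : ℤ, z I = x i + k * δ) (hw : ∀ K, ∃ i, ∃ k : ℤ, w K = y i + k * δ) :
    (Matrix.of fun I J => thetaFun L g s w J (z I)).det =
      (∏ i : Fin (N + d), ∏ _j ∈ Finset.Ioi i, (-1 : ℂ)) * delta L g s * delta L g w * delta L g z /
        ∏ I, ∏ K, brpm L g (z I) (w K) := by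
  refine det_thetaFun s w z (fun I K => ?_) (fun I l => ?_) fun K =>
    Finset.prod_ne_zero_iff.2 fun l _ => ?_
  · obtain ⟨i, k, h⟩ := hz I
    obtain ⟨j, l, h'⟩ := hw K
    exact ((hG.apart i j).shift_eq k l h h').brpm_ne_zero
  · obtain ⟨i, k, h⟩ := hz I
    exact ((hs.left i l).shift_eq k 0 h (by simp)).brpm_ne_zero
  · obtain ⟨j, k, h⟩ := hw K
    exact ((hs.right j l).shift_eq k 0 h (by simp)).brpm_ne_zero

/-- The determinant is a functional on the wedge of its rows, and each row of the left matrix is a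
three-term combination of the rows at z - δ, z, z + δ. The factors depending on s and w alone go
into the constant of `apply_prod_chains`. -/
lemma det_rows (hG : GenericPoints L δ x y) (hs : GenericNodes L δ x y s)
    (hz : List.ofFn z = chains α fun i k => x i + k * δ)
    (hw : List.ofFn w = chains β fun k l => y k + l * δ) :
    (Matrix.of fun I J => vanDiejen L g δ a c (thetaFun L g s w J) (z I)).det =
      bcSum L g δ a c x α y β * (Matrix.of fun I J => thetaFun L g s w J (z I)).det := by
  have hlen : ∑ i, α i = N + d := by rw [← length_chains α, ← hz, List.length_ofFn]
  have hw' := fun K => exists_of_ofFn_eq hw K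
  have h := apply_prod_chains (g := g) (a := a) (c := c) (fun z J => thetaFun L g s w J z)
    (detFunctional (N + d))
    ((∏ i : Fin (N + d), ∏ _j ∈ Finset.Ioi i, (-1 : ℂ)) * delta L g s * delta L g w) hG α β ?_
  · rw [det_thetaFun_eq hG hs (fun I => exists_of_ofFn_eq hz I) hw', ← hz, weight_ofFn hw,
      List.map_ofFn, Function.comp_def, detFunctional_prod] at *
    rw [mul_div_assoc, ← h]
    congr 2
    ext I J
    simp only [vanDiejen, Pi.add_apply, Pi.smul_apply, smul_eq_mul]
    ring
  · intro l hl hl'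
    obtain ⟨z', rfl⟩ := exists_ofFn_eq (hl.trans hlen)
    rw [List.map_ofFn, Function.comp_def, detFunctional_prod, weight_ofFn hw]
    rw [det_thetaFun_eq hG hs ?_ hw', mul_div_assoc]
    intro I
    obtain ⟨i, k, h⟩ := hl' (z' I) (List.mem_ofFn.2 ⟨I, rfl⟩)
    exact ⟨i, k - 1, by rw [← h]; simp only [node]; push_cast; ring⟩

lemma detFunctional_mul (f : Fin N → Fin (N + d) → ℂ) (h : Fin d → Fin (N + d) → ℂ) :
    detFunctional (N + d) ((List.ofFn fun i => ι ℂ (f i)).prod * (List.ofFn fun i => ι ℂ (h i)).prod) =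
      (Matrix.of (Fin.append f h)).det := by
  rw [← detFunctional_prod, ← List.prod_append, ← List.ofFn_fin_append]
  congr 3
  funext i
  induction i using Fin.addCases <;> simp

/-- The columns obtained by applying an operator to the parameters of the kernels. -/
def dualColumns (L : PeriodPair) (g δ : ℂ) (a : Fin 8 → ℂ) (c : Fin 4 → ℂ) {N d : ℕ}
    (s : Fin d → ℂ) (w : Fin N → ℂ) : Fin (N + d) → ℂ → ℂ :=
  Fin.append (fun K z => vanDiejen L g δ a c (fun w => kern L g s w z) (w K))
    (fun k => lagr L g s k)

/-- The argument of `det_rows` for the kernel columns, with the wedge X of the unchanged Lagrange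
columns as a fixed right factor. Now w varies along the chains in y, and x, y exchange roles. -/
lemma det_columns (hG : GenericPoints L δ x y) (hs : GenericNodes L δ x y s)
    (hz : List.ofFn z = chains α fun i k => x i + k * δ)
    (hw : List.ofFn w = chains β fun k l => y k + l * δ) :
    (Matrix.of fun I J => dualColumns L g δ a c s w J (z I)).det =
      bcSum L g δ a c y β x α * (Matrix.of fun I J => thetaFun L g s w J (z I)).det := by
  have hlen : ∑ i, β i = N := by rw [← length_chains β, ← hw, List.length_ofFn]
  have hz' := fun I => exists_of_ofFn_eq hz I
  let X := (List.ofFn fun k => ι ℂ fun I => lagr L g s k (z I)).prod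
  -- The weight for exchanged roles uses [w ± z] instead of [z ± w]; the (N + d)N signs are put into
  -- the constant.
  have key : ∀ w' : Fin N → ℂ, (∀ K, ∃ i, ∃ k : ℤ, w' K = y i + k * δ) →
      (Matrix.of fun I J => thetaFun L g s w' J (z I)).det =
      ((∏ i : Fin (N + d), ∏ _j ∈ Finset.Ioi i, (-1 : ℂ)) * delta L g s * delta L g z /
        ((-1) ^ (N + d)) ^ N) * weight L g δ x α (List.ofFn w') := by
    intro w' hw'
    have e1 : ∏ I, ∏ K, brpm L g (z I) (w' K) =
        ((-1) ^ (N + d)) ^ N * ∏ K, ∏ I, brpm L g (w' K) (z I) := by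
      rw [Finset.prod_comm]
      simp_rw [fun I K => brpm_swap (L := L) (g := g) (z I) (w' K), Finset.prod_neg,
        Finset.prod_mul_distrib]
      simp
    rw [det_thetaFun_eq hG hs hz' hw', weight_ofFn hz, e1]
    rw [div_mul_div_comm]
    congr 1
    ring
  have h := apply_prod_chains (g := g) (a := a) (c := c) (fun w I => kern L g s w (z I))
    ((detFunctional (N + d)).comp (LinearMap.mulRight ℂ X))
    ((∏ i : Fin (N + d), ∏ _j ∈ Finset.Ioi i, (-1 : ℂ)) * delta L g s * delta L g z /
      ((-1) ^ (N + d)) ^ N) hG.symm β α ?_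
  · rw [← hw, ← key w (fun K => exists_of_ofFn_eq hw K), LinearMap.comp_apply,
      LinearMap.mulRight_apply, List.map_ofFn, Function.comp_def, detFunctional_mul] at h
    rw [← h, ← Matrix.det_transpose]
    congr 1
    ext J I
    simp only [Matrix.transpose_apply, Matrix.of_apply, dualColumns]
    induction J using Fin.addCases with
    | left K =>
      simp only [Fin.append_left, vanDiejen, Pi.add_apply, Pi.smul_apply, smul_eq_mul]
      ring
    | right k => simp only [Fin.append_right]
  · intro l hl hl'
    obtain ⟨w', rfl⟩ := exists_ofFn_eq (hl.trans hlen)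
    rw [LinearMap.comp_apply, LinearMap.mulRight_apply, List.map_ofFn, Function.comp_def,
      detFunctional_mul, ← key, ← Matrix.det_transpose]
    · congr 1
      ext I J
      simp only [Matrix.transpose_apply, Matrix.of_apply, thetaFun]
      induction J using Fin.addCases <;> simp
    · intro I
      obtain ⟨i, k, h⟩ := hl' (w' I) (List.mem_ofFn.2 ⟨I, rfl⟩)
      exact ⟨i, k - 1, by rw [← h]; simp only [node]; push_cast; ring⟩

/-- The matrix of the operator in the Lagrange basis. -/
def lagrMatrix (L : PeriodPair) (g δ : ℂ) (a : Fin 8 → ℂ) (c : Fin 4 → ℂ) {d : ℕ}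
    (s : Fin d → ℂ) : Matrix (Fin d) (Fin d) ℂ :=
  Matrix.of fun l k => vanDiejen L g δ a c (lagr L g s k) (s l) / lagr L g s l (s l)

/-- The kernel identity and the invariance of the theta space together say that one matrix is the
other times a block lower triangular matrix. -/
lemma det_rows_eq_det_columns (hG : GenericPoints L δ x y) (hs : GenericNodes L δ x y s)
    (hbal : ∑ p, a p = (4 - 2 * (d : ℂ)) * δ)
    (hc : ∀ r, brpm L g ((om L r - δ) / 2) (c r) ≠ 0)
    (hz : ∀ I, ∃ i, ∃ k : ℤ, z I = x i + k * δ) (hw : ∀ K, ∃ i, ∃ k : ℤ, w K = y i + k * δ) :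
    (Matrix.of fun I J => vanDiejen L g δ a c (thetaFun L g s w J) (z I)).det =
      (Matrix.of fun I J => dualColumns L g δ (dualParams δ a) c s w J (z I)).det *
        (lagrMatrix L g δ a c s).det := by
  have hgz : ∀ I, Gen L δ (z I) := fun I => by
    obtain ⟨i, k, h⟩ := hz I
    exact (hG.gen_left i).shift_eq k h
  -- Lagrange coefficients of the correction terms in the kernel identity; they do not enter the
  -- determinant.
  let B : Matrix (Fin d) (Fin N) ℂ :=
    Matrix.of fun l K => kernDiff L g δ a c s (w K) (s l) / lagr L g s l (s l)
  have hmul : (Matrix.of fun I J => vanDiejen L g δ a c (thetaFun L g s w J) (z I)).submatrix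
      finSumFinEquiv finSumFinEquiv =
      (Matrix.of fun I J => dualColumns L g δ (dualParams δ a) c s w J (z I)).submatrix
      finSumFinEquiv finSumFinEquiv * Matrix.fromBlocks 1 0 B (lagrMatrix L g δ a c s) := by
    ext I J
    rw [Matrix.mul_apply, Fintype.sum_sum_type]
    rcases J with K | k
    · simp only [Matrix.submatrix_apply, Matrix.of_apply, finSumFinEquiv_apply_left, thetaFun,
        dualColumns, Fin.append_left, Fin.append_right, Matrix.fromBlocks_apply₁₁,
        Matrix.fromBlocks_apply₂₁, finSumFinEquiv_apply_right, B]
      obtain ⟨j, k, h⟩ := hw K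
      obtain ⟨i, k', h'⟩ := hz (finSumFinEquiv I)
      rw [vanDiejen_kern hG.transverse hs.separated hs.gen hbal hc
        ((hG.gen_right j).shift_eq k h) (fun l => (hs.right j l).shift_eq k 0 h (by simp))
        (hgz _) ((hG.apart i j).shift_eq k' k h' h)]
      congr 1
      · simp [Matrix.one_apply]
      · exact Finset.sum_congr rfl fun l _ => mul_comm _ _
    · simp only [Matrix.submatrix_apply, Matrix.of_apply, finSumFinEquiv_apply_left, thetaFun,
        dualColumns, Fin.append_left, Fin.append_right, Matrix.fromBlocks_apply₁₂,
        Matrix.fromBlocks_apply₂₂, finSumFinEquiv_apply_right, lagrMatrix]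
      rw [vanDiejen_lagr hG.transverse hs.separated hs.gen hbal hc k (hgz _)]
      simp [mul_comm]
  have h := congrArg Matrix.det hmul
  rw [Matrix.det_submatrix_equiv_self, Matrix.det_mul, Matrix.det_submatrix_equiv_self,
    Matrix.det_fromBlocks_zero₁₂, Matrix.det_one, one_mul] at h
  exact h

lemma delta_ne_zero_of_separated (hs : Separated L s) : delta L g s ≠ 0 :=
  Finset.prod_ne_zero_iff.2 fun _ _ => Finset.prod_ne_zero_iff.2 fun _ hj =>
    brpm_ne_zero (hs.add _ _ (Finset.mem_Ioi.1 hj).ne) (hs.sub _ _ (Finset.mem_Ioi.1 hj).ne)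

lemma delta_chains_ne_zero (hG : GenericPoints L δ x y) {M : ℕ} {z : Fin M → ℂ}
    (hz : List.ofFn z = chains α fun i k => x i + k * δ) : delta L g z ≠ 0 := by
  rw [← deltaList_ofFn, hz, deltaList_chains]
  simp only [← node_succ]
  refine mul_ne_zero (Finset.prod_ne_zero_iff.2 fun i _ => Finset.prod_ne_zero_iff.2 fun k _ =>
    Finset.prod_ne_zero_iff.2 fun l hl => ?_) (Finset.prod_ne_zero_iff.2 fun i _ =>
    Finset.prod_ne_zero_iff.2 fun j hj => Finset.prod_ne_zero_iff.2 fun k _ =>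
    Finset.prod_ne_zero_iff.2 fun l _ => ?_)
  · have := Finset.mem_range.1 hl
    rw [brpm_node_eq (fun _ => by omega)]
    exact mul_ne_zero (sumFactor_ne_zero hG _ _ _) (diffFactor_ne_zero hG _ _ _)
  · rw [brpm_node_eq (fun h => absurd h (Finset.mem_Ioi.1 hj).ne')]
    exact mul_ne_zero (sumFactor_ne_zero hG _ _ _) (diffFactor_ne_zero hG _ _ _)

/-- The duality transformation for generic points, up to the value of a determinant. -/
lemma bcSum_eq_det_mul (hG : GenericPoints L δ x y) (hs : GenericNodes L δ x y s)
    (hbal : ∑ p, a p = (4 - 2 * (d : ℂ)) * δ)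
    (hc : ∀ r, brpm L g ((om L r - δ) / 2) (c r) ≠ 0)
    (hα : ∑ i, α i = N + d) (hβ : ∑ k, β k = N) :
    bcSum L g δ a c x α y β =
      (lagrMatrix L g δ a c s).det * bcSum L g δ (dualParams δ a) c y β x α := by
  obtain ⟨z, hz⟩ := exists_ofFn_eq ((length_chains α fun i k => x i + k * δ).trans hα)
  obtain ⟨w, hw⟩ := exists_ofFn_eq ((length_chains β fun i k => y i + k * δ).trans hβ)
  have hz' := fun I => exists_of_ofFn_eq hz I
  have hw' := fun I => exists_of_ofFn_eq hw I
  have h := det_rows_eq_det_columns (g := g) hG hs hbal hc hz' hw'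
  rw [det_rows hG hs hz hw, det_columns hG hs hz hw] at h
  -- Both series appear multiplied by this Cauchy determinant, which can be cancelled at generic
  -- points.
  have h0 : (Matrix.of fun I J => thetaFun L g s w J (z I)).det ≠ 0 := by
    rw [det_thetaFun_eq hG hs hz' hw']
    refine div_ne_zero (mul_ne_zero (mul_ne_zero (mul_ne_zero ?_
      (delta_ne_zero_of_separated hs.separated)) (delta_chains_ne_zero hG.symm hw))
      (delta_chains_ne_zero hG hz)) ?_
    · exact Finset.prod_ne_zero_iff.2 fun _ _ => Finset.prod_ne_zero_iff.2 fun _ _ => by norm_num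
    · refine Finset.prod_ne_zero_iff.2 fun I _ => Finset.prod_ne_zero_iff.2 fun K _ => ?_
      obtain ⟨i, k, h⟩ := hz' I
      obtain ⟨j, l, h'⟩ := hw' K
      exact ((hG.apart i j).shift_eq k l h h').brpm_ne_zero
  refine mul_right_cancel₀ h0 (h.trans ?_)
  ring

end

end EllipticBC

end

open scoped BigOperators

noncomputable section

namespace EllipticBC

variable {L : PeriodPair} {g δ : ℂ} {a : Fin 8 → ℂ} {d : ℕ} {s : Fin d → ℂ}

/-! ### Evaluation of the determinant -/

lemma det_lagr (z : Fin d → ℂ) (hs : ∀ I l, brpm L g (z I) (s l) ≠ 0) :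
    (Matrix.of fun I k => lagr L g s k (z I)).det =
      (∏ i, ∏ j ∈ Finset.Ioi i, brpm L g (s j) (s i)) * delta L g z := by
  have hM : (Matrix.of fun I k => lagr L g s k (z I)) = Matrix.of fun I k => gauge L g s (z I) *
      (Matrix.of fun I k => 1 / brpm L g (z I) (s k)) I k := by
    ext I k
    simp only [Matrix.of_apply, lagr, gauge]
    rw [← Finset.mul_prod_erase _ _ (Finset.mem_univ k)]
    have := hs I k
    field_simp
  have h : ∏ I, gauge L g s (z I) ≠ 0 :=
    Finset.prod_ne_zero_iff.2 fun I _ => Finset.prod_ne_zero_iff.2 fun l _ => hs I l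
  rw [hM, Matrix.det_mul_column, det_one_div_brpm _ _ hs]
  change (∏ I, gauge L g s (z I)) * (_ / ∏ I, gauge L g s (z I)) = _
  rw [mul_div_cancel₀ _ h, mul_comm]

lemma Aminus_self : Aminus L g δ a (a 0) = 0 := by
  rw [Aminus, Finset.prod_eq_zero (Finset.mem_univ 0), zero_div]
  rw [sub_self, br_zero]

lemma Aminus_self_add (ha : a 7 = a 0 + δ) : Aminus L g δ a (a 0 + δ) = 0 := by
  rw [Aminus, Finset.prod_eq_zero (Finset.mem_univ 7), zero_div]
  rw [ha, sub_self, br_zero]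

lemma Azero_self (u : ℂ) : Azero L g δ a (fun _ => u) u = 0 := by
  refine Finset.sum_eq_zero fun r _ => ?_
  rw [AzeroTerm, brpm_self, zero_mul, zero_div, mul_zero]

lemma Gen.brpm_half_ne_zero {u : ℂ} (h : Gen L δ u) (r : Fin 4) :
    brpm L g ((om L r - δ) / 2) u ≠ 0 := by
  refine brpm_ne_zero (notMem_of_two_mul fun h' => h.sub ?_) (notMem_of_two_mul fun h' => h.add ?_)
  · convert! sub_mem h' (om_mem r) using 1; ring
  · rw [← neg_mem_iff]; convert! sub_mem h' (om_mem r) using 1; ring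

lemma Gen.br_ne_zero {u : ℂ} (h : Gen L δ u) (k : ℕ) : br L g (2 * u + k * δ) ≠ 0 :=
  EllipticBC.br_ne_zero (by simpa using h k)

/-- The values of the operator along the chain starting at `a 0`. -/
lemma vanDiejen_chain (ha : a 7 = a 0 + δ) (f : ℂ → ℂ) (j : Fin d) :
    vanDiejen L g δ a (fun _ => a 0) f (a 0 + (j : ℕ) * δ) =
      ∑ k : Fin d, (if k = j then Aplus L g δ a (a 0 + (j : ℕ) * δ) else
        if (k : ℕ) + 1 = j then Azero L g δ a (fun _ => a 0) (a 0 + (j : ℕ) * δ) else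
        if (k : ℕ) + 2 = j then Aminus L g δ a (a 0 + (j : ℕ) * δ) else 0) *
          f (a 0 + ((k : ℕ) + 1 : ℕ) * δ) := by
  obtain ⟨j, hj⟩ := j
  rw [vanDiejen, ← Finset.add_sum_erase _ _ (Finset.mem_univ (⟨j, hj⟩ : Fin d)),
    if_pos rfl, add_assoc]
  congr 1
  · congr 2; push_cast; ring
  rcases j with _ | _ | j
  -- Column k stands for the point a_0 + (k + 1)δ, so a_0 - δ and a_0 must not occur: for j = 0
  -- their coefficients A⁻(a_0) and A⁰(a_0 | a_0) vanish, and for j = 1 the coefficient A⁻(a_7) of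
  -- the value at a_0 does.
  · simp only [Nat.cast_zero, zero_mul, add_zero]
    rw [Azero_self, Aminus_self, zero_mul, zero_mul, add_zero, Finset.sum_eq_zero]
    intro k hk
    have : k ≠ ⟨0, hj⟩ := by simpa using hk
    rw [if_neg this, if_neg (by omega), if_neg (by omega), zero_mul]
  · simp only [zero_add, Nat.cast_one, one_mul]
    rw [Aminus_self_add ha, zero_mul, add_zero, Finset.sum_eq_single ⟨0, by omega⟩]
    · simp
    · intro k hk hk'
      have : k ≠ ⟨1, hj⟩ := by simpa using hk
      have : (k : ℕ) ≠ 0 := fun h => hk' (Fin.ext h)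
      rw [if_neg (by assumption), if_neg (by omega), if_neg (by omega), zero_mul]
    · intro h; simp at h
  · rw [Finset.sum_eq_add (⟨j + 1, by omega⟩ : Fin d) ⟨j, by omega⟩]
    · congr 1
      · simp
      · rw [if_neg (by simp; omega), if_neg (by simp), if_pos rfl]
        congr 2; push_cast; ring
    · simp
    · intro k hk hk'
      have h1 : k ≠ ⟨j + 2, hj⟩ := by simpa using hk
      have h2 : (k : ℕ) ≠ j + 1 := fun h => hk'.1 (Fin.ext h)
      have h3 : (k : ℕ) ≠ j := fun h => hk'.2 (Fin.ext h)
      rw [if_neg h1, if_neg (by simp only; omega), if_neg (by simp only; omega), zero_mul]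
    · intro h; simp at h
    · intro h
      have : j = j + 1 + 1 := by simpa using h
      omega

lemma delta_chain (u : ℂ) (d : ℕ) : delta L g (fun j : Fin d => u + (j : ℕ) * δ) =
    ∏ k ∈ Finset.range d, ∏ l ∈ Finset.range k, brpm L g (u + l * δ) (u + k * δ) := by
  rw [← deltaList_range (fun k => u + k * δ), ← deltaList_ofFn]
  congr 1
  exact List.ext_getElem (by simp) (by simp)

lemma prod_fin_eight (f : Fin 8 → ℂ) : ∏ p, f p = f 0 * f 7 * ∏ p ∈ Finset.Icc (1 : Fin 8) 6, f p := by
  have : Finset.Icc (1 : Fin 8) 6 = {1, 2, 3, 4, 5, 6} := by decide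
  rw [Fin.prod_univ_eight, this]
  simp
  ring

/-- The factors of A⁺ from a_0 and a_7 and its denominators telescope against the shift of the chain
by δ; only the six parameters a_1, …, a_6 remain. -/
lemma Aplus_mul_prod_chain (ha : a 7 = a 0 + δ) (h0 : Gen L δ (a 0)) (k : ℕ) :
    Aplus L g δ a (a 0 + k * δ) *
      ∏ l ∈ Finset.range k, brpm L g (a 0 + δ + l * δ) (a 0 + δ + k * δ) =
    (∏ p ∈ Finset.Icc (1 : Fin 8) 6, br L g (a 0 + a p + k * δ)) *
      ∏ l ∈ Finset.range k, brpm L g (a 0 + l * δ) (a 0 + k * δ) := by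
  let u : ℕ → ℂ := fun l => br L g (2 * a 0 + l * δ)
  have hu : ∀ l, u l ≠ 0 := fun l => h0.br_ne_zero l
  have e1 : ∀ l : ℕ, brpm L g (a 0 + δ + l * δ) (a 0 + δ + k * δ) =
      u (k + (l + 1 + 1)) * br L g (l * δ - k * δ) := fun l => by
    simp only [brpm, u]; congr 2
    · push_cast; ring
    · ring
  have e2 : ∀ l : ℕ, brpm L g (a 0 + l * δ) (a 0 + k * δ) =
      u (k + l) * br L g (l * δ - k * δ) := fun l => by
    simp only [brpm, u]; congr 2
    · push_cast; ring
    · ring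
  have e3 : Aplus L g δ a (a 0 + k * δ) = u k * u (k + 1) *
      (∏ p ∈ Finset.Icc (1 : Fin 8) 6, br L g (a 0 + a p + k * δ)) / (u (k + k) * u (k + k + 1)) := by
    rw [Aplus, prod_fin_eight, ha]
    simp only [u]
    congr 2
    · congr 2
      · ring
      · push_cast; ring
    · refine Finset.prod_congr rfl fun p _ => ?_
      congr 1; ring
    · congr 1; push_cast; ring
    · congr 1; push_cast; ring
  have e4 : (∏ l ∈ Finset.range k, u (k + (l + 1 + 1))) * u (k + (0 + 1)) * u (k + 0) =
      (∏ l ∈ Finset.range k, u (k + l)) * u (k + k) * u (k + (k + 1)) := by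
    rw [← Finset.prod_range_succ, ← Finset.prod_range_succ (fun l => u (k + l)),
      Finset.prod_range_succ', Finset.prod_range_succ']
  simp_rw [e1, e2]
  rw [e3, Finset.prod_mul_distrib, Finset.prod_mul_distrib, div_mul_eq_mul_div,
    div_eq_iff (mul_ne_zero (hu _) (hu _))]
  simp only [zero_add, add_zero, ← add_assoc] at e4 ⊢
  linear_combination ((∏ p ∈ Finset.Icc (1 : Fin 8) 6, br L g (a 0 + a p + k * δ)) *
    ∏ l ∈ Finset.range k, br L g (l * δ - k * δ)) * e4

/-- Evaluating the operator on the Lagrange basis along a_0 + jδ factors it through the triangular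
matrix T and the values along the chain shifted by δ. The two value matrices have product
determinants by `det_lagr`, and the dependence on the nodes cancels. -/
lemma det_lagrMatrix (hδ : Transverse L δ) (hs : Separated L s) (hgs : ∀ l, Gen L δ (s l))
    (hbal : ∑ p, a p = (4 - 2 * (d : ℂ)) * δ) (ha : a 7 = a 0 + δ) (h0 : Gen L δ (a 0))
    (h0s : ∀ l, Apart L δ (a 0) (s l)) :
    (lagrMatrix L g δ a (fun _ => a 0) s).det =
      ∏ p ∈ Finset.Icc (1 : Fin 8) 6, brPoch L g δ (a 0 + a p) d := by
  let T : Matrix (Fin d) (Fin d) ℂ := Matrix.of fun j k =>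
    if k = j then Aplus L g δ a (a 0 + (j : ℕ) * δ) else
        if (k : ℕ) + 1 = j then Azero L g δ a (fun _ => a 0) (a 0 + (j : ℕ) * δ) else
        if (k : ℕ) + 2 = j then Aminus L g δ a (a 0 + (j : ℕ) * δ) else 0
  have hap : ∀ (k : ℕ) l, Apart L δ (a 0 + k * δ) (s l) := fun k l =>
    (h0s l).shift_eq k 0 (by norm_cast) (by simp)
  have hmul : (Matrix.of fun (j : Fin d) k => lagr L g s k (a 0 + (j : ℕ) * δ)) *
      lagrMatrix L g δ a (fun _ => a 0) s =
      T * Matrix.of fun (j : Fin d) k => lagr L g s k (a 0 + ((j : ℕ) + 1 : ℕ) * δ) := by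
    ext j k
    rw [Matrix.mul_apply, Matrix.mul_apply]
    simp only [T, Matrix.of_apply, lagrMatrix]
    rw [← vanDiejen_chain ha (lagr L g s k) j, vanDiejen_lagr hδ hs hgs hbal
      (fun r => h0.brpm_half_ne_zero r) k (h0.shift_eq (j : ℕ) (by norm_cast))]
    exact Finset.sum_congr rfl fun l _ => mul_comm _ _
  have hT : T.det = ∏ j : Fin d, Aplus L g δ a (a 0 + (j : ℕ) * δ) := by
    rw [Matrix.det_of_isLowerTriangular]
    · exact Finset.prod_congr rfl fun j _ => by simp [T]
    · intro j k hjk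
      have : (j : ℕ) < k := by simpa using hjk
      simp only [T, Matrix.of_apply]
      rw [if_neg (by rintro rfl; omega), if_neg (by omega), if_neg (by omega)]
  have h := congrArg Matrix.det hmul
  rw [Matrix.det_mul, Matrix.det_mul, hT, det_lagr _ (fun I l => (hap _ l).brpm_ne_zero),
    det_lagr _ (fun I l => (hap _ l).brpm_ne_zero)] at h
  have hσ : ∏ i, ∏ j ∈ Finset.Ioi i, brpm L g (s j) (s i) ≠ 0 :=
    Finset.prod_ne_zero_iff.2 fun _ _ => Finset.prod_ne_zero_iff.2 fun _ hj =>
      brpm_ne_zero (hs.add _ _ (Finset.mem_Ioi.1 hj).ne') (hs.sub _ _ (Finset.mem_Ioi.1 hj).ne')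
  have e1 : (fun j : Fin d => a 0 + ((j : ℕ) + 1 : ℕ) * δ) =
      fun j : Fin d => a 0 + δ + (j : ℕ) * δ := by
    funext j; push_cast; ring
  rw [e1, delta_chain, delta_chain, mul_left_comm _ _ (∏ k ∈ Finset.range d, _), mul_assoc] at h
  have h2 := mul_left_cancel₀ hσ h
  rw [Fin.prod_univ_eq_prod_range (fun j : ℕ => Aplus L g δ a (a 0 + j * δ)),
    ← Finset.prod_mul_distrib, Finset.prod_congr rfl fun k _ => Aplus_mul_prod_chain ha h0 k,
    Finset.prod_mul_distrib, mul_comm] at h2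
  have hne : ∏ k ∈ Finset.range d, ∏ l ∈ Finset.range k,
      brpm L g (a 0 + l * δ) (a 0 + k * δ) ≠ 0 := by
    refine Finset.prod_ne_zero_iff.2 fun k _ => Finset.prod_ne_zero_iff.2 fun l hl =>
      brpm_ne_zero ?_ ?_
    · convert! h0 (l + k) using 1; push_cast; ring_nf
    · have := Finset.mem_range.1 hl
      convert! hδ (l - k) (by omega) using 1; push_cast; ring_nf
  rw [mul_right_cancel₀ hne h2, Finset.prod_comm]
  rfl

end EllipticBC

end

open scoped BigOperators

noncomputable section

namespace EllipticBC

open Filter Topology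

variable {L : PeriodPair} {g δ : ℂ} {m n : ℕ}

/-! ### Generic points -/

lemma countable_setOf_mem_lattice {ι : Type*} [Countable ι] (A B : ι → ℂ) (hB : ∀ i, B i ≠ 0) :
    {t : ℂ | ∃ i, A i + B i * t ∈ L.lattice}.Countable := by
  have : {t : ℂ | ∃ i, A i + B i * t ∈ L.lattice} =
      ⋃ i, (fun t => A i + B i * t) ⁻¹' (L.lattice : Set ℂ) := by
    ext t; simp
  rw [this]
  refine Set.countable_iUnion fun i => (countable_lattice L).preimage_of_injOn ?_
  intro t _ t' _ h
  exact mul_left_cancel₀ (hB i) (add_left_cancel h)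

lemma exists_gen_apart {ι : Type*} [Countable ι] (q : ι → ℂ) :
    ∃ u, Gen L δ u ∧ ∀ i, Apart L δ (q i) u := by
  have h := countable_setOf_mem_lattice (L := L) (ι := ℤ ⊕ (ι × ℤ) ⊕ (ι × ℤ))
    (Sum.elim (fun j => j * δ) (Sum.elim (fun p => q p.1 + p.2 * δ) fun p => q p.1 + p.2 * δ))
    (Sum.elim (fun _ => 2) (Sum.elim (fun _ => 1) fun _ => -1))
    (by rintro (_ | _ | _) <;> simp)
  obtain ⟨u, hu⟩ := exists_notMem_of_countable h
  simp only [Set.mem_ofPred_eq, Sum.exists, Sum.elim_inl, Sum.elim_inr, Prod.exists, not_or,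
    not_exists] at hu
  refine ⟨u, fun j hj => hu.1 j ?_, fun i j => ⟨fun hj => hu.2.1 i j ?_, fun hj => hu.2.2 i j ?_⟩⟩
  · convert! hj using 1; ring
  · convert! hj using 1; ring
  · convert! hj using 1; ring

/-- A single generic u suffices: the nodes u + lδ are separated because u is generic and no nonzero
multiple of δ is a period. -/
lemma exists_genericNodes (hδ : Transverse L δ) (x : Fin m → ℂ) (y : Fin n → ℂ) (v : ℂ) (d : ℕ) :
    ∃ s : Fin d → ℂ, GenericNodes L δ x y s ∧ ∀ l, Apart L δ v (s l) := by
  obtain ⟨u, hu, hq⟩ := exists_gen_apart (L := L) (δ := δ)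
    (Sum.elim x (Sum.elim y fun _ : Unit => v))
  have hs : ∀ (l : Fin d) i, Apart L δ (Sum.elim x (Sum.elim y fun _ : Unit => v) i)
      (u + (l : ℕ) * δ) := fun l i => (hq i).shift_eq 0 (l : ℕ) (by simp) (by norm_cast)
  refine ⟨fun l => u + (l : ℕ) * δ, ⟨⟨fun l => ?_, fun i j hij => ?_, fun i j hij => ?_⟩,
    fun l => hu.shift_eq (l : ℕ) (by norm_cast), fun i l => hs l (Sum.inl i),
    fun k l => hs l (Sum.inr (Sum.inl k))⟩, fun l => hs l (Sum.inr (Sum.inr ()))⟩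
  · convert! hu (2 * (l : ℕ)) using 1; push_cast; ring_nf
  · convert! hu ((i : ℕ) + (j : ℕ)) using 1; push_cast; ring_nf
  · convert! hδ ((i : ℕ) - (j : ℕ)) (sub_ne_zero.2 fun h => hij (Fin.ext (by exact_mod_cast h)))
      using 1
    push_cast; ring_nf

lemma bcSum_duality_of_generic {x : Fin m → ℂ} {y : Fin n → ℂ} (hG : GenericPoints L δ x y)
    {α : Fin m → ℕ} {β : Fin n → ℕ} {M N : ℕ} (hMN : N ≤ M) (hα : ∑ i, α i = M)
    (hβ : ∑ k, β k = N) {a : Fin 8 → ℂ} (hbal : ∑ p, a p = (4 - 2 * (M : ℂ) + 2 * (N : ℂ)) * δ)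
    (ha : a 7 = a 0 + δ) (h0 : Gen L δ (a 0)) :
    bcSum L g δ a (fun _ => a 0) x α y β = (∏ p ∈ Finset.Icc (1 : Fin 8) 6,
      brPoch L g δ (a 0 + a p) (M - N)) * bcSum L g δ (dualParams δ a) (fun _ => a 0) y β x α := by
  obtain ⟨s, hs, h0s⟩ := exists_genericNodes hG.transverse x y (a 0) (M - N)
  have hbal' : ∑ p, a p = (4 - 2 * ((M - N : ℕ) : ℂ)) * δ := by
    rw [hbal, Nat.cast_sub hMN]; ring
  rw [bcSum_eq_det_mul hG hs hbal' (fun r => h0.brpm_half_ne_zero r)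
    (hα.trans (Nat.add_sub_cancel' hMN).symm) hβ,
    det_lagrMatrix hG.transverse hs.separated hs.gen hbal' ha h0 h0s]

/-- Evenness in c reconciles the constant a_0 of the determinant identity with b_0 = δ - a_7 = -a_0.
-/
lemma Azero_neg_const (a : Fin 8 → ℂ) (u : ℂ) :
    Azero L g δ a (fun _ => -u) = Azero L g δ a fun _ => u := by
  funext z
  simp only [Azero, AzeroTerm, brpm_neg_right]

lemma bcSum_neg_const (a : Fin 8 → ℂ) (u : ℂ) (x : Fin m → ℂ) (α : Fin m → ℕ) (y : Fin n → ℂ)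
    (β : Fin n → ℕ) :
    bcSum L g δ a (fun _ => -u) x α y β = bcSum L g δ a (fun _ => u) x α y β := by
  have h : ∀ σ z, Cfun L g δ a (fun _ => -u) σ z = Cfun L g δ a (fun _ => u) σ z := fun σ z => by
    rw [Cfun, Cfun, Azero_neg_const]
  simp only [bcSum, bcTerm, h]

/-! ### Continuity -/

section Continuity

variable {a : ℂ → Fin 8 → ℂ} {c : ℂ → Fin 4 → ℂ} {x : ℂ → Fin m → ℂ} {y : ℂ → Fin n → ℂ}

@[fun_prop]
lemma Continuous.br {f : ℂ → ℂ} (hf : Continuous f) : Continuous fun t => br L g (f t) :=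
  (continuous_br L g).comp hf

@[fun_prop]
lemma Continuous.brpm {f h : ℂ → ℂ} (hf : Continuous f) (hh : Continuous h) :
    Continuous fun t => brpm L g (f t) (h t) := by
  unfold EllipticBC.brpm; fun_prop

@[fun_prop]
lemma Continuous.brPoch {f : ℂ → ℂ} (hf : Continuous f) (k : ℕ) :
    Continuous fun t => brPoch L g δ (f t) k := by
  unfold EllipticBC.brPoch; fun_prop

lemma brPoch_ne_zero_of_le {u : ℂ} {k l : ℕ} (h : brPoch L g δ u k ≠ 0) (hl : l ≤ k) :
    brPoch L g δ u l ≠ 0 :=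
  Finset.prod_ne_zero_iff.2 fun j hj => Finset.prod_ne_zero_iff.1 h j (Finset.range_mono hl hj)

lemma continuousAt_finset_prod {ι : Type*} {s : Finset ι} {f : ι → ℂ → ℂ} {t : ℂ}
    (h : ∀ i ∈ s, ContinuousAt (f i) t) : ContinuousAt (fun t => ∏ i ∈ s, f i t) t :=
  tendsto_finsetProd s h

lemma continuousAt_finset_sum {ι : Type*} {s : Finset ι} {f : ι → ℂ → ℂ} {t : ℂ}
    (h : ∀ i ∈ s, ContinuousAt (f i) t) : ContinuousAt (fun t => ∑ i ∈ s, f i t) t :=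
  tendsto_finsetSum s h

lemma continuousAt_div {f h : ℂ → ℂ} {t : ℂ} (hf : Continuous f) (hh : Continuous h)
    (h0 : h t ≠ 0) : ContinuousAt (fun t => f t / h t) t :=
  hf.continuousAt.div hh.continuousAt h0

lemma continuousAt_div_mul_div {f h f' h' : ℂ → ℂ} {t : ℂ} (hf : Continuous f) (hh : Continuous h)
    (hf' : Continuous f') (hh' : Continuous h') (h0 : h t ≠ 0) (h0' : h' t ≠ 0) :
    ContinuousAt (fun t => f t / h t * (f' t / h' t)) t :=
  (continuousAt_div hf hh h0).mul (continuousAt_div hf' hh' h0')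

lemma continuousAt_continuant {P Q R : ℕ → ℂ → ℂ} {t : ℂ} {N : ℕ}
    (hP : ∀ k < N, ContinuousAt (P k) t) (hQ : ∀ k < N, ContinuousAt (Q k) t)
    (hR : ∀ k < N, ContinuousAt (R k) t) (ν σ : ℕ) (h : ν + σ ≤ N) :
    ContinuousAt (fun t => continuant (fun k => P k t) (fun k => Q k t) (fun k => R k t) ν σ) t := by
  induction σ using Nat.twoStepInduction with
  | zero => simp only [continuant]; exact continuousAt_const
  | one => simp only [continuant]; exact hQ _ (by omega)
  | more σ h1 h2 =>
    simp only [continuant]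
    exact ((hQ _ (by omega)).mul (h2 (by omega))).sub
      (((hR _ (by omega)).mul (hP _ (by omega))).mul (h1 (by omega)))

/-- Writing C_σ as a continuant reduces its continuity to that of A⁺, A⁰ and A⁻ at x_i + kδ with k <
α_i. A Pochhammer denominator of full length α_i controls all the shorter ones. -/
lemma continuousAt_bcTerm (ha : Continuous a) (hc : Continuous c) (hx : Continuous x)
    (hy : Continuous y) {α : Fin m → ℕ} {β : Fin n → ℕ} {t : ℂ}
    (h : DenominatorsNonzero L g δ (c t) (x t) α (y t) β) {ν μ : Fin m → ℕ} (hν : ν ≤ μ)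
    (hμ : μ ≤ α) :
    ContinuousAt (fun t => bcTerm L g δ (a t) (c t) (x t) α (y t) β ν μ) t := by
  have hplus : ∀ i, ∀ k < α i, ContinuousAt (fun t => Aplus L g δ (a t) (x t i + k * δ)) t :=
    fun i k hk => continuousAt_div (by fun_prop) (by fun_prop)
      (mul_ne_zero (h.atPlusMinus i k hk).1 (h.atPlusMinus i k hk).2.1)
  have hminus : ∀ i, ∀ k < α i, ContinuousAt (fun t => Aminus L g δ (a t) (x t i + k * δ)) t :=
    fun i k hk => continuousAt_div (by fun_prop) (by fun_prop)
      (mul_ne_zero (h.atPlusMinus i k hk).1 (h.atPlusMinus i k hk).2.2)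
  have hzero : ∀ i, ∀ k < α i,
      ContinuousAt (fun t => Azero L g δ (a t) (c t) (x t i + k * δ)) t := by
    intro i k hk
    refine continuousAt_finset_sum fun r _ => ContinuousAt.mul ?_ ?_
    · have := differentiable_e.continuous
      exact (continuous_const.mul (this.comp (by fun_prop))).continuousAt
    · exact continuousAt_div (by fun_prop) (by fun_prop)
        (mul_ne_zero (mul_ne_zero two_ne_zero (h.atZero i k hk r).1) (h.atZero i k hk r).2)
  have hνμ : ∀ i, ν i ≤ μ i := hν
  have hμα : ∀ i, μ i ≤ α i := hμ
  have hle : ∀ i, α i - μ i ≤ α i := fun i => Nat.sub_le _ _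
  have hνα : ∀ i, ν i ≤ α i := fun i => (hνμ i).trans (hμα i)
  unfold bcTerm
  refine ContinuousAt.mul ?_ (continuousAt_finset_prod fun i _ => continuousAt_finset_prod fun j _ =>
    continuousAt_div_mul_div (by fun_prop) (by fun_prop) (by fun_prop) (by fun_prop)
      (brPoch_ne_zero_of_le (h.mixedMu i j).1 (hle i))
      (brPoch_ne_zero_of_le (h.mixedMu i j).2 (hle i)))
  refine ContinuousAt.mul ?_ (continuousAt_finset_prod fun i _ => continuousAt_finset_prod fun j _ =>
    continuousAt_div_mul_div (by fun_prop) (by fun_prop) (by fun_prop) (by fun_prop)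
      (brPoch_ne_zero_of_le (h.mixedNu i j).1 (hνα i))
      (brPoch_ne_zero_of_le (h.mixedNu i j).2 (hνα i)))
  refine ContinuousAt.mul ?_ (continuousAt_finset_prod fun i _ => continuousAt_finset_prod fun j _ =>
    continuousAt_div_mul_div (by fun_prop) (by fun_prop) (by fun_prop) (by fun_prop)
      (brPoch_ne_zero_of_le (h.pochMu i j).1 (hle i))
      (brPoch_ne_zero_of_le (h.pochMu i j).2 (hle i)))
  refine ContinuousAt.mul ?_ (continuousAt_finset_prod fun i _ => continuousAt_finset_prod fun j _ =>
    ContinuousAt.mul (ContinuousAt.mul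
      (continuousAt_div_mul_div (by fun_prop) (by fun_prop) (by fun_prop) (by fun_prop)
        (h.shiftMu i j _ (hμα j)) (h.shiftNu i j _ (hνα i)))
      (continuousAt_div (by fun_prop) (by fun_prop)
        (brPoch_ne_zero_of_le (h.pochNu i j).1 (hνα i))))
      (continuousAt_div (by fun_prop) (by fun_prop)
        (brPoch_ne_zero_of_le (h.pochNu i j).2 (hνα i))))
  refine ContinuousAt.mul ?_ (continuousAt_finset_prod fun i _ => continuousAt_finset_prod fun j hj =>
    continuousAt_div_mul_div (by fun_prop) (by fun_prop) (by fun_prop) (by fun_prop)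
      (h.pair i j (Finset.mem_Ioi.1 hj)).1 (h.pair i j (Finset.mem_Ioi.1 hj)).2)
  refine ContinuousAt.mul (ContinuousAt.mul continuousAt_const ?_)
    (continuousAt_finset_prod fun i _ =>
      continuousAt_div_mul_div (by fun_prop) (by fun_prop) (by fun_prop) (by fun_prop)
        (h.single i).1 (h.single i).2)
  refine continuousAt_finset_prod fun i _ => ContinuousAt.mul (ContinuousAt.mul ?_ ?_) ?_
  · refine continuousAt_finset_prod fun k hk => hminus i k ?_
    exact (Finset.mem_range.1 hk).trans_le (hνα i)
  · refine continuousAt_finset_prod fun k hk => ?_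
    have := Finset.mem_range.1 hk
    have e : ∀ t, x t i + μ i * δ + k * δ = x t i + ((μ i + k : ℕ) : ℂ) * δ := fun t => by
      push_cast; ring
    simp only [e]
    exact hplus i _ (by omega)
  · simp only [Cfun_eq_continuant]
    exact continuousAt_continuant (hminus i) (hzero i) (hplus i) _ _
      (by have := hνμ i; have := hμα i; omega)

lemma continuousAt_bcSum (ha : Continuous a) (hc : Continuous c) (hx : Continuous x)
    (hy : Continuous y) {α : Fin m → ℕ} {β : Fin n → ℕ} {t : ℂ}
    (h : DenominatorsNonzero L g δ (c t) (x t) α (y t) β) :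
    ContinuousAt (fun t => bcSum L g δ (a t) (c t) (x t) α (y t) β) t :=
  continuousAt_finset_sum fun _ hμ => continuousAt_finset_sum fun _ hν =>
    continuousAt_bcTerm ha hc hx hy h (Finset.mem_Icc.1 hν).2 (Finset.mem_Icc.1 hμ).2

end Continuity

end EllipticBC

end

open scoped BigOperators

noncomputable section

namespace EllipticBC

open Filter Topology

variable {L : PeriodPair} {g δ : ℂ} {m n : ℕ}

/-! ### Reduction to generic points -/

/-- Distinct positive rates make each of 2P, P ± Q and 2v a nonconstant affine function of t. Each
condition therefore excludes countably many t, and so do all of them together. -/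
lemma dense_gen_apart {ι : Type*} [Countable ι] (P : ι → ℂ) {κ : ι → ℕ} (hκ : κ.Injective)
    (hκ0 : ∀ p, κ p ≠ 0) (v : ℂ) :
    Dense {t : ℂ | (∀ p, Gen L δ (P p + κ p * t)) ∧
      (∀ p q, p ≠ q → Apart L δ (P p + κ p * t) (P q + κ q * t)) ∧ Gen L δ (v + t)} := by
  let J := {pq : ι × ι // pq.1 ≠ pq.2}
  have h := countable_setOf_mem_lattice (L := L) (ι := (ι × ℤ) ⊕ (J × ℤ) ⊕ (J × ℤ) ⊕ ℤ)
    (Sum.elim (fun p => 2 * P p.1 + p.2 * δ) (Sum.elim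
      (fun p => P p.1.1.1 + P p.1.1.2 + p.2 * δ) (Sum.elim
      (fun p => P p.1.1.1 - P p.1.1.2 + p.2 * δ) fun j => 2 * v + j * δ)))
    (Sum.elim (fun p => 2 * κ p.1) (Sum.elim (fun p => κ p.1.1.1 + κ p.1.1.2)
      (Sum.elim (fun p => κ p.1.1.1 - κ p.1.1.2) fun _ => 2)))
    (by
      rintro (p | p | p | p)
      · simpa using hκ0 p.1
      · have := hκ0 p.1.1.1
        simp only [Sum.elim_inl, Sum.elim_inr]
        exact_mod_cast (by omega)
      · simp only [Sum.elim_inl, Sum.elim_inr]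
        exact sub_ne_zero.2 fun h => p.1.2 (hκ (by exact_mod_cast h))
      · simp)
  refine (h.dense_compl ℂ).mono fun t ht => ?_
  simp only [Set.mem_compl_iff, Set.mem_ofPred_eq, Sum.exists, Sum.elim_inl, Sum.elim_inr,
    Prod.exists, not_or, not_exists] at ht
  obtain ⟨h1, h2, h3, h4⟩ := ht
  refine ⟨fun p j hj => h1 p j ?_, fun p q hpq j =>
    ⟨fun hj => h2 ⟨(p, q), hpq⟩ j ?_, fun hj => h3 ⟨(p, q), hpq⟩ j ?_⟩, fun j hj => h4 j ?_⟩ <;>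
  · convert! hj using 1; ring

/-- The displacement rates of the points of the two families. -/
def rate (m n : ℕ) : Fin m ⊕ Fin n → ℕ := Sum.elim (fun i => i + 1) fun k => m + k + 1

lemma dense_genericPoints (hδ : Transverse L δ) (x : Fin m → ℂ) (y : Fin n → ℂ) (v : ℂ) :
    Dense {t : ℂ | GenericPoints L δ (fun i => x i + rate m n (.inl i) * t)
      (fun k => y k + rate m n (.inr k) * t) ∧ Gen L δ (v + t)} := by
  have hκ : (rate m n).Injective := by
    rintro (i | i) (j | j) h <;> simp only [rate, Sum.elim_inl, Sum.elim_inr] at h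
    · exact congrArg _ (Fin.ext (by omega))
    · omega
    · omega
    · exact congrArg _ (Fin.ext (by omega))
  refine (dense_gen_apart (Sum.elim x y) hκ ?_ v).mono fun t ht => ⟨⟨hδ, fun i => ht.1 (.inl i),
    fun k => ht.1 (.inr k), fun i j h => ht.2.1 (.inl i) (.inl j) (by simpa using h),
    fun i j h => ht.2.1 (.inr i) (.inr j) (by simpa using h),
    fun i k => ht.2.1 (.inl i) (.inr k) (by simp)⟩, ht.2.2⟩
  rintro (i | i) <;> simp [rate]

lemma dualParams_zero {a : Fin 8 → ℂ} (ha : a 7 = a 0 + δ) : dualParams δ a 0 = -a 0 := by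
  simp [dualParams, ha]

lemma continuous_dualParams {a : ℂ → Fin 8 → ℂ} (ha : Continuous a) :
    Continuous fun t => dualParams δ (a t) := by
  refine continuous_pi fun p => ?_
  fin_cases p <;> simp [dualParams] <;> fun_prop

lemma bcSum_duality (hδ : Transverse L δ) {x : Fin m → ℂ} {y : Fin n → ℂ}
    {α : Fin m → ℕ} {β : Fin n → ℕ} {M N : ℕ} (hMN : N ≤ M) (hα : ∑ i, α i = M)
    (hβ : ∑ k, β k = N) {a : Fin 8 → ℂ} (hbal : ∑ p, a p = (4 - 2 * (M : ℂ) + 2 * (N : ℂ)) * δ)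
    (ha : a 7 = a 0 + δ) (hx : DenominatorsNonzero L g δ (fun _ => a 0) x α y β)
    (hy : DenominatorsNonzero L g δ (fun _ => dualParams δ a 0) y β x α) :
    bcSum L g δ a (fun _ => a 0) x α y β =
      (∏ p ∈ Finset.Icc (1 : Fin 8) 6, brPoch L g δ (a 0 + a p) (M - N)) *
        bcSum L g δ (dualParams δ a) (fun _ => dualParams δ a 0) y β x α := by
  -- This direction keeps both Σ a_p and the relation a_7 = a_0 + δ while moving a_0 to a generic
  -- value.
  let A : ℂ → Fin 8 → ℂ := fun t p => a p + ![1, -2, 0, 0, 0, 0, 0, 1] p * t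
  let X : ℂ → Fin m → ℂ := fun t i => x i + rate m n (.inl i) * t
  let Y : ℂ → Fin n → ℂ := fun t k => y k + rate m n (.inr k) * t
  have hA : Continuous A := by fun_prop
  have hX : Continuous X := by fun_prop
  have hY : Continuous Y := by fun_prop
  have hB : Continuous fun t => dualParams δ (A t) := continuous_dualParams hA
  have hA0 : A 0 = a := by funext p; simp [A]
  have hX0 : X 0 = x := by funext i; simp [X]
  have hY0 : Y 0 = y := by funext k; simp [Y]
  have hl : ContinuousAt (fun t => bcSum L g δ (A t) (fun _ => A t 0) (X t) α (Y t) β) 0 :=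
    continuousAt_bcSum hA (by fun_prop) hX hY (by rw [hA0, hX0, hY0]; exact hx)
  have hr : ContinuousAt (fun t => (∏ p ∈ Finset.Icc (1 : Fin 8) 6,
      brPoch L g δ (A t 0 + A t p) (M - N)) * bcSum L g δ (dualParams δ (A t))
        (fun _ => dualParams δ (A t) 0) (Y t) β (X t) α) 0 :=
    ContinuousAt.mul (Continuous.continuousAt (by fun_prop))
      (continuousAt_bcSum hB (by fun_prop) hY hX (by rw [hA0, hX0, hY0]; exact hy))
  have hd := dense_genericPoints hδ x y (a 0)
  -- Density of the generic parameters lets t tend to 0 through them; both sides are continuous at t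
  -- = 0 because no denominator vanishes there.
  have hne : (𝓝[{t : ℂ | GenericPoints L δ (X t) (Y t) ∧ Gen L δ (a 0 + t)}] 0).NeBot :=
    mem_closure_iff_nhdsWithin_neBot.1 (hd 0)
  have key := tendsto_nhds_unique_of_eventuallyEq (hl.mono_left nhdsWithin_le_nhds)
    (hr.mono_left (nhdsWithin_le_nhds (s := {t : ℂ | GenericPoints L δ (X t) (Y t) ∧
      Gen L δ (a 0 + t)}))) (by
      filter_upwards [self_mem_nhdsWithin] with t ht
      have ha' : A t 7 = A t 0 + δ := by simp [A, ha]; ring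
      have h0 : Gen L δ (A t 0) := by simpa [A] using ht.2
      have hbal' : ∑ p, A t p = (4 - 2 * (M : ℂ) + 2 * (N : ℂ)) * δ := by
        rw [← hbal, Fin.sum_univ_eight, Fin.sum_univ_eight]
        simp [A]; ring
      rw [bcSum_duality_of_generic ht.1 hMN hα hβ hbal' ha' h0, dualParams_zero ha',
        bcSum_neg_const])
  simpa only [hA0, hX0, hY0] using key

end EllipticBC

end

/-! ### The duality transformation -/

theorem mainTheorem8
    (L : PeriodPair) (g δ : ℂ) (hδ₀ : δ ≠ 0)
    (hδ : ∀ k : ℤ, (k : ℂ) * δ ∈ L.lattice → (k : ℂ) * δ = 0)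
    (m n M N : ℕ) (hMN : N ≤ M)
    (α : Fin m → ℕ) (β : Fin n → ℕ) (hα : ∑ i, α i = M) (hβ : ∑ k, β k = N)
    (a b : Fin 8 → ℂ) (hbal : ∑ p, a p = (4 - 2 * (M : ℂ) + 2 * (N : ℂ)) * δ)
    (ha : a 7 = a 0 + δ) (hb : b = EllipticBC.dualParams δ a)
    (x : Fin m → ℂ) (y : Fin n → ℂ)
    (hx : EllipticBC.DenominatorsNonzero L g δ (fun _ => a 0) x α y β)
    (hy : EllipticBC.DenominatorsNonzero L g δ (fun _ => b 0) y β x α) :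
    EllipticBC.bcSum L g δ a (fun _ => a 0) x α y β =
      (∏ p ∈ Finset.Icc (1 : Fin 8) 6, EllipticBC.brPoch L g δ (a 0 + a p) (M - N)) *
        EllipticBC.bcSum L g δ b (fun _ => b 0) y β x α := by
  subst hb
  refine EllipticBC.bcSum_duality (fun k hk h => ?_) hMN hα hβ hbal ha hx hy
  rcases mul_eq_zero.1 (hδ k h) with h | h
  · exact hk (by exact_mod_cast h)
  · exact hδ₀ h
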